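/- Let $\bar{\mathcal L}_0$ be the class of equations $$u_t+uu_x=A^2(t,x)u_{xx}+\bigl(A^{11}x+A^{10}\bigr)u_x$$ for an unknown function $u(t,x)$, parameterized by the tuples $\bar\theta=(A^{10},A^{11},A^2,Y^0,Y^1,Y^2)$ of smooth functions of $(t,x)$ on open sets with $$A^{10}_x=A^{11}_x=Y^0_x=Y^1_x=Y^2_x=0,\quad A^2\ne0,\quad Y^0_t=A^{11},\quad Y^1_t=e^{Y^0},\quad Y^2_t=A^{10}e^{Y^0}.$$ All transformations are local: a point transformation of a space is a smooth diffeomorphism between open subsets of it. An *admissible transformation* is a triple $(\bar\theta,\varphi,\tilde{\bar\theta})$ where $\bar\theta,\tilde{\bar\theta}$ are such tuples and $\varphi$ is a point transformation of the $(t,x,u)$-space whose second prolongation maps the equation with $\bar\theta$ to the equation with $\tilde{\bar\theta}$. A *generalized equivalence transformation* is a point transformation $\mathcal T$ of the space with coordinates $(t,x,u,A^{10},A^{11},A^2,Y^0,Y^1,Y^2)$ such that for every tuple $\bar\theta$, locally near every point of its graph in the domain of $\mathcal T$, substituting $\bar\theta(t,x)$ for the arbitrary elements in the $(t,x,u)$-components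 of $\mathcal T$ gives a point transformation $\varphi$, substituting it in the remaining components gives a tuple $\tilde{\bar\theta}$ of the class in the new variables, and $(\bar\theta,\varphi,\tilde{\bar\theta})$ is an admissible transformation, said to be *generated* by $\mathcal T$. **Theorem.** The class $\bar{\mathcal L}_0$ is normalized in the generalized sense: every admissible transformation (with $\varphi$ defined on a convex open set) is generated by a generalized equivalence transformation. The generalized equivalence transformations constitute a pseudogroup $\bar G^\sim_0$, the generalized equivalence group of the class, and its elements (with convex domains) are exactly the point transformations of the form $$\tilde t=\bar T,\quad \tilde x=(\bar{\mathrm D}_t\bar T)(c_1Y^1+c_0)x+\bar X^0,\quad \tilde u=(c_1Y^1+c_0)u-c_1e^{Y^0}x+c_2-c_1Y^2,$$ $$\tilde A^2=(\bar{\mathrm D}_t\bar T)(c_1Y^1+c_0)^2A^2,\quad \tilde A^{11}=\frac{B}{\bar{\mathrm D}_t\bar T},\quad B:=A^{11}-\frac{\bar{\mathrm D}_t^2\bar T}{\bar{\mathrm D}_t\bar T}-\frac{2c_1e^{Y^0}}{c_1Y^1+c_0},$$ $$\tilde A^{10}=(c_1Y^1+c_0)A^{10}-\frac{\bar{\mathrm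 D}_t\bar X^0}{\bar{\mathrm D}_t\bar T}+c_2-c_1Y^2-\frac{\bar X^0}{\bar{\mathrm D}_t\bar T}\,B,$$ $$\tilde Y^0=Y^0+\ln\frac{\delta}{(\bar{\mathrm D}_t\bar T)(c_1Y^1+c_0)^2},\quad \tilde Y^1=\frac{c_1'Y^1+c_0'}{c_1Y^1+c_0},$$ $$\tilde Y^2=\frac{\delta Y^2}{c_1Y^1+c_0}-\frac{\delta\bar X^0e^{Y^0}}{(\bar{\mathrm D}_t\bar T)(c_1Y^1+c_0)^2}+c_2\frac{c_1'Y^1+c_0'}{c_1Y^1+c_0}+c_3.$$ Here $\bar T=\bar T(t,Y^1)$ and $\bar X^0=\bar X^0(t,Y^0,Y^1,Y^2)$ are smooth functions, $c_0,c_1,c_2,c_3,c_0',c_1'$ are constants, $\delta:=c_1'c_0-c_0'c_1$, on functions of $(t,Y^0,Y^1,Y^2)$ the restricted total derivative is $\bar{\mathrm D}_t=\partial_t+A^{11}\partial_{Y^0}+e^{Y^0}\partial_{Y^1}+A^{10}e^{Y^0}\partial_{Y^2}$, and on the domain of the transformation $c_1Y^1+c_0\neq0$ and $\delta\,\bar{\mathrm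 D}_t\bar T>0$. -/

import Mathlib

open scoped ContDiff Topology

namespace BurgersL0

/-! ### Spaces of variables -/

/-- The space with coordinates `(t, x, u)`. -/
abbrev Pt : Type := ℝ × ℝ × ℝ

/-- The space of values `(A¹⁰, A¹¹, A², Y⁰, Y¹, Y²)` of the arbitrary elements. -/
abbrev Val : Type := ℝ × ℝ × ℝ × ℝ × ℝ × ℝ

/-- The space with coordinates `((t, x, u), (A¹⁰, A¹¹, A², Y⁰, Y¹, Y²))`, on which generalized
equivalence transformations act. -/
abbrev Ext : Type := Pt × Val

/-- The projection `(t, x, u) ↦ (t, x)`. -/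
def tx (p : Pt) : ℝ × ℝ := (p.1, p.2.1)

/-- Partial derivative in the first variable `t` of a function of `(t, x)`. -/
noncomputable def dt (f : ℝ → ℝ → ℝ) (t x : ℝ) : ℝ := deriv (fun s => f s x) t

/-- Partial derivative in the second variable `x` of a function of `(t, x)`. -/
noncomputable def dx (f : ℝ → ℝ → ℝ) (t x : ℝ) : ℝ := deriv (fun y => f t y) x

/-- `f`, as a function of `(t, x)`, is smooth on `Ω`. -/
def SmoothOn (f : ℝ → ℝ → ℝ) (Ω : Set (ℝ × ℝ)) : Prop :=
  ContDiffOn ℝ ∞ (fun z : ℝ × ℝ => f z.1 z.2) Ω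

/-- `f`, as a function of `(t, x)`, is smooth in a neighbourhood of `z`. -/
def SmoothNear (f : ℝ → ℝ → ℝ) (z : ℝ × ℝ) : Prop :=
  ∀ᶠ w in 𝓝 z, ContDiffAt ℝ ∞ (fun z : ℝ × ℝ => f z.1 z.2) w

/-! ### The class of equations -/

/-- A tuple of functions of `(t, x)`, the candidates for the arbitrary elements
`(A¹⁰, A¹¹, A², Y⁰, Y¹, Y²)`. -/
structure ArbTuple where
  A10 : ℝ → ℝ → ℝ
  A11 : ℝ → ℝ → ℝ
  A2 : ℝ → ℝ → ℝ
  Y0 : ℝ → ℝ → ℝ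
  Y1 : ℝ → ℝ → ℝ
  Y2 : ℝ → ℝ → ℝ

/-- The value of the tuple at (the `(t, x)`-part of) a point. -/
def ArbTuple.val (θ : ArbTuple) (p : Pt) : Val :=
  (θ.A10 p.1 p.2.1, θ.A11 p.1 p.2.1, θ.A2 p.1 p.2.1,
    θ.Y0 p.1 p.2.1, θ.Y1 p.1 p.2.1, θ.Y2 p.1 p.2.1)

/-- The auxiliary system of the class: on the open set `Ω` the tuple `θ` consists of smooth
functions, all of them but `A²` do not depend on `x`, `A²` does not vanish, and
`Y⁰_t = A¹¹`, `Y¹_t = exp Y⁰`, `Y²_t = A¹⁰ exp Y⁰`. -/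
structure IsArbTuple (Ω : Set (ℝ × ℝ)) (θ : ArbTuple) : Prop where
  isOpen : IsOpen Ω
  smooth_A10 : SmoothOn θ.A10 Ω
  smooth_A11 : SmoothOn θ.A11 Ω
  smooth_A2 : SmoothOn θ.A2 Ω
  smooth_Y0 : SmoothOn θ.Y0 Ω
  smooth_Y1 : SmoothOn θ.Y1 Ω
  smooth_Y2 : SmoothOn θ.Y2 Ω
  A10_x : ∀ t x, (t, x) ∈ Ω → dx θ.A10 t x = 0
  A11_x : ∀ t x, (t, x) ∈ Ω → dx θ.A11 t x = 0
  Y0_x : ∀ t x, (t, x) ∈ Ω → dx θ.Y0 t x = 0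
  Y1_x : ∀ t x, (t, x) ∈ Ω → dx θ.Y1 t x = 0
  Y2_x : ∀ t x, (t, x) ∈ Ω → dx θ.Y2 t x = 0
  A2_ne : ∀ t x, (t, x) ∈ Ω → θ.A2 t x ≠ 0
  Y0_t : ∀ t x, (t, x) ∈ Ω → dt θ.Y0 t x = θ.A11 t x
  Y1_t : ∀ t x, (t, x) ∈ Ω → dt θ.Y1 t x = Real.exp (θ.Y0 t x)
  Y2_t : ∀ t x, (t, x) ∈ Ω → dt θ.Y2 t x = θ.A10 t x * Real.exp (θ.Y0 t x)

/-- The equation `u_t + u u_x = A² u_xx + (A¹¹ x + A¹⁰) u_x` holds for `u = f` at the point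
`(t, x)`, that is, the 2-jet of `f` at `(t, x)` lies on the manifold of the equation. -/
def SolvesAt (θ : ArbTuple) (f : ℝ → ℝ → ℝ) (t x : ℝ) : Prop :=
  dt f t x + f t x * dx f t x
    = θ.A2 t x * dx (dx f) t x + (θ.A11 t x * x + θ.A10 t x) * dx f t x

/-! ### Point transformations and admissible transformations -/

/-- A (local) point transformation of a space: a smooth diffeomorphism between open subsets. -/
def IsPointTransformation {E : Type*} [NormedAddCommGroup E] [NormedSpace ℝ E]
    (e : OpenPartialHomeomorph E E) : Prop :=
  ContDiffOn ℝ ∞ e e.source ∧ ContDiffOn ℝ ∞ e.symm e.target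

/-- The `t`-component of `φ` along the graph of `f`, as a function of `(t, x)`. -/
def tAlong (φ : Pt → Pt) (f : ℝ → ℝ → ℝ) (t x : ℝ) : ℝ := (φ (t, x, f t x)).1

/-- The `x`-component of `φ` along the graph of `f`, as a function of `(t, x)`. -/
def xAlong (φ : Pt → Pt) (f : ℝ → ℝ → ℝ) (t x : ℝ) : ℝ := (φ (t, x, f t x)).2.1

/-- The `u`-component of `φ` along the graph of `f`, as a function of `(t, x)`. -/
def uAlong (φ : Pt → Pt) (f : ℝ → ℝ → ℝ) (t x : ℝ) : ℝ := (φ (t, x, f t x)).2.2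

/-- Near `(t, x)` the transformation `φ` maps the graph of the smooth function `f` to the graph
of the smooth function `g`. The nonvanishing of the Jacobian
`D_t φᵗ D_x φˣ - D_x φᵗ D_t φˣ` is the condition under which the prolongation of `φ`
is defined at the jet of `f`. -/
structure MapsGraph (φ : Pt → Pt) (f g : ℝ → ℝ → ℝ) (t x : ℝ) : Prop where
  smooth_source : SmoothNear f (t, x)
  smooth_target : SmoothNear g (tAlong φ f t x, xAlong φ f t x)
  jacobian_ne : dt (tAlong φ f) t x * dx (xAlong φ f) t x
    - dx (tAlong φ f) t x * dt (xAlong φ f) t x ≠ 0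
  graph : ∀ᶠ z in 𝓝 ((t, x) : ℝ × ℝ),
    g (tAlong φ f z.1 z.2) (xAlong φ f z.1 z.2) = uAlong φ f z.1 z.2

/-- Over the point `p = (t, x, u)` the second prolongation of `φ` maps the manifold of the equation
with arbitrary elements `θ` in the second-order jet space to that of the equation with arbitrary
elements `θ'`: a 2-jet over `p` (represented by a function `f`) satisfies the former equation
if and only if its image (represented by `g`) satisfies the latter one. -/
def ConnectsAt (φ : Pt → Pt) (θ θ' : ArbTuple) (p : Pt) : Prop :=
  ∀ f g : ℝ → ℝ → ℝ, f p.1 p.2.1 = p.2.2 → MapsGraph φ f g p.1 p.2.1 →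
    (SolvesAt θ f p.1 p.2.1 ↔ SolvesAt θ' g (φ p).1 (φ p).2.1)

/-- `(θ, φ, θ')` is an admissible transformation of the class: `θ` and `θ'` are tuples of arbitrary
elements on open sets `Ω` and `Ω'`, and the point transformation `φ` of the `(t, x, u)`-space,
which maps points over `Ω` to points over `Ω'`, connects the corresponding equations. -/
structure IsAdmissible (Ω : Set (ℝ × ℝ)) (θ : ArbTuple) (φ : OpenPartialHomeomorph Pt Pt)
    (Ω' : Set (ℝ × ℝ)) (θ' : ArbTuple) : Prop where
  source : IsArbTuple Ω θ
  target : IsArbTuple Ω' θ'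
  point : IsPointTransformation φ
  source_mem : ∀ p ∈ φ.source, tx p ∈ Ω
  target_mem : ∀ p ∈ φ.source, tx (φ p) ∈ Ω'
  connects : ∀ p ∈ φ.source, ConnectsAt φ θ θ' p

/-! ### Generalized equivalence transformations and normalization -/

/-- The transformation `e` of the extended space generates `(θ, φ, θ')`: substituting the functions
`θ(t, x)` for the arbitrary elements into the `(t, x, u)`-components of `e` gives `φ`,
and substituting them into the remaining components gives `θ'` in the new variables. -/
def Generates (e : OpenPartialHomeomorph Ext Ext) (θ : ArbTuple)
    (φ : OpenPartialHomeomorph Pt Pt) (θ' : ArbTuple) : Prop :=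
  ∀ p ∈ φ.source, (p, θ.val p) ∈ e.source ∧ e (p, θ.val p) = (φ p, θ'.val (φ p))

/-- Generalized equivalence transformations of the class: point transformations of the extended
space that generate an admissible transformation from every tuple of arbitrary elements, locally
around each point at which the substitution is possible. -/
def IsGenEquiv (e : OpenPartialHomeomorph Ext Ext) : Prop :=
  IsPointTransformation e ∧
  ∀ (Ω : Set (ℝ × ℝ)) (θ : ArbTuple), IsArbTuple Ω θ →
    ∀ p : Pt, tx p ∈ Ω → (p, θ.val p) ∈ e.source →
      ∃ (φ : OpenPartialHomeomorph Pt Pt) (Ω' : Set (ℝ × ℝ)) (θ' : ArbTuple),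
        p ∈ φ.source ∧ IsAdmissible Ω θ φ Ω' θ' ∧ Generates e θ φ θ'

/-- The class is normalized in the generalized sense: every admissible transformation is generated
by a generalized equivalence transformation. As usual for local objects, the domains of the
admissible transformations are taken to be convex (every point has such neighbourhoods). -/
def IsNormalizedGen : Prop :=
  ∀ (Ω Ω' : Set (ℝ × ℝ)) (θ θ' : ArbTuple) (φ : OpenPartialHomeomorph Pt Pt),
    IsAdmissible Ω θ φ Ω' θ' → Convex ℝ φ.source →
      ∃ e : OpenPartialHomeomorph Ext Ext, IsGenEquiv e ∧ Generates e θ φ θ'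

/-! ### The explicit family of transformations -/

/-- The restricted total derivative with respect to `t`,
`∂_t + A¹¹ ∂_{Y⁰} + exp Y⁰ ∂_{Y¹} + A¹⁰ exp Y⁰ ∂_{Y²}`, of a function `F` of `(t, Y⁰, Y¹, Y²)`.
(The terms with `∂_{A¹⁰}`, `∂_{A¹¹}` and `∂_{A²}` annihilate such functions.) -/
noncomputable def Dbar (a10 a11 : ℝ) (F : ℝ → ℝ → ℝ → ℝ → ℝ) (t y0 y1 y2 : ℝ) : ℝ :=
  deriv (fun s => F s y0 y1 y2) t
    + a11 * deriv (fun s => F t s y1 y2) y0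
    + Real.exp y0 * deriv (fun s => F t y0 s y2) y1
    + a10 * Real.exp y0 * deriv (fun s => F t y0 y1 s) y2

/-- A function of `(t, Y¹)` as a function of `(t, Y⁰, Y¹, Y²)`. -/
def lift (T : ℝ → ℝ → ℝ) : ℝ → ℝ → ℝ → ℝ → ℝ := fun t _ y1 _ => T t y1

/-- `e` has the form of the theorem. Here `DT` and `DDT` are the first and the second
total derivatives of `T`; as `T` depends on `(t, Y¹)` only, `DT` does not depend on
`A¹⁰`, `A¹¹` and `A²`, so that its total derivative is `Dbar` as well. -/
def HasForm (e : OpenPartialHomeomorph Ext Ext) : Prop :=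
  ∃ (T : ℝ → ℝ → ℝ) (X : ℝ → ℝ → ℝ → ℝ → ℝ) (c0 c1 c2 c3 c0' c1' δ : ℝ),
    δ = c1' * c0 - c0' * c1 ∧
    ContDiffOn ℝ ∞ (fun z : ℝ × ℝ => T z.1 z.2)
      {z | ∃ x u a10 a11 a2 y0 y2,
        (((z.1, x, u), (a10, a11, a2, y0, z.2, y2)) : Ext) ∈ e.source} ∧
    ContDiffOn ℝ ∞ (fun z : ℝ × ℝ × ℝ × ℝ => X z.1 z.2.1 z.2.2.1 z.2.2.2)
      {z | ∃ x u a10 a11 a2,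
        (((z.1, x, u), (a10, a11, a2, z.2.1, z.2.2.1, z.2.2.2)) : Ext) ∈ e.source} ∧
    ∀ t x u a10 a11 a2 y0 y1 y2 : ℝ,
      (((t, x, u), (a10, a11, a2, y0, y1, y2)) : Ext) ∈ e.source →
      let X0 := X t y0 y1 y2
      let DX0 := Dbar a10 a11 X t y0 y1 y2
      let DT := Dbar a10 a11 (lift T) t y0 y1 y2
      let DDT := Dbar a10 a11 (Dbar a10 a11 (lift T)) t y0 y1 y2
      let U := c1 * y1 + c0
      let B := a11 - DDT / DT - 2 * c1 * Real.exp y0 / U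
      U ≠ 0 ∧ 0 < δ * DT ∧
      e ((t, x, u), (a10, a11, a2, y0, y1, y2)) =
        (( T t y1,
           DT * U * x + X0,
           U * u - c1 * Real.exp y0 * x + c2 - c1 * y2 ),
         ( U * a10 - DX0 / DT + c2 - c1 * y2 - X0 / DT * B,
           1 / DT * B,
           DT * U ^ 2 * a2,
           y0 + Real.log (δ / (DT * U ^ 2)),
           (c1' * y1 + c0') / U,
           δ * y2 / U - δ * X0 * Real.exp y0 / (DT * U ^ 2)
             + c2 * ((c1' * y1 + c0') / U) + c3 ))

end BurgersL0

/-! The theorem rests on the determining equations of a single admissible transformation, and on the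
observation that they are ordinary differential equations in t which `Y⁰`, `Y¹`, `Y²` integrate
explicitly.

Necessary conditions. Every 2-jet over a point is represented by a quadratic polynomial, so the jet
variables can be varied freely. Changing u_tt, which is absent from the equation, forces the
t-component T to depend on t only (`IsAdmissible.pd_T`). Changing u_xx and then u_x forces the
x-component to be free of u and the u-component to be affine in u (`IsAdmissible.split_polynomial`,
`IsAdmissible.splitEqs`). Differentiating what remains with respect to u and x gives x̃ = T_t W x +
X and ũ = W u - R x + v, with W_t = R, R_t = A¹¹ R, v_t = -A¹⁰ R and explicit expressions for the
new A¹⁰, A¹¹, A² (`IsAdmissible.det`). Conversely these equations suffice: along every graph the new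
equation times T_t is the old one times W (`connectsAt_of_det`).

Invariants. Since Y⁰_t = A¹¹, Y¹_t = exp Y⁰ and Y²_t = A¹⁰ exp Y⁰, the system has the solution R =
c₁ exp Y⁰, W = c₁ Y¹ + c₀, v = c₂ - c₁ Y². The formulas for the new A¹¹ and A¹⁰ likewise integrate
to formulas for the new Y⁰, Y¹, Y². Thus seven expressions `Frame.inv` have zero derivative
(`Frame.Flow.inv`), hence are constant on a convex domain, and solving for the unknowns gives the
formulas of the theorem (`Frame.formulas`).

Normalization. For an admissible transformation T and X are functions of t alone. With these two
functions and the seven constants, the explicit family contains a member `timeForm` that reproduces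
the transformation along the graph of θ (`isNormalizedGen`).

Form of the group elements. Through each point of the extended space with A² ≠ 0 passes the graph of
a tuple with arbitrary A¹⁰_t, A¹¹_t, A²_t, A²_x (`exists_isArbTuple`, `IsGenEquiv.realize`). The
determining equations of the generated transformations can therefore be split once more, with
respect to these derivatives, and then with respect to A¹⁰ and A¹¹ themselves. This shows that the
invariants are constant, that T depends on (t, Y¹) and that X depends on (t, Y⁰, Y¹, Y²). Points
with A² = 0 lie on no graph and are reached by continuity. Conversely, substitution of a tuple into
the explicit family satisfies the determining equations, so every member is a generalized
equivalence transformation (`HasForm.isGenEquiv`).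

Pseudogroup. Compositions are handled on the level of graphs (`ConnectsAt.comp`). For inverses no
formula is inverted: the differential of the transformation maps certain kernels, among them that of
the contact forms dY⁰ - A¹¹dt, dY¹ - exp(Y⁰)dt, dY² - A¹⁰exp(Y⁰)dt, into kernels of the same
dimension, hence onto them, so the preimage of the graph of a tuple is again locally the graph of a
tuple (`IsGenEquiv.graphlike_symm`). -/

namespace BurgersL0

/-! ### Directional derivatives -/

section Calculus

variable {E : Type*} [NormedAddCommGroup E] [NormedSpace ℝ E]
  {E' : Type*} [NormedAddCommGroup E'] [NormedSpace ℝ E']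

/-- The derivative of a function in the direction of a fixed vector. -/
noncomputable def pd (v : E) (F : E → ℝ) (z : E) : ℝ := fderiv ℝ F z v

/-- `F` is differentiable at `z`, with derivative `a` in the direction `v`. -/
structure HasPd (v : E) (F : E → ℝ) (a : ℝ) (z : E) : Prop where
  diff : DifferentiableAt ℝ F z
  eq : pd v F z = a

theorem smooth_at {F : E → E'} {S : Set E} (hF : ContDiffOn ℝ ∞ F S) (hS : IsOpen S) {z : E}
    (hz : z ∈ S) : DifferentiableAt ℝ F z :=
  (hF.contDiffAt (hS.mem_nhds hz)).differentiableAt (by simp)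

theorem hasPd {F : E → ℝ} {S : Set E} (hF : ContDiffOn ℝ ∞ F S) (hS : IsOpen S) {z : E}
    (hz : z ∈ S) (v : E) : HasPd v F (pd v F z) z :=
  ⟨smooth_at hF hS hz, rfl⟩

theorem pd_add_vec (v w : E) (F : E → ℝ) (z : E) : pd (v + w) F z = pd v F z + pd w F z := by
  simp [pd]

theorem pd_smul_vec (c : ℝ) (v : E) (F : E → ℝ) (z : E) : pd (c • v) F z = c * pd v F z := by
  simp [pd]

theorem HasFDerivAt.hasPd {F : E → ℝ} {L : E →L[ℝ] ℝ} {z : E} (h : HasFDerivAt F L z) (v : E) :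
    HasPd v F (L v) z :=
  ⟨h.differentiableAt, by rw [pd, h.fderiv]⟩

namespace HasPd

variable {v : E} {F G : E → ℝ} {a b : ℝ} {z : E}

theorem hasFDerivAt (h : HasPd v F a z) : HasFDerivAt F (fderiv ℝ F z) z := h.diff.hasFDerivAt

theorem val (h : HasPd v F a z) (hab : a = b) : HasPd v F b z := hab ▸ h

theorem const (c : ℝ) : HasPd v (fun _ : E => c) 0 z :=
  (HasFDerivAt.hasPd (hasFDerivAt_const c z) v).val (by simp)

theorem clm (L : E →L[ℝ] ℝ) : HasPd v (fun z => L z) (L v) z :=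
  HasFDerivAt.hasPd L.hasFDerivAt v

theorem add (hF : HasPd v F a z) (hG : HasPd v G b z) :
    HasPd v (fun z => F z + G z) (a + b) z :=
  (HasFDerivAt.hasPd (hF.hasFDerivAt.add hG.hasFDerivAt) v).val (by
    rw [← hF.eq, ← hG.eq]; rfl)

theorem sub (hF : HasPd v F a z) (hG : HasPd v G b z) :
    HasPd v (fun z => F z - G z) (a - b) z :=
  (HasFDerivAt.hasPd (hF.hasFDerivAt.sub hG.hasFDerivAt) v).val (by
    rw [← hF.eq, ← hG.eq]; rfl)

theorem neg (hF : HasPd v F a z) : HasPd v (fun z => -F z) (-a) z :=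
  (HasFDerivAt.hasPd hF.hasFDerivAt.neg v).val (by rw [← hF.eq]; rfl)

theorem mul (hF : HasPd v F a z) (hG : HasPd v G b z) :
    HasPd v (fun z => F z * G z) (a * G z + F z * b) z :=
  (HasFDerivAt.hasPd (hF.hasFDerivAt.mul hG.hasFDerivAt) v).val (by
    rw [← hF.eq, ← hG.eq]
    simp only [add_apply, smul_apply, smul_eq_mul, pd]
    ring)

theorem comp_deriv {h : ℝ → ℝ} {h' : ℝ} (hh : HasDerivAt h h' (F z)) (hF : HasPd v F a z) :
    HasPd v (fun z => h (F z)) (h' * a) z :=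
  (HasFDerivAt.hasPd (hh.comp_hasFDerivAt z hF.hasFDerivAt) v).val (by
    rw [← hF.eq]; rfl)

theorem inv (hF : HasPd v F a z) (h0 : F z ≠ 0) :
    HasPd v (fun z => (F z)⁻¹) (-(F z ^ 2)⁻¹ * a) z :=
  comp_deriv (hasDerivAt_inv h0) hF

theorem div (hF : HasPd v F a z) (hG : HasPd v G b z) (h0 : G z ≠ 0) :
    HasPd v (fun z => F z / G z) ((a * G z - F z * b) / G z ^ 2) z := by
  have := (hF.mul (hG.inv h0)).val (b := (a * G z - F z * b) / G z ^ 2) (by field_simp; ring)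
  simpa only [div_eq_mul_inv] using this

theorem exp (hF : HasPd v F a z) : HasPd v (fun z => Real.exp (F z)) (Real.exp (F z) * a) z :=
  comp_deriv (Real.hasDerivAt_exp _) hF

theorem log (hF : HasPd v F a z) (h0 : F z ≠ 0) :
    HasPd v (fun z => Real.log (F z)) ((F z)⁻¹ * a) z :=
  comp_deriv (Real.hasDerivAt_log h0) hF

theorem congr_of_eqOn {S : Set E} (hF : HasPd v F a z) (hS : IsOpen S) (hz : z ∈ S)
    (h : Set.EqOn G F S) : HasPd v G a z := by
  have he : G =ᶠ[𝓝 z] F := Filter.eventuallyEq_of_mem (hS.mem_nhds hz) h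
  exact ⟨he.differentiableAt_iff.2 hF.diff, by rw [← hF.eq, pd, pd, he.fderiv_eq]⟩

end HasPd

theorem pd_congr {S : Set E} (hS : IsOpen S) {F G : E → ℝ} (h : Set.EqOn F G S) {z : E}
    (hz : z ∈ S) (v : E) : pd v F z = pd v G z := by
  rw [pd, pd, (Filter.eventuallyEq_of_mem (hS.mem_nhds hz) h).fderiv_eq]

theorem pd_eq_zero {S : Set E} (hS : IsOpen S) {F : E → ℝ} {c : ℝ} (h : ∀ z ∈ S, F z = c) {z : E}
    (hz : z ∈ S) (v : E) : pd v F z = 0 := by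
  rw [pd_congr hS (G := fun _ => c) h hz v]
  exact (HasPd.const c).eq

theorem smooth_pd {S : Set E} (hS : IsOpen S) {F : E → ℝ} (hF : ContDiffOn ℝ ∞ F S) (v : E) :
    ContDiffOn ℝ ∞ (pd v F) S :=
  (hF.fderiv_of_isOpen hS (by simp)).clm_apply contDiffOn_const

theorem pd_comm {S : Set E} (hS : IsOpen S) {F : E → ℝ} (hF : ContDiffOn ℝ ∞ F S) {z : E}
    (hz : z ∈ S) (v w : E) : pd v (pd w F) z = pd w (pd v F) z := by
  have hc : ContDiffAt ℝ ∞ F z := hF.contDiffAt (hS.mem_nhds hz)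
  have hs : IsSymmSndFDerivAt ℝ F z := hc.isSymmSndFDerivAt (by
    rw [minSmoothness_of_isRCLikeNormedField]; exact WithTop.coe_le_coe.2 (le_top (a := (2 : ℕ∞))))
  have hd : DifferentiableAt ℝ (fderiv ℝ F) z :=
    smooth_at (hF.fderiv_of_isOpen hS (by simp)) hS hz
  have key : ∀ v w : E, pd v (pd w F) z = fderiv ℝ (fderiv ℝ F) z v w := by
    intro v w
    have h1 : HasFDerivAt (fun z => fderiv ℝ F z w)
        ((ContinuousLinearMap.apply ℝ ℝ w).comp (fderiv ℝ (fderiv ℝ F) z)) z :=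
      (ContinuousLinearMap.apply ℝ ℝ w).hasFDerivAt.comp z hd.hasFDerivAt
    exact (HasFDerivAt.hasPd h1 v).eq
  rw [key, key]
  exact hs v w

theorem HasPd.comp {G : E → E'} {G' : E →L[ℝ] E'} {F : E' → ℝ} {z : E}
    (hF : DifferentiableAt ℝ F (G z)) (hG : HasFDerivAt G G' z) (v : E) :
    HasPd v (fun z => F (G z)) (pd (G' v) F (G z)) z :=
  HasFDerivAt.hasPd (hF.hasFDerivAt.comp z hG) v

/-- Only the derivative along the segment has to vanish. This turns independence of some variables
into equality of values, and it is the place where convexity of the domains is used. -/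
theorem eq_of_segment {S : Set E} (hS : Convex ℝ S) (hO : IsOpen S) {F : E → ℝ}
    (hF : ContDiffOn ℝ ∞ F S) {z z' : E} (hz : z ∈ S) (hz' : z' ∈ S)
    (h : ∀ w ∈ S, pd (z' - z) F w = 0) : F z = F z' := by
  have hseg : ∀ s ∈ Set.Icc (0 : ℝ) 1, z + s • (z' - z) ∈ S := by
    intro s hs
    exact hS.add_smul_sub_mem hz hz' hs
  have hd : ∀ s ∈ Set.Icc (0 : ℝ) 1,
      HasDerivAt (fun s : ℝ => F (z + s • (z' - z))) 0 s := by
    intro s hs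
    have h1 := (smooth_at hF hO (hseg s hs)).hasFDerivAt
    have h2 : HasDerivAt (fun s : ℝ => z + s • (z' - z)) (z' - z) s := by
      simpa using ((hasDerivAt_id s).smul_const (z' - z)).const_add z
    have h3 := h1.comp_hasDerivAt s h2
    rw [show fderiv ℝ F (z + s • (z' - z)) (z' - z) = 0 from h _ (hseg s hs)] at h3
    exact h3
  have := (convex_Icc (0 : ℝ) 1).is_const_of_fderivWithin_eq_zero (𝕜 := ℝ)
    (f := fun s : ℝ => F (z + s • (z' - z)))
    (fun s hs => (hd s hs).differentiableAt.differentiableWithinAt)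
    (fun s hs => by
      have h4 := (hd s hs).hasFDerivAt.hasFDerivWithinAt (s := Set.Icc (0 : ℝ) 1)
      rw [h4.fderivWithin ((uniqueDiffOn_Icc zero_lt_one) s hs)]
      ext; simp)
    (Set.left_mem_Icc.2 zero_le_one) (Set.right_mem_Icc.2 zero_le_one)
  simpa using this

theorem eq_of_pd_zero {S : Set E} (hS : Convex ℝ S) (hO : IsOpen S) {F : E → ℝ}
    (hF : ContDiffOn ℝ ∞ F S) (h : ∀ w ∈ S, ∀ v, pd v F w = 0) {z z' : E} (hz : z ∈ S)
    (hz' : z' ∈ S) : F z = F z' :=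
  eq_of_segment hS hO hF hz hz' fun w hw => h w hw _

/-! ### Inverse functions -/

variable [FiniteDimensional ℝ E]

theorem exists_equiv_of_injective {A : E →L[ℝ] E} (hA : Function.Injective A) :
    ∃ A' : E ≃L[ℝ] E, (A' : E →L[ℝ] E) = A := by
  refine ⟨(LinearEquiv.ofInjectiveEndo (A : E →ₗ[ℝ] E) hA).toContinuousLinearEquiv, ?_⟩
  ext v; rfl

theorem exists_pointTransformation {S : Set E} (hS : IsOpen S) {Φ : E → E}
    (hΦ : ContDiffOn ℝ ∞ Φ S) (hinj : Set.InjOn Φ S)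
    (hd : ∀ z ∈ S, Function.Injective (fderiv ℝ Φ z)) :
    ∃ h : OpenPartialHomeomorph E E, h.source = S ∧ (∀ z, h z = Φ z) ∧
      IsPointTransformation h := by
  have : CompleteSpace E := FiniteDimensional.complete ℝ E
  have hstrict : ∀ z ∈ S, ∃ A : E ≃L[ℝ] E, HasStrictFDerivAt Φ (A : E →L[ℝ] E) z := by
    intro z hz
    obtain ⟨A, hA⟩ := exists_equiv_of_injective (hd z hz)
    have h1 : ContDiffAt ℝ ∞ Φ z := hΦ.contDiffAt (hS.mem_nhds hz)
    exact ⟨A, hA ▸ h1.hasStrictFDerivAt (by simp)⟩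
  let e : PartialEquiv E E := hinj.toPartialEquiv
  -- Openness is a local matter: an invertible strict derivative maps the neighbourhood filter onto
  -- the neighbourhood filter of the image.
  have hopen : IsOpenMap (e.source.domRestrict e) := by
    rw [isOpenMap_iff_nhds_le]
    rintro ⟨z, hz⟩
    obtain ⟨A, hA⟩ := hstrict z hz
    have h1 := hA.map_nhds_eq_of_equiv
    have h2 : Filter.map (e.source.domRestrict e) (𝓝 ⟨z, hz⟩)
        = Filter.map Φ (Filter.map Subtype.val (𝓝 (⟨z, hz⟩ : S))) := by
      rw [Filter.map_map]; rfl
    have h3 := map_nhds_subtype_coe_eq_nhds (p := fun y => y ∈ S) hz (hS.mem_nhds hz)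
    rw [h2, h3, h1]
    exact le_rfl
  let h : OpenPartialHomeomorph E E :=
    OpenPartialHomeomorph.ofContinuousOpenRestrict e hΦ.continuousOn hopen hS
  refine ⟨h, rfl, fun z => rfl, hΦ, ?_⟩
  intro w hw
  have hz : h.symm w ∈ S := h.map_target hw
  obtain ⟨A, hA⟩ := hstrict _ hz
  exact (h.contDiffAt_symm hw hA.hasFDerivAt (hΦ.contDiffAt (hS.mem_nhds hz))).contDiffWithinAt

theorem exists_local_pointTransformation {S : Set E} (hS : IsOpen S) {Φ : E → E}
    (hΦ : ContDiffOn ℝ ∞ Φ S) {z : E} (hz : z ∈ S)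
    (hd : Function.Injective (fderiv ℝ Φ z)) :
    ∃ h : OpenPartialHomeomorph E E, z ∈ h.source ∧ h.source ⊆ S ∧ (∀ z, h z = Φ z) ∧
      IsPointTransformation h := by
  have : CompleteSpace E := FiniteDimensional.complete ℝ E
  obtain ⟨A, hA⟩ := exists_equiv_of_injective hd
  have hc : ContDiffAt ℝ ∞ Φ z := hΦ.contDiffAt (hS.mem_nhds hz)
  have hA' : HasFDerivAt Φ (A : E →L[ℝ] E) z := hA ▸ (smooth_at hΦ hS hz).hasFDerivAt
  let h0 := hc.toOpenPartialHomeomorph Φ hA' (by simp)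
  have hz0 : z ∈ h0.source := hc.mem_toOpenPartialHomeomorph_source hA' (by simp)
  have hcont : ContinuousOn (fderiv ℝ Φ) S :=
    (hΦ.fderiv_of_isOpen (m := ∞) hS (by simp)).continuousOn
  -- The inverse has to be smooth on the whole target, so the source is shrunk until the derivative
  -- is invertible everywhere; invertible operators form an open set.
  have hev : ∀ᶠ y in 𝓝 z, ∃ B : E ≃L[ℝ] E, (B : E →L[ℝ] E) = fderiv ℝ Φ y := by
    have h1 : ContinuousAt (fderiv ℝ Φ) z := hcont.continuousAt (hS.mem_nhds hz)
    have h2 := ContinuousLinearEquiv.nhds A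
    rw [hA] at h2
    filter_upwards [h1.preimage_mem_nhds h2] with y hy
    exact hy
  obtain ⟨O, hO1, hO2, hzO⟩ := eventually_nhds_iff.1 hev
  obtain ⟨h, hs, hh, hp⟩ := exists_pointTransformation
    (S := S ∩ h0.source ∩ O) ((hS.inter h0.open_source).inter hO2) (Φ := Φ)
    (hΦ.mono fun y hy => hy.1.1)
    (fun y hy y' hy' hyy => h0.injOn hy.1.2 hy'.1.2 hyy)
    (fun y hy => by
      obtain ⟨B, hB⟩ := hO1 y hy.2
      rw [← hB]; exact B.injective)
  exact ⟨h, hs ▸ ⟨⟨hz, hz0⟩, hzO⟩, hs ▸ fun y hy => hy.1.1, hh, hp⟩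

theorem IsPointTransformation.fderiv_bijective {h : OpenPartialHomeomorph E E}
    (hp : IsPointTransformation h) {z : E} (hz : z ∈ h.source) :
    Function.Bijective (fderiv ℝ h z) := by
  have h1 := (smooth_at hp.1 h.open_source hz).hasFDerivAt
  have h2 := (smooth_at hp.2 h.open_target (h.map_source hz)).hasFDerivAt
  have h3 := h2.comp z h1
  have h4 : HasFDerivAt (h.symm ∘ h) (ContinuousLinearMap.id ℝ E) z :=
    (hasFDerivAt_id z).congr_of_eventuallyEq
      (Filter.eventuallyEq_of_mem (h.open_source.mem_nhds hz) fun y hy => h.left_inv hy)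
  have h5 := h3.unique h4
  have hinj : Function.Injective (fderiv ℝ h z) := by
    intro v w hvw
    have hv := congrArg (fun A => A v) h5
    have hw := congrArg (fun A => A w) h5
    simp only [ContinuousLinearMap.comp_apply, ContinuousLinearMap.id_apply] at hv hw
    rw [← hv, ← hw, hvw]
  exact ⟨hinj, LinearMap.injective_iff_surjective (f := (fderiv ℝ h z : E →ₗ[ℝ] E)).1 hinj⟩

end Calculus

/-! ### Functions of two variables -/

/-- A function of two variables as a function on the plane. -/
def unc (f : ℝ → ℝ → ℝ) (z : ℝ × ℝ) : ℝ := f z.1 z.2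

theorem dt_eq {f : ℝ → ℝ → ℝ} {t x : ℝ} (h : DifferentiableAt ℝ (unc f) (t, x)) :
    dt f t x = pd (1, 0) (unc f) (t, x) := by
  have h2 : HasDerivAt (fun s : ℝ => (s, x)) ((1, 0) : ℝ × ℝ) t :=
    (hasDerivAt_id t).prodMk (hasDerivAt_const t x)
  exact (h.hasFDerivAt.comp_hasDerivAt t h2).deriv

theorem dx_eq {f : ℝ → ℝ → ℝ} {t x : ℝ} (h : DifferentiableAt ℝ (unc f) (t, x)) :
    dx f t x = pd (0, 1) (unc f) (t, x) := by
  have h2 : HasDerivAt (fun s : ℝ => (t, s)) ((0, 1) : ℝ × ℝ) x :=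
    (hasDerivAt_const x t).prodMk (hasDerivAt_id x)
  exact (h.hasFDerivAt.comp_hasDerivAt x h2).deriv

theorem dxx_eq {f : ℝ → ℝ → ℝ} {O : Set (ℝ × ℝ)} (hO : IsOpen O)
    (hf : ContDiffOn ℝ ∞ (unc f) O) {t x : ℝ} (hz : (t, x) ∈ O) :
    dx (dx f) t x = pd (0, 1) (pd (0, 1) (unc f)) (t, x) := by
  have he : Set.EqOn (unc (dx f)) (pd (0, 1) (unc f)) O := fun z hz =>
    dx_eq (f := f) (t := z.1) (x := z.2) (smooth_at hf hO hz)
  have h1 := (hasPd (smooth_pd hO hf (0, 1)) hO hz (0, 1)).congr_of_eqOn hO hz he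
  rw [dx_eq h1.diff, h1.eq]

theorem pd_plane (F : ℝ × ℝ → ℝ) (z : ℝ × ℝ) (a b : ℝ) :
    pd (a, b) F z = a * pd (1, 0) F z + b * pd (0, 1) F z := by
  rw [← pd_smul_vec, ← pd_smul_vec, ← pd_add_vec]; simp

theorem SmoothNear.exists_open {f : ℝ → ℝ → ℝ} {z : ℝ × ℝ} (h : SmoothNear f z) :
    ∃ O, IsOpen O ∧ z ∈ O ∧ ContDiffOn ℝ ∞ (unc f) O := by
  obtain ⟨O, h1, h2, h3⟩ := eventually_nhds_iff.1 h
  exact ⟨O, h2, h3, fun w hw => (h1 w hw).contDiffWithinAt⟩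

theorem smoothNear_of_open {f : ℝ → ℝ → ℝ} {O : Set (ℝ × ℝ)} (hO : IsOpen O)
    (hf : ContDiffOn ℝ ∞ (unc f) O) {z : ℝ × ℝ} (hz : z ∈ O) : SmoothNear f z := by
  filter_upwards [hO.mem_nhds hz] with w hw
  exact hf.contDiffAt (hO.mem_nhds hw)

theorem HasPd.comp_plane {E : Type*} [NormedAddCommGroup E] [NormedSpace ℝ E]
    {G : ℝ × ℝ → ℝ} {T X : E → ℝ} {v : E} {a b : ℝ} {z : E}
    (hG : DifferentiableAt ℝ G (T z, X z)) (hT : HasPd v T a z) (hX : HasPd v X b z) :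
    HasPd v (fun z => G (T z, X z))
      (a * pd (1, 0) G (T z, X z) + b * pd (0, 1) G (T z, X z)) z := by
  have h := HasPd.comp (F := G) (G := fun z => (T z, X z)) hG
    (hT.hasFDerivAt.prodMk hX.hasFDerivAt) v
  refine h.val ?_
  rw [← hT.eq, ← hX.eq, ← pd_plane]
  rfl

/-! ### The space of the variables `t, x, u` -/

/-- The direction of `t`. -/
def bt : Pt := (1, 0, 0)

/-- The direction of `x`. -/
def bx : Pt := (0, 1, 0)

/-- The direction of `u`. -/
def bu : Pt := (0, 0, 1)

theorem pd_pt (F : Pt → ℝ) (p : Pt) (a b c : ℝ) :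
    pd (a, b, c) F p = a * pd bt F p + b * pd bx F p + c * pd bu F p := by
  rw [← pd_smul_vec, ← pd_smul_vec, ← pd_smul_vec, ← pd_add_vec, ← pd_add_vec]
  simp [bt, bx, bu]

/-- The `t`-component of a map. -/
def cT (φ : Pt → Pt) (p : Pt) : ℝ := (φ p).1

/-- The `x`-component of a map. -/
def cX (φ : Pt → Pt) (p : Pt) : ℝ := (φ p).2.1

/-- The `u`-component of a map. -/
def cU (φ : Pt → Pt) (p : Pt) : ℝ := (φ p).2.2

section Smooth

variable {φ : Pt → Pt} {S : Set Pt}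

theorem smooth_cT (h : ContDiffOn ℝ ∞ φ S) : ContDiffOn ℝ ∞ (cT φ) S := h.fst
theorem smooth_cX (h : ContDiffOn ℝ ∞ φ S) : ContDiffOn ℝ ∞ (cX φ) S := h.snd.fst
theorem smooth_cU (h : ContDiffOn ℝ ∞ φ S) : ContDiffOn ℝ ∞ (cU φ) S := h.snd.snd

end Smooth

/-! ### Jets -/

/-- The section of the `(t, x, u)`-space defined by a function of `(t, x)`. -/
def graphMap (f : ℝ → ℝ → ℝ) (z : ℝ × ℝ) : Pt := (z.1, z.2, unc f z)

theorem smooth_graphMap {f : ℝ → ℝ → ℝ} {O : Set (ℝ × ℝ)} (hf : ContDiffOn ℝ ∞ (unc f) O) :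
    ContDiffOn ℝ ∞ (graphMap f) O :=
  contDiffOn_fst.prodMk (contDiffOn_snd.prodMk hf)

theorem HasPd.graph {f : ℝ → ℝ → ℝ} {F : Pt → ℝ} {z : ℝ × ℝ}
    (hf : DifferentiableAt ℝ (unc f) z) (hF : DifferentiableAt ℝ F (graphMap f z))
    (w : ℝ × ℝ) :
    HasPd w (fun z => F (graphMap f z)) (pd (w.1, w.2, pd w (unc f) z) F (graphMap f z)) z :=
  have h : HasFDerivAt (graphMap f) ((ContinuousLinearMap.fst ℝ ℝ ℝ).prod
      ((ContinuousLinearMap.snd ℝ ℝ ℝ).prod (fderiv ℝ (unc f) z))) z :=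
    hasFDerivAt_fst.prodMk (hasFDerivAt_snd.prodMk hf.hasFDerivAt)
  HasPd.comp hF h w

/-- Chain rule with the lifted direction frozen at the point: the turning of that direction along
the graph contributes only the second derivative of f times F_u. -/
theorem pd_pd_graph {f : ℝ → ℝ → ℝ} {F : Pt → ℝ} {S : Set Pt} (hS : IsOpen S)
    (hF : ContDiffOn ℝ ∞ F S) {O : Set (ℝ × ℝ)} (hO : IsOpen O)
    (hf : ContDiffOn ℝ ∞ (unc f) O) (hfS : ∀ z ∈ O, graphMap f z ∈ S)
    {z : ℝ × ℝ} (hz : z ∈ O) (w : ℝ × ℝ) :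
    pd w (pd w (fun z => F (graphMap f z))) z
      = pd (w.1, w.2, pd w (unc f) z) (pd (w.1, w.2, pd w (unc f) z) F) (graphMap f z)
        + pd w (pd w (unc f)) z * pd bu F (graphMap f z) := by
  have h1 : Set.EqOn (pd w (fun z => F (graphMap f z)))
      (fun z => w.1 * pd bt F (graphMap f z) + w.2 * pd bx F (graphMap f z)
        + pd w (unc f) z * pd bu F (graphMap f z)) O := by
    intro y hy
    rw [(HasPd.graph (smooth_at hf hO hy) (smooth_at hF hS (hfS y hy)) w).eq, pd_pt]
  have hg : ∀ v : Pt, HasPd w (fun z => pd v F (graphMap f z))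
      (pd (w.1, w.2, pd w (unc f) z) (pd v F) (graphMap f z)) z := fun v =>
    HasPd.graph (smooth_at hf hO hz) (smooth_at (smooth_pd hS hF v) hS (hfS z hz)) w
  have h2 := (((HasPd.const w.1).mul (hg bt)).add ((HasPd.const w.2).mul (hg bx))).add
    ((hasPd (smooth_pd hO hf w) hO hz w).mul (hg bu))
  rw [pd_congr hO h1 hz, h2.eq]
  set m := pd w (unc f) z
  have h3 : Set.EqOn (pd (w.1, w.2, m) F)
      (fun p => w.1 * pd bt F p + w.2 * pd bx F p + m * pd bu F p) S := fun p _ => pd_pt F p _ _ _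
  have hk : ∀ v : Pt, HasPd (w.1, w.2, m) (pd v F)
      (pd (w.1, w.2, m) (pd v F) (graphMap f z)) (graphMap f z) := fun v =>
    hasPd (smooth_pd hS hF v) hS (hfS z hz) _
  have h4 := (((HasPd.const w.1).mul (hk bt)).add ((HasPd.const w.2).mul (hk bx))).add
    ((HasPd.const m).mul (hk bu))
  rw [pd_congr hS h3 (hfS z hz), h4.eq]
  ring

section Jet

variable {φ : Pt → Pt} {S : Set Pt} {f g : ℝ → ℝ → ℝ} {t x : ℝ}

theorem exists_graph_nhds (hS : IsOpen S) (hf : SmoothNear f (t, x)) (hp : (t, x, f t x) ∈ S) :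
    ∃ O, IsOpen O ∧ (t, x) ∈ O ∧ ContDiffOn ℝ ∞ (unc f) O ∧ ∀ z ∈ O, graphMap f z ∈ S := by
  obtain ⟨O, hO, hz, hfO⟩ := hf.exists_open
  refine ⟨O ∩ graphMap f ⁻¹' S, (smooth_graphMap hfO).continuousOn.isOpen_inter_preimage hO hS,
    ⟨hz, hp⟩, hfO.mono fun z hz => hz.1, fun z hz => hz.2⟩

theorem along_t (hS : IsOpen S) {F : Pt → ℝ} (hF : ContDiffOn ℝ ∞ F S) (hf : SmoothNear f (t, x))
    (hp : (t, x, f t x) ∈ S) :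
    dt (fun s y => F (s, y, f s y)) t x
      = pd bt F (t, x, f t x) + dt f t x * pd bu F (t, x, f t x) := by
  obtain ⟨O, hO, hz, hfO, hfS⟩ := exists_graph_nhds hS hf hp
  have h := HasPd.graph (smooth_at hfO hO hz) (smooth_at hF hS (hfS _ hz)) (1, 0)
  rw [dt_eq (smooth_at hfO hO hz), dt_eq (f := fun s y => F (s, y, f s y)) h.diff]
  refine h.eq.trans ?_
  rw [pd_pt]; simp [graphMap, unc]

theorem along_x (hS : IsOpen S) {F : Pt → ℝ} (hF : ContDiffOn ℝ ∞ F S) (hf : SmoothNear f (t, x))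
    (hp : (t, x, f t x) ∈ S) :
    dx (fun s y => F (s, y, f s y)) t x
      = pd bx F (t, x, f t x) + dx f t x * pd bu F (t, x, f t x) := by
  obtain ⟨O, hO, hz, hfO, hfS⟩ := exists_graph_nhds hS hf hp
  have h := HasPd.graph (smooth_at hfO hO hz) (smooth_at hF hS (hfS _ hz)) (0, 1)
  rw [dx_eq (smooth_at hfO hO hz), dx_eq (f := fun s y => F (s, y, f s y)) h.diff]
  refine h.eq.trans ?_
  rw [pd_pt]; simp [graphMap, unc]

/-- The Jacobian of the projection of `φ` along a graph with first derivatives `α`, `β`. -/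
noncomputable def jac (φ : Pt → Pt) (p : Pt) (α β : ℝ) : ℝ :=
  (pd bt (cT φ) p + α * pd bu (cT φ) p) * (pd bx (cX φ) p + β * pd bu (cX φ) p)
    - (pd bx (cT φ) p + β * pd bu (cT φ) p) * (pd bt (cX φ) p + α * pd bu (cX φ) p)

theorem jac_eq (hS : IsOpen S) (hφ : ContDiffOn ℝ ∞ φ S) (hf : SmoothNear f (t, x))
    (hp : (t, x, f t x) ∈ S) :
    dt (tAlong φ f) t x * dx (xAlong φ f) t x - dx (tAlong φ f) t x * dt (xAlong φ f) t x
      = jac φ (t, x, f t x) (dt f t x) (dx f t x) := by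
  rw [jac, ← along_t hS (smooth_cT hφ) hf hp, ← along_t hS (smooth_cX hφ) hf hp,
    ← along_x hS (smooth_cT hφ) hf hp, ← along_x hS (smooth_cX hφ) hf hp]
  rfl

/-- The projection of the image of the graph of `f` to the plane is a local diffeomorphism. -/
theorem exists_graph_chart (hS : IsOpen S) (hφ : ContDiffOn ℝ ∞ φ S) (hf : SmoothNear f (t, x))
    (hp : (t, x, f t x) ∈ S) (hJ : dt (tAlong φ f) t x * dx (xAlong φ f) t x
      - dx (tAlong φ f) t x * dt (xAlong φ f) t x ≠ 0) :
    ∃ (O : Set (ℝ × ℝ)) (h : OpenPartialHomeomorph (ℝ × ℝ) (ℝ × ℝ)),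
      ContDiffOn ℝ ∞ (unc f) O ∧ (∀ z ∈ O, graphMap f z ∈ S) ∧ (t, x) ∈ h.source ∧ h.source ⊆ O ∧
      (∀ z, h z = (tAlong φ f z.1 z.2, xAlong φ f z.1 z.2)) ∧ IsPointTransformation h := by
  obtain ⟨O, hO, hz, hfO, hfS⟩ := exists_graph_nhds hS hf hp
  have hc : ∀ {F : Pt → ℝ}, ContDiffOn ℝ ∞ F S →
      ContDiffOn ℝ ∞ (fun z => F (graphMap f z)) O := fun hF =>
    hF.comp (smooth_graphMap hfO) hfS
  have hT := hc (smooth_cT hφ)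
  have hX := hc (smooth_cX hφ)
  have hinj : Function.Injective (fderiv ℝ
      (fun z => (cT φ (graphMap f z), cX φ (graphMap f z))) (t, x)) := by
    rw [injective_iff_map_eq_zero]
    rintro ⟨a, b⟩ hv
    rw [((smooth_at hT hO hz).hasFDerivAt.prodMk (smooth_at hX hO hz).hasFDerivAt).fderiv] at hv
    have h1 : pd (a, b) (fun z => cT φ (graphMap f z)) (t, x) = 0 := congrArg Prod.fst hv
    have h2 : pd (a, b) (fun z => cX φ (graphMap f z)) (t, x) = 0 := congrArg Prod.snd hv
    have e1 : dt (tAlong φ f) t x = _ := dt_eq (f := tAlong φ f) (smooth_at hT hO hz)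
    have e2 : dx (tAlong φ f) t x = _ := dx_eq (f := tAlong φ f) (smooth_at hT hO hz)
    have e3 : dt (xAlong φ f) t x = _ := dt_eq (f := xAlong φ f) (smooth_at hX hO hz)
    have e4 : dx (xAlong φ f) t x = _ := dx_eq (f := xAlong φ f) (smooth_at hX hO hz)
    rw [pd_plane] at h1 h2
    have h1' : a * dt (tAlong φ f) t x + b * dx (tAlong φ f) t x = 0 := by rw [e1, e2]; exact h1
    have h2' : a * dt (xAlong φ f) t x + b * dx (xAlong φ f) t x = 0 := by rw [e3, e4]; exact h2
    have ha : a = 0 := by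
      refine (mul_eq_zero.1 ?_).resolve_right hJ
      linear_combination dx (xAlong φ f) t x * h1' - dx (tAlong φ f) t x * h2'
    have hb : b = 0 := by
      refine (mul_eq_zero.1 ?_).resolve_right hJ
      linear_combination dt (tAlong φ f) t x * h2' - dt (xAlong φ f) t x * h1'
    rw [ha, hb]; rfl
  obtain ⟨h, hzs, hsO, hh, hpt⟩ := exists_local_pointTransformation hO (hT.prodMk hX) hz hinj
  exact ⟨O, h, hfO, hfS, hzs, hsO, hh, hpt⟩

/-- `ConnectsAt` speaks only about pairs f, g related by `MapsGraph`; this supplies a g for each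
regular f, so that the condition is not empty. -/
theorem exists_mapsGraph (hS : IsOpen S) (hφ : ContDiffOn ℝ ∞ φ S) (hf : SmoothNear f (t, x))
    (hp : (t, x, f t x) ∈ S) (hJ : jac φ (t, x, f t x) (dt f t x) (dx f t x) ≠ 0) :
    ∃ g, MapsGraph φ f g t x := by
  rw [← jac_eq hS hφ hf hp] at hJ
  obtain ⟨O, h, hfO, hfS, hzs, hsO, hh, hpt⟩ := exists_graph_chart hS hφ hf hp hJ
  have hU : ContDiffOn ℝ ∞ (fun z => cU φ (graphMap f z)) O :=
    (smooth_cU hφ).comp (smooth_graphMap hfO) hfS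
  refine ⟨fun s y => cU φ (graphMap f (h.symm (s, y))), hf,
    smoothNear_of_open h.open_target ?_ (hh (t, x) ▸ h.map_source hzs), hJ, ?_⟩
  · exact hU.comp hpt.2 fun w hw => hsO (h.map_target hw)
  filter_upwards [h.open_source.mem_nhds hzs] with z hzz
  rw [← hh z, h.left_inv hzz]
  rfl

/-- The projected graph map is open at the point, so its values fill a neighbourhood and determine
the germ of g. -/
theorem MapsGraph.unique (hS : IsOpen S) (hφ : ContDiffOn ℝ ∞ φ S) (h : MapsGraph φ f g t x)
    {g' : ℝ → ℝ → ℝ} (h' : MapsGraph φ f g' t x) (hp : (t, x, f t x) ∈ S) :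
    ∀ᶠ w in 𝓝 (tAlong φ f t x, xAlong φ f t x), g w.1 w.2 = g' w.1 w.2 := by
  obtain ⟨O, k, -, -, hz, -, hk, -⟩ := exists_graph_chart hS hφ h.smooth_source hp h.jacobian_ne
  have ht := k.map_source hz
  have hc := k.continuousAt_symm ht
  rw [ContinuousAt, k.left_inv hz] at hc
  have hev := hc.eventually (h.graph.and h'.graph)
  rw [hk (t, x)] at hev ht
  filter_upwards [hev, k.open_target.mem_nhds ht] with w hw hwt
  have e := hw.1.trans hw.2.symm
  have e1 : (tAlong φ f (k.symm w).1 (k.symm w).2, xAlong φ f (k.symm w).1 (k.symm w).2) = w :=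
    (hk _).symm.trans (k.right_inv hwt)
  have e2 := congrArg Prod.fst e1
  have e3 := congrArg Prod.snd e1
  simp only at e2 e3
  rwa [e2, e3] at e

theorem MapsGraph.continuousAt (hS : IsOpen S) (hφ : ContDiffOn ℝ ∞ φ S) (h : MapsGraph φ f g t x)
    (hp : (t, x, f t x) ∈ S) :
    ContinuousAt (fun z : ℝ × ℝ => (tAlong φ f z.1 z.2, xAlong φ f z.1 z.2)) (t, x) := by
  obtain ⟨O, k, -, -, hz, -, hk, -⟩ := exists_graph_chart hS hφ h.smooth_source hp h.jacobian_ne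
  rw [← show (k : ℝ × ℝ → ℝ × ℝ) = _ from funext hk]
  exact k.continuousAt hz

/-- The first two equations are the first prolongation. In the second prolongation g_tt and g_tx
carry a factor T_v, so directions with T_v = 0 leave only g_xx, the one second derivative that
occurs in the equations. -/
theorem MapsGraph.jet_second (hS : IsOpen S) (hφ : ContDiffOn ℝ ∞ φ S) (h : MapsGraph φ f g t x)
    (hp : (t, x, f t x) ∈ S) :
    let p : Pt := (t, x, f t x)
    let a := dt g (φ p).1 (φ p).2.1
    let b := dx g (φ p).1 (φ p).2.1
    (pd bt (cU φ) p + dt f t x * pd bu (cU φ) p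
      = a * (pd bt (cT φ) p + dt f t x * pd bu (cT φ) p)
        + b * (pd bt (cX φ) p + dt f t x * pd bu (cX φ) p)) ∧
    (pd bx (cU φ) p + dx f t x * pd bu (cU φ) p
      = a * (pd bx (cT φ) p + dx f t x * pd bu (cT φ) p)
        + b * (pd bx (cX φ) p + dx f t x * pd bu (cX φ) p)) ∧
    ∀ w : ℝ × ℝ,
      let v : Pt := (w.1, w.2, w.1 * dt f t x + w.2 * dx f t x)
      let n := pd w (pd w (unc f)) (t, x)
      pd v (cT φ) p = 0 →
      pd v (pd v (cU φ)) p + n * pd bu (cU φ) p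
        = dx (dx g) (φ p).1 (φ p).2.1 * (pd v (cX φ) p) ^ 2
          + a * (pd v (pd v (cT φ)) p + n * pd bu (cT φ) p)
          + b * (pd v (pd v (cX φ)) p + n * pd bu (cX φ) p) := by
  intro p a b
  obtain ⟨O₁, hO₁, hz₁, hfO₁, hfS₁⟩ := exists_graph_nhds hS h.smooth_source hp
  obtain ⟨Og, hOg, hzg, hgO⟩ := h.smooth_target.exists_open
  obtain ⟨O₂, hO₂g, hO₂, hz₂⟩ := eventually_nhds_iff.1 h.graph
  have hc : ∀ {F : Pt → ℝ}, ContDiffOn ℝ ∞ F S →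
      ContDiffOn ℝ ∞ (fun z => F (graphMap f z)) O₁ := fun hF =>
    hF.comp (smooth_graphMap hfO₁) hfS₁
  have hT₁ := hc (smooth_cT hφ)
  have hX₁ := hc (smooth_cX hφ)
  have hO₃ : IsOpen (O₁ ∩ (fun z => (cT φ (graphMap f z), cX φ (graphMap f z))) ⁻¹' Og) :=
    (hT₁.prodMk hX₁).continuousOn.isOpen_inter_preimage hO₁ hOg
  set O := (O₁ ∩ (fun z => (cT φ (graphMap f z), cX φ (graphMap f z))) ⁻¹' Og) ∩ O₂ with hOdef
  have hO : IsOpen O := hO₃.inter hO₂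
  have hz : (t, x) ∈ O := ⟨⟨hz₁, hzg⟩, hz₂⟩
  have hfO : ContDiffOn ℝ ∞ (unc f) O := hfO₁.mono fun z hz => hz.1.1
  have hfS : ∀ z ∈ O, graphMap f z ∈ S := fun z hz => hfS₁ z hz.1.1
  have hT := hT₁.mono (t := O) fun z hz => hz.1.1
  have hX := hX₁.mono (t := O) fun z hz => hz.1.1
  have hmap : ∀ z ∈ O, (cT φ (graphMap f z), cX φ (graphMap f z)) ∈ Og := fun z hz => hz.1.2
  have hg : Set.EqOn (fun z => cU φ (graphMap f z))
      (fun z => unc g (cT φ (graphMap f z), cX φ (graphMap f z))) O := fun z hz =>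
    (hO₂g z hz.2).symm
  have ha : a = pd (1, 0) (unc g) (cT φ p, cX φ p) := dt_eq (smooth_at hgO hOg (hmap _ hz))
  have hb : b = pd (0, 1) (unc g) (cT φ p, cX φ p) := dx_eq (smooth_at hgO hOg (hmap _ hz))
  have hk : dx (dx g) (φ p).1 (φ p).2.1 = pd (0, 1) (pd (0, 1) (unc g)) (cT φ p, cX φ p) :=
    dxx_eq hOg hgO (hmap _ hz)
  have hft : dt f t x = pd (1, 0) (unc f) (t, x) := dt_eq (smooth_at hfO hO hz)
  have hfx : dx f t x = pd (0, 1) (unc f) (t, x) := dx_eq (smooth_at hfO hO hz)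
  have hfirst : ∀ w : ℝ × ℝ, Set.EqOn (pd w (fun z => cU φ (graphMap f z)))
      (fun z => pd w (fun z => cT φ (graphMap f z)) z
          * pd (1, 0) (unc g) (cT φ (graphMap f z), cX φ (graphMap f z))
        + pd w (fun z => cX φ (graphMap f z)) z
          * pd (0, 1) (unc g) (cT φ (graphMap f z), cX φ (graphMap f z))) O := by
    intro w z hz
    rw [pd_congr hO hg hz]
    exact (HasPd.comp_plane (T := fun z => cT φ (graphMap f z))
      (X := fun z => cX φ (graphMap f z)) (smooth_at hgO hOg (hmap z hz)) (hasPd hT hO hz w)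
      (hasPd hX hO hz w)).eq
  have hgr : ∀ (w : ℝ × ℝ) {F : Pt → ℝ}, ContDiffOn ℝ ∞ F S →
      pd w (fun z => F (graphMap f z)) (t, x)
        = pd (w.1, w.2, w.1 * dt f t x + w.2 * dx f t x) F p := by
    intro w F hF
    rw [(HasPd.graph (smooth_at hfO hO hz) (smooth_at hF hS hp) w).eq, hft, hfx, ← pd_plane]
    rfl
  refine ⟨?_, ?_, ?_⟩
  · have := hfirst (1, 0) hz
    simp only [hgr (1, 0) (smooth_cT hφ), hgr (1, 0) (smooth_cX hφ), hgr (1, 0) (smooth_cU hφ),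
      pd_pt] at this
    rw [ha, hb]
    change _ = _ * pd (1, 0) (unc g) (cT φ p, cX φ p)
      + _ * pd (0, 1) (unc g) (cT φ p, cX φ p) at this
    linear_combination this
  · have := hfirst (0, 1) hz
    simp only [hgr (0, 1) (smooth_cT hφ), hgr (0, 1) (smooth_cX hφ), hgr (0, 1) (smooth_cU hφ),
      pd_pt] at this
    rw [ha, hb]
    change _ = _ * pd (1, 0) (unc g) (cT φ p, cX φ p)
      + _ * pd (0, 1) (unc g) (cT φ p, cX φ p) at this
    linear_combination this
  · intro w v n hv
    have hm : pd w (unc f) (t, x) = w.1 * dt f t x + w.2 * dx f t x := by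
      rw [hft, hfx, ← pd_plane]
    have hsec : ∀ {F : Pt → ℝ}, ContDiffOn ℝ ∞ F S →
        pd w (pd w (fun z => F (graphMap f z))) (t, x) = pd v (pd v F) p + n * pd bu F p := by
      intro F hF
      rw [pd_pd_graph hS hF hO hfO hfS hz w, hm]
      rfl
    have hTw := hgr w (smooth_cT hφ)
    have hXw := hgr w (smooth_cX hφ)
    have h1 : HasPd w (fun z => pd (1, 0) (unc g) (cT φ (graphMap f z), cX φ (graphMap f z)))
        _ (t, x) := HasPd.comp_plane (T := fun z => cT φ (graphMap f z))
      (X := fun z => cX φ (graphMap f z)) (smooth_at (smooth_pd hOg hgO _) hOg (hmap _ hz))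
      (hasPd hT hO hz w) (hasPd hX hO hz w)
    have h2 : HasPd w (fun z => pd (0, 1) (unc g) (cT φ (graphMap f z), cX φ (graphMap f z)))
        _ (t, x) := HasPd.comp_plane (T := fun z => cT φ (graphMap f z))
      (X := fun z => cX φ (graphMap f z)) (smooth_at (smooth_pd hOg hgO _) hOg (hmap _ hz))
      (hasPd hT hO hz w) (hasPd hX hO hz w)
    have h3 := ((hasPd (smooth_pd hO hT w) hO hz w).mul h1).add
      ((hasPd (smooth_pd hO hX w) hO hz w).mul h2)
    rw [← hsec (smooth_cU hφ), ← hsec (smooth_cT hφ), ← hsec (smooth_cX hφ),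
      pd_congr hO (hfirst w) hz, h3.eq, hTw, hXw, ha, hb, hk]
    change pd v (cT φ) p = 0 at hv
    have hv' : pd (w.1, w.2, w.1 * dt f t x + w.2 * dx f t x) (cT φ) p = 0 := hv
    rw [hv']
    change _ * pd (1, 0) (unc g) (cT φ p, cX φ p) + _
      + (_ * pd (0, 1) (unc g) (cT φ p, cX φ p)
        + _ * (_ + _ * pd (0, 1) (pd (0, 1) (unc g)) (cT φ p, cX φ p))) = _
    ring

end Jet

/-! ### Test functions -/

theorem hasPd_fst {E E' : Type*} [NormedAddCommGroup E] [NormedSpace ℝ E] [NormedAddCommGroup E']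
    [NormedSpace ℝ E'] {F : E → ℝ} {z : E × E'} {v : E × E'} {a : ℝ} (h : HasPd v.1 F a z.1) :
    HasPd v (fun z : E × E' => F z.1) a z := by
  have h1 : HasFDerivAt (fun z : E × E' => z.1) (ContinuousLinearMap.fst ℝ E E') z :=
    hasFDerivAt_fst
  exact (HasPd.comp (F := F) h.diff h1 v).val h.eq

theorem hasPd_snd {E E' : Type*} [NormedAddCommGroup E] [NormedSpace ℝ E] [NormedAddCommGroup E']
    [NormedSpace ℝ E'] {F : E' → ℝ} {z : E × E'} {v : E × E'} {a : ℝ} (h : HasPd v.2 F a z.2) :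
    HasPd v (fun z : E × E' => F z.2) a z := by
  have h1 : HasFDerivAt (fun z : E × E' => z.2) (ContinuousLinearMap.snd ℝ E E') z :=
    hasFDerivAt_snd
  exact (HasPd.comp (F := F) h.diff h1 v).val h.eq

theorem hasPd_id (v z : ℝ) : HasPd v (fun z : ℝ => z) v z :=
  HasPd.clm (ContinuousLinearMap.id ℝ ℝ)

theorem hasPd_t (v p : Pt) : HasPd v (fun p : Pt => p.1) v.1 p := hasPd_fst (hasPd_id _ _)

theorem hasPd_x (v p : Pt) : HasPd v (fun p : Pt => p.2.1) v.2.1 p :=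
  hasPd_snd (hasPd_fst (hasPd_id _ _))

theorem hasPd_u (v p : Pt) : HasPd v (fun p : Pt => p.2.2) v.2.2 p :=
  hasPd_snd (hasPd_snd (hasPd_id _ _))

/-- The quadratic function with prescribed value and derivatives at `p`. -/
noncomputable def quad (p : Pt) (α β γ κ : ℝ) (s y : ℝ) : ℝ :=
  p.2.2 + α * (s - p.1) + β * (y - p.2.1) + γ / 2 * ((y - p.2.1) * (y - p.2.1))
    + κ / 2 * ((s - p.1) * (s - p.1))

section Quad

variable (p : Pt) (α β γ κ : ℝ)

theorem smooth_quad : ContDiff ℝ ∞ (unc (quad p α β γ κ)) := by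
  unfold unc quad; fun_prop

theorem pd_quad (w z : ℝ × ℝ) : HasPd w (unc (quad p α β γ κ))
    (w.1 * (α + κ * (z.1 - p.1)) + w.2 * (β + γ * (z.2 - p.2.1))) z := by
  have h1 : HasPd w (fun z : ℝ × ℝ => z.1) w.1 z := hasPd_fst (hasPd_id _ _)
  have h2 : HasPd w (fun z : ℝ × ℝ => z.2) w.2 z := hasPd_snd (hasPd_id _ _)
  have h1' := h1.sub (HasPd.const p.1)
  have h2' := h2.sub (HasPd.const p.2.1)
  exact (((((HasPd.const p.2.2).add ((HasPd.const α).mul h1')).add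
    ((HasPd.const β).mul h2')).add ((HasPd.const (γ / 2)).mul (h2'.mul h2'))).add
    ((HasPd.const (κ / 2)).mul (h1'.mul h1'))).val (by ring)

theorem pd_pd_quad (w z : ℝ × ℝ) :
    pd w (pd w (unc (quad p α β γ κ))) z = γ * w.2 ^ 2 + κ * w.1 ^ 2 := by
  have h1 : HasPd w (fun z : ℝ × ℝ => z.1) w.1 z := hasPd_fst (hasPd_id _ _)
  have h2 : HasPd w (fun z : ℝ × ℝ => z.2) w.2 z := hasPd_snd (hasPd_id _ _)
  have h1' := h1.sub (HasPd.const p.1)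
  have h2' := h2.sub (HasPd.const p.2.1)
  rw [show pd w (unc (quad p α β γ κ)) = fun z =>
    w.1 * (α + κ * (z.1 - p.1)) + w.2 * (β + γ * (z.2 - p.2.1)) from
    funext fun z => (pd_quad p α β γ κ w z).eq]
  rw [(((HasPd.const w.1).mul ((HasPd.const α).add ((HasPd.const κ).mul h1'))).add
    ((HasPd.const w.2).mul ((HasPd.const β).add ((HasPd.const γ).mul h2')))).eq]
  ring

theorem quad_val : quad p α β γ κ p.1 p.2.1 = p.2.2 := by simp [quad]

theorem dt_quad : dt (quad p α β γ κ) p.1 p.2.1 = α := by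
  rw [dt_eq (pd_quad p α β γ κ 0 _).diff, (pd_quad p α β γ κ _ _).eq]; simp

theorem dx_quad : dx (quad p α β γ κ) p.1 p.2.1 = β := by
  rw [dx_eq (pd_quad p α β γ κ 0 _).diff, (pd_quad p α β γ κ _ _).eq]; simp

theorem dxx_quad : dx (dx (quad p α β γ κ)) p.1 p.2.1 = γ := by
  rw [dxx_eq isOpen_univ (smooth_quad p α β γ κ).contDiffOn (Set.mem_univ _), pd_pd_quad]; simp

end Quad

/-! ### The determining equations of admissible transformations -/

section Determination

variable {Ω Ω' : Set (ℝ × ℝ)} {θ θ' : ArbTuple} {φ : OpenPartialHomeomorph Pt Pt} {p : Pt}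

theorem hasPd_components {φ : Pt → Pt} (h : DifferentiableAt ℝ φ p) (v : Pt) :
    pd v (cT φ) p = (fderiv ℝ φ p v).1 ∧ pd v (cX φ) p = (fderiv ℝ φ p v).2.1 ∧
      pd v (cU φ) p = (fderiv ℝ φ p v).2.2 :=
  ⟨(HasFDerivAt.hasPd h.hasFDerivAt.fst v).eq, (HasFDerivAt.hasPd h.hasFDerivAt.snd.fst v).eq,
    (HasFDerivAt.hasPd h.hasFDerivAt.snd.snd v).eq⟩

theorem IsPointTransformation.exists_dir (hφ : IsPointTransformation φ) (hp : p ∈ φ.source)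
    (w : Pt) : ∃ v, pd v (cT φ) p = w.1 ∧ pd v (cX φ) p = w.2.1 ∧ pd v (cU φ) p = w.2.2 := by
  obtain ⟨v, hv⟩ := (hφ.fderiv_bijective hp).2 w
  refine ⟨v, ?_⟩
  obtain ⟨h1, h2, h3⟩ := hasPd_components (smooth_at hφ.1 φ.open_source hp) v
  rw [h1, h2, h3, hv]
  exact ⟨rfl, rfl, rfl⟩

theorem IsPointTransformation.not_dependent (hφ : IsPointTransformation φ) (hp : p ∈ φ.source)
    {a b : ℝ} (ht : pd bt (cU φ) p = a * pd bt (cT φ) p + b * pd bt (cX φ) p)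
    (hx : pd bx (cU φ) p = a * pd bx (cT φ) p + b * pd bx (cX φ) p)
    (hu : pd bu (cU φ) p = a * pd bu (cT φ) p + b * pd bu (cX φ) p) : False := by
  obtain ⟨⟨v1, v2, v3⟩, h1, h2, h3⟩ := hφ.exists_dir hp (0, 0, 1)
  simp only [pd_pt] at h1 h2 h3
  have : (0 : ℝ) = 1 := by
    linear_combination -a * h1 - b * h2 + h3 - v1 * ht - v2 * hx - v3 * hu
  norm_num at this

/-- A graph over `p` with prescribed first derivatives and regular projection. -/
theorem IsAdmissible.jet_condition (h : IsAdmissible Ω θ φ Ω' θ') (hp : p ∈ φ.source)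
    {α β : ℝ} (hJ : jac φ p α β ≠ 0) :
    ∃ a b : ℝ,
      (pd bt (cU φ) p + α * pd bu (cU φ) p
        = a * (pd bt (cT φ) p + α * pd bu (cT φ) p) + b * (pd bt (cX φ) p + α * pd bu (cX φ) p)) ∧
      (pd bx (cU φ) p + β * pd bu (cU φ) p
        = a * (pd bx (cT φ) p + β * pd bu (cT φ) p) + b * (pd bx (cX φ) p + β * pd bu (cX φ) p)) ∧
      ∀ γ κ : ℝ, ∃ k : ℝ,
        (∀ w₁ w₂ : ℝ, pd (w₁, w₂, w₁ * α + w₂ * β) (cT φ) p = 0 →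
          let v : Pt := (w₁, w₂, w₁ * α + w₂ * β)
          let n := γ * w₂ ^ 2 + κ * w₁ ^ 2
          pd v (pd v (cU φ)) p + n * pd bu (cU φ) p
            = k * (pd v (cX φ) p) ^ 2 + a * (pd v (pd v (cT φ)) p + n * pd bu (cT φ) p)
              + b * (pd v (pd v (cX φ)) p + n * pd bu (cX φ) p)) ∧
        (α + p.2.2 * β = θ.A2 p.1 p.2.1 * γ + (θ.A11 p.1 p.2.1 * p.2.1 + θ.A10 p.1 p.2.1) * β ↔
          a + cU φ p * b = θ'.A2 (cT φ p) (cX φ p) * k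
            + (θ'.A11 (cT φ p) (cX φ p) * cX φ p + θ'.A10 (cT φ p) (cX φ p)) * b) := by
  have hS := φ.open_source
  have hφ := h.point.1
  have hpe : ∀ γ κ, ((p.1, p.2.1, quad p α β γ κ p.1 p.2.1) : Pt) = p := fun γ κ => by
    rw [quad_val]
  have key : ∀ γ κ : ℝ, ∃ a b k : ℝ,
      (pd bt (cU φ) p + α * pd bu (cU φ) p
        = a * (pd bt (cT φ) p + α * pd bu (cT φ) p) + b * (pd bt (cX φ) p + α * pd bu (cX φ) p)) ∧
      (pd bx (cU φ) p + β * pd bu (cU φ) p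
        = a * (pd bx (cT φ) p + β * pd bu (cT φ) p) + b * (pd bx (cX φ) p + β * pd bu (cX φ) p)) ∧
        (∀ w₁ w₂ : ℝ, pd (w₁, w₂, w₁ * α + w₂ * β) (cT φ) p = 0 →
          let v : Pt := (w₁, w₂, w₁ * α + w₂ * β)
          let n := γ * w₂ ^ 2 + κ * w₁ ^ 2
          pd v (pd v (cU φ)) p + n * pd bu (cU φ) p
            = k * (pd v (cX φ) p) ^ 2 + a * (pd v (pd v (cT φ)) p + n * pd bu (cT φ) p)
              + b * (pd v (pd v (cX φ)) p + n * pd bu (cX φ) p)) ∧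
        (α + p.2.2 * β = θ.A2 p.1 p.2.1 * γ + (θ.A11 p.1 p.2.1 * p.2.1 + θ.A10 p.1 p.2.1) * β ↔
          a + cU φ p * b = θ'.A2 (cT φ p) (cX φ p) * k
            + (θ'.A11 (cT φ p) (cX φ p) * cX φ p + θ'.A10 (cT φ p) (cX φ p)) * b) := by
    intro γ κ
    have hsm : SmoothNear (quad p α β γ κ) (p.1, p.2.1) :=
      smoothNear_of_open isOpen_univ (smooth_quad p α β γ κ).contDiffOn (Set.mem_univ _)
    obtain ⟨g, hg⟩ := exists_mapsGraph (f := quad p α β γ κ) hS hφ hsm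
      (by rw [hpe]; exact hp) (by rw [hpe, dt_quad, dx_quad]; exact hJ)
    obtain ⟨h1, h2, h3⟩ := hg.jet_second hS hφ (by rw [hpe]; exact hp)
    have hcon := h.connects p hp _ g (quad_val p α β γ κ) hg
    simp only [hpe, dt_quad, dx_quad, pd_pd_quad] at h1 h2 h3
    have hval : g (φ p).1 (φ p).2.1 = (φ p).2.2 := by
      have := hg.graph.self_of_nhds
      simp only [tAlong, xAlong, uAlong, hpe] at this
      exact this
    simp only [SolvesAt, dt_quad, dx_quad, dxx_quad, quad_val, hval] at hcon
    exact ⟨_, _, _, h1, h2, fun w₁ w₂ => h3 (w₁, w₂), hcon⟩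
  -- The first derivatives a, b of the image are fixed by α, β through a linear system with
  -- determinant `jac`, so they are common to all γ, κ.
  obtain ⟨a, b, -, ha, hb, -, -⟩ := key 0 0
  refine ⟨a, b, ha, hb, fun γ κ => ?_⟩
  obtain ⟨a', b', k, ha', hb', h3, h4⟩ := key γ κ
  have hJ' := hJ
  rw [jac] at hJ'
  have e1 : a' = a := by
    refine sub_eq_zero.1 ((mul_eq_zero.1 ?_).resolve_right hJ')
    linear_combination (pd bx (cX φ) p + β * pd bu (cX φ) p) * (ha - ha')
      - (pd bt (cX φ) p + α * pd bu (cX φ) p) * (hb - hb')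
  have e2 : b' = b := by
    refine sub_eq_zero.1 ((mul_eq_zero.1 ?_).resolve_right hJ')
    linear_combination (pd bt (cT φ) p + α * pd bu (cT φ) p) * (hb - hb')
      - (pd bx (cT φ) p + β * pd bu (cT φ) p) * (ha - ha')
  subst e1 e2
  exact ⟨k, h3, h4⟩

theorem IsArbTuple.A2_ne' (h : IsArbTuple Ω θ) {z : ℝ × ℝ} (hz : z ∈ Ω) : θ.A2 z.1 z.2 ≠ 0 :=
  h.A2_ne _ _ hz

theorem IsAdmissible.A2_ne (h : IsAdmissible Ω θ φ Ω' θ') (hp : p ∈ φ.source) :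
    θ.A2 p.1 p.2.1 ≠ 0 := h.source.A2_ne' (h.source_mem p hp)

theorem IsAdmissible.A2_ne' (h : IsAdmissible Ω θ φ Ω' θ') (hp : p ∈ φ.source) :
    θ'.A2 (cT φ p) (cX φ p) ≠ 0 := h.target.A2_ne' (h.target_mem p hp)

/-- Changing f_tt does not affect whether the jet solves the source equation, so it must not change
g_xx on solutions. Unless T_x + β T_u = 0, it would; two admissible values of β then kill T_x and
T_u separately. -/
theorem IsAdmissible.pd_T (h : IsAdmissible Ω θ φ Ω' θ') (hp : p ∈ φ.source) :
    pd bx (cT φ) p = 0 ∧ pd bu (cT φ) p = 0 := by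
  have key : ∀ α β : ℝ, jac φ p α β ≠ 0 → pd bx (cT φ) p + β * pd bu (cT φ) p = 0 := by
    intro α β hJ
    obtain ⟨a, b, h1, h2, h3⟩ := h.jet_condition hp hJ
    have hA := h.A2_ne hp
    have hA' := h.A2_ne' hp
    -- The value of f_xx for which the jet lies on the source equation.
    set γ := (α + p.2.2 * β - (θ.A11 p.1 p.2.1 * p.2.1 + θ.A10 p.1 p.2.1) * β) / θ.A2 p.1 p.2.1
      with hγ
    have hsrc : α + p.2.2 * β
        = θ.A2 p.1 p.2.1 * γ + (θ.A11 p.1 p.2.1 * p.2.1 + θ.A10 p.1 p.2.1) * β := by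
      rw [hγ]; field_simp; ring
    obtain ⟨k₀, e₀, i₀⟩ := h3 γ 0
    obtain ⟨k₁, e₁, i₁⟩ := h3 γ 1
    have hk : k₁ = k₀ := mul_left_cancel₀ hA' (by linear_combination i₀.1 hsrc - i₁.1 hsrc)
    -- The direction tangent to the level line of T along the graph; the second-derivative formula
    -- is available in it.
    set w₁ := -(pd bx (cT φ) p + β * pd bu (cT φ) p) with hw₁
    set w₂ := pd bt (cT φ) p + α * pd bu (cT φ) p with hw₂
    have hv : pd (w₁, w₂, w₁ * α + w₂ * β) (cT φ) p = 0 := by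
      rw [pd_pt, hw₁, hw₂]; ring
    have E₀ := e₀ w₁ w₂ hv
    have E₁ := e₁ w₁ w₂ hv
    simp only at E₀ E₁
    rw [hk] at E₁
    have hw : w₁ ^ 2 * (pd bu (cU φ) p - a * pd bu (cT φ) p - b * pd bu (cX φ) p) = 0 := by
      linear_combination E₁ - E₀
    rcases mul_eq_zero.1 hw with hw | hw
    · have : w₁ = 0 := by simpa using hw
      linarith
    · exfalso
      refine h.point.not_dependent hp (a := a) (b := b) ?_ ?_ ?_
      · linear_combination h1 - α * hw
      · linear_combination h2 - β * hw
      · linear_combination hw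
  -- The Jacobian is affine in α, β, with the 2×2 minors of the rows T, X as coefficients. These
  -- rows are independent, so some minor is nonzero and regular jets with two different β exist.
  set M₁ := pd bt (cT φ) p * pd bx (cX φ) p - pd bx (cT φ) p * pd bt (cX φ) p with hM₁
  set M₂ := pd bu (cT φ) p * pd bx (cX φ) p - pd bx (cT φ) p * pd bu (cX φ) p with hM₂
  set M₃ := pd bt (cT φ) p * pd bu (cX φ) p - pd bu (cT φ) p * pd bt (cX φ) p with hM₃
  have hjac : ∀ α β, jac φ p α β = M₁ + α * M₂ + β * M₃ := by
    intro α β; rw [jac, hM₁, hM₂, hM₃]; ring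
  have two : ∀ β₁ β₂ : ℝ, β₁ ≠ β₂ → pd bx (cT φ) p + β₁ * pd bu (cT φ) p = 0 →
      pd bx (cT φ) p + β₂ * pd bu (cT φ) p = 0 →
      pd bx (cT φ) p = 0 ∧ pd bu (cT φ) p = 0 := by
    intro β₁ β₂ hne h1 h2
    have hu : pd bu (cT φ) p = 0 := by
      refine (mul_eq_zero.1 ?_).resolve_left (sub_ne_zero.2 hne)
      linear_combination h1 - h2
    exact ⟨by linear_combination h1 - β₁ * hu, hu⟩
  by_cases h2 : M₂ = 0
  · by_cases h3 : M₃ = 0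
    · have h1 : M₁ ≠ 0 := by
        intro h1
        obtain ⟨⟨v1, v2, v3⟩, p1, p2, -⟩ := h.point.exists_dir hp (1, 0, 0)
        obtain ⟨⟨w1, w2, w3⟩, q1, q2, -⟩ := h.point.exists_dir hp (0, 1, 0)
        simp only [pd_pt] at p1 p2 q1 q2
        have : (1 : ℝ) = (v1 * w2 - v2 * w1) * M₁ - (v2 * w3 - v3 * w2) * M₂
            + (v1 * w3 - v3 * w1) * M₃ := by
          rw [hM₁, hM₂, hM₃]
          linear_combination (-1 : ℝ) * q2 - p1 * (w1 * pd bt (cX φ) p + w2 * pd bx (cX φ) p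
            + w3 * pd bu (cX φ) p) + p2 * (w1 * pd bt (cT φ) p + w2 * pd bx (cT φ) p
            + w3 * pd bu (cT φ) p)
        rw [h1, h2, h3] at this
        norm_num at this
      exact two 0 1 (by norm_num) (key 0 0 (by rw [hjac, h2, h3]; simpa using h1))
        (key 0 1 (by rw [hjac, h2, h3]; simpa using h1))
    · refine two ((1 - M₁) / M₃) ((2 - M₁) / M₃) ?_ (key 0 _ ?_) (key 0 _ ?_)
      · intro he
        rw [div_left_inj' h3] at he
        linarith
      · rw [hjac, div_mul_cancel₀ _ h3]; norm_num
      · rw [hjac, div_mul_cancel₀ _ h3]; norm_num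
  · refine two 0 1 (by norm_num) (key ((1 - M₁) / M₂) 0 ?_) (key ((1 - M₁ - M₃) / M₂) 1 ?_)
    · rw [hjac, div_mul_cancel₀ _ h2]; norm_num
    · rw [hjac, div_mul_cancel₀ _ h2]; ring_nf; norm_num

theorem pd_pd_xu {S : Set Pt} (hS : IsOpen S) {F : Pt → ℝ} (hF : ContDiffOn ℝ ∞ F S)
    (hp : p ∈ S) (β : ℝ) :
    pd (0, 1, β) (pd (0, 1, β) F) p
      = pd bx (pd bx F) p + 2 * β * pd bx (pd bu F) p + β ^ 2 * pd bu (pd bu F) p := by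
  have h1 : Set.EqOn (pd (0, 1, β) F) (fun p => pd bx F p + β * pd bu F p) S := fun q _ => by
    rw [pd_pt]; ring
  rw [pd_congr hS h1 hp, ((hasPd (smooth_pd hS hF bx) hS hp _).add
    ((HasPd.const β).mul (hasPd (smooth_pd hS hF bu) hS hp _))).eq, pd_pt, pd_pt (pd bu F),
    pd_comm hS hF hp bu bx]
  ring

/-- The equations that are obtained by splitting with respect to the second-order jet variables. -/
structure SplitEqs (θ θ' : ArbTuple) (φ : Pt → Pt) (p : Pt) : Prop where
  Tx : pd bx (cT φ) p = 0
  Tu : pd bu (cT φ) p = 0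
  Xu : pd bu (cX φ) p = 0
  Tt : pd bt (cT φ) p ≠ 0
  Xx : pd bx (cX φ) p ≠ 0
  Uu : pd bu (cU φ) p ≠ 0
  A2 : θ.A2 p.1 p.2.1 * pd bx (cX φ) p ^ 2 = θ'.A2 (cT φ p) (cX φ p) * pd bt (cT φ) p
  Uuu : pd bu (pd bu (cU φ)) p = 0
  first : pd bx (cX φ) p * (θ.A11 p.1 p.2.1 * p.2.1 + θ.A10 p.1 p.2.1 - p.2.2) * pd bu (cU φ) p
      - pd bt (cX φ) p * pd bu (cU φ) p
      + (cU φ p - (θ'.A11 (cT φ p) (cX φ p) * cX φ p + θ'.A10 (cT φ p) (cX φ p)))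
        * pd bt (cT φ) p * pd bu (cU φ) p
    = θ.A2 p.1 p.2.1 * (2 * pd bx (cX φ) p * pd bx (pd bu (cU φ)) p
      - pd bu (cU φ) p * pd bx (pd bx (cX φ)) p)
  zeroth : pd bx (cX φ) p * pd bt (cU φ) p - pd bt (cX φ) p * pd bx (cU φ) p
      + (cU φ p - (θ'.A11 (cT φ p) (cX φ p) * cX φ p + θ'.A10 (cT φ p) (cX φ p)))
        * pd bt (cT φ) p * pd bx (cU φ) p
    = θ.A2 p.1 p.2.1 * (pd bx (cX φ) p * pd bx (pd bx (cU φ)) p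
      - pd bx (cU φ) p * pd bx (pd bx (cX φ)) p)

/-- As T depends on t only, every β with X_x + β X_u ≠ 0 is allowed. Letting f_xx vary on the
equation compares the two diffusion coefficients and forces X_u = 0. Eliminating the derivatives of
the image leaves an identity in β. -/
theorem IsAdmissible.split_polynomial (h : IsAdmissible Ω θ φ Ω' θ') (hp : p ∈ φ.source) :
    pd bu (cX φ) p = 0 ∧ pd bt (cT φ) p ≠ 0 ∧ pd bx (cX φ) p ≠ 0 ∧ pd bu (cU φ) p ≠ 0 ∧
    θ.A2 p.1 p.2.1 * pd bx (cX φ) p ^ 2 = θ'.A2 (cT φ p) (cX φ p) * pd bt (cT φ) p ∧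
    ∀ β, pd bx (cX φ) p * (pd bt (cU φ) p
        + (θ.A11 p.1 p.2.1 * p.2.1 + θ.A10 p.1 p.2.1 - p.2.2) * β * pd bu (cU φ) p)
      - pd bt (cX φ) p * (pd bx (cU φ) p + β * pd bu (cU φ) p)
      + (cU φ p - (θ'.A11 (cT φ p) (cX φ p) * cX φ p + θ'.A10 (cT φ p) (cX φ p)))
        * pd bt (cT φ) p * (pd bx (cU φ) p + β * pd bu (cU φ) p)
    = θ.A2 p.1 p.2.1 * (pd bx (cX φ) p * (pd bx (pd bx (cU φ)) p
        + 2 * β * pd bx (pd bu (cU φ)) p + β ^ 2 * pd bu (pd bu (cU φ)) p)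
      - (pd bx (cU φ) p + β * pd bu (cU φ) p)
        * pd (0, 1, β) (pd (0, 1, β) (cX φ)) p) := by
  have hS := φ.open_source
  have hT := smooth_cT h.point.1
  have hX := smooth_cX h.point.1
  have hU := smooth_cU h.point.1
  obtain ⟨hTx, hTu⟩ := h.pd_T hp
  have hA := h.A2_ne hp
  have hA' := h.A2_ne' hp
  have hTt : pd bt (cT φ) p ≠ 0 := by
    intro h0
    obtain ⟨⟨v1, v2, v3⟩, h1, -, -⟩ := h.point.exists_dir hp (1, 0, 0)
    rw [pd_pt, h0, hTx, hTu] at h1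
    norm_num at h1
  have hTT : ∀ β, pd (0, 1, β) (pd (0, 1, β) (cT φ)) p = 0 := fun β =>
    pd_eq_zero hS (c := 0) (fun q hq => by
      rw [pd_pt, (h.pd_T hq).1, (h.pd_T hq).2]; ring) hp _
  have hjac : ∀ α β, jac φ p α β = pd bt (cT φ) p * (pd bx (cX φ) p + β * pd bu (cX φ) p) := by
    intro α β; rw [jac, hTx, hTu]; ring
  have main : ∀ β, pd bx (cX φ) p + β * pd bu (cX φ) p ≠ 0 → ∀ γ, ∃ a b k : ℝ,
      pd bt (cU φ) p + (θ.A2 p.1 p.2.1 * γ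
          + (θ.A11 p.1 p.2.1 * p.2.1 + θ.A10 p.1 p.2.1 - p.2.2) * β) * pd bu (cU φ) p
        = a * pd bt (cT φ) p + b * (pd bt (cX φ) p + (θ.A2 p.1 p.2.1 * γ
          + (θ.A11 p.1 p.2.1 * p.2.1 + θ.A10 p.1 p.2.1 - p.2.2) * β) * pd bu (cX φ) p) ∧
      pd bx (cU φ) p + β * pd bu (cU φ) p = b * (pd bx (cX φ) p + β * pd bu (cX φ) p) ∧
      pd (0, 1, β) (pd (0, 1, β) (cU φ)) p + γ * pd bu (cU φ) p
        = k * (pd bx (cX φ) p + β * pd bu (cX φ) p) ^ 2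
          + b * (pd (0, 1, β) (pd (0, 1, β) (cX φ)) p + γ * pd bu (cX φ) p) ∧
      a + cU φ p * b = θ'.A2 (cT φ p) (cX φ p) * k
            + (θ'.A11 (cT φ p) (cX φ p) * cX φ p + θ'.A10 (cT φ p) (cX φ p)) * b := by
    intro β hβ γ
    set α := θ.A2 p.1 p.2.1 * γ
          + (θ.A11 p.1 p.2.1 * p.2.1 + θ.A10 p.1 p.2.1 - p.2.2) * β with hα
    obtain ⟨a, b, h1, h2, h3⟩ := h.jet_condition hp (α := α) (β := β)
      (by rw [hjac]; exact mul_ne_zero hTt hβ)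
    obtain ⟨k, h4, h5⟩ := h3 γ 0
    have h6 := h4 0 1 (by rw [pd_pt, hTx, hTu]; ring)
    simp only [zero_mul, one_mul, zero_add, add_zero, one_pow, mul_one] at h6
    rw [hTx, hTu] at h2
    rw [hTu] at h1
    rw [hTT, hTu, pd_pt (cX φ)] at h6
    refine ⟨a, b, k, by linear_combination h1, by linear_combination h2,
      by linear_combination h6, h5.1 (by rw [hα]; ring)⟩
  -- Difference of the relations for γ = 1 and γ = 0: b is unchanged, and N = U_u - b X_u is nonzero
  -- because otherwise the rows of the differential would be dependent.
  have hA2 : ∀ β, pd bx (cX φ) p + β * pd bu (cX φ) p ≠ 0 →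
      θ.A2 p.1 p.2.1 * (pd bx (cX φ) p + β * pd bu (cX φ) p) ^ 2
        = θ'.A2 (cT φ p) (cX φ p) * pd bt (cT φ) p := by
    intro β hβ
    obtain ⟨a₀, b₀, k₀, e₀, f₀, g₀, i₀⟩ := main β hβ 0
    obtain ⟨a₁, b₁, k₁, e₁, f₁, g₁, i₁⟩ := main β hβ 1
    have hb : b₁ = b₀ := mul_right_cancel₀ hβ (by linear_combination f₀ - f₁)
    subst hb
    set N := pd bu (cU φ) p - b₁ * pd bu (cX φ) p with hN
    have hNne : N ≠ 0 := by
      intro hN0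
      have hu : pd bu (cU φ) p = b₁ * pd bu (cX φ) p := by rw [hN] at hN0; linarith
      refine h.point.not_dependent hp (a := a₀) (b := b₁) ?_ ?_ ?_
      · linear_combination e₀ - ((θ.A11 p.1 p.2.1 * p.2.1 + θ.A10 p.1 p.2.1 - p.2.2) * β) * hu
      · rw [hTx]; linear_combination f₀ - β * hu
      · rw [hTu]; linear_combination hu
    refine mul_right_cancel₀ hNne ?_
    rw [hN]
    linear_combination (pd bx (cX φ) p + β * pd bu (cX φ) p) ^ 2 * (e₁ - e₀)
      + pd bt (cT φ) p * (pd bx (cX φ) p + β * pd bu (cX φ) p) ^ 2 * (i₁ - i₀)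
      - pd bt (cT φ) p * θ'.A2 (cT φ p) (cX φ p) * (g₁ - g₀)
  -- If X_u ≠ 0, some β make X_x + β X_u equal to 1 and to 2, although its square times A² ≠ 0 takes
  -- a single value.
  have hXu : pd bu (cX φ) p = 0 := by
    by_contra hne
    have h1 : pd bx (cX φ) p + (1 - pd bx (cX φ) p) / pd bu (cX φ) p * pd bu (cX φ) p = 1 := by
      rw [div_mul_cancel₀ _ hne]; ring
    have h2 : pd bx (cX φ) p + (2 - pd bx (cX φ) p) / pd bu (cX φ) p * pd bu (cX φ) p = 2 := by
      rw [div_mul_cancel₀ _ hne]; ring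
    have e1 := hA2 _ (by rw [h1]; norm_num)
    have e2 := hA2 _ (by rw [h2]; norm_num)
    rw [h1] at e1
    rw [h2] at e2
    exact hA (by linarith)
  have hXx : pd bx (cX φ) p ≠ 0 := by
    intro h0
    obtain ⟨⟨v1, v2, v3⟩, h1, h2, -⟩ := h.point.exists_dir hp (0, 1, 0)
    rw [pd_pt, hTx, hTu] at h1
    have hv1 : v1 = 0 := by
      refine (mul_eq_zero.1 ?_).resolve_right hTt
      linear_combination h1
    rw [pd_pt, h0, hXu, hv1] at h2
    norm_num at h2
  have hUu : pd bu (cU φ) p ≠ 0 := by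
    intro h0
    refine h.point.not_dependent hp
      (a := (pd bt (cU φ) p - pd bx (cU φ) p / pd bx (cX φ) p * pd bt (cX φ) p) / pd bt (cT φ) p)
      (b := pd bx (cU φ) p / pd bx (cX φ) p) ?_ ?_ ?_
    · field_simp; ring
    · rw [hTx]; field_simp; ring
    · rw [hTu, hXu, h0]; ring
  have hA2' : θ.A2 p.1 p.2.1 * pd bx (cX φ) p ^ 2
      = θ'.A2 (cT φ p) (cX φ p) * pd bt (cT φ) p := by
    have := hA2 0 (by simpa using hXx)
    simpa using this
  refine ⟨hXu, hTt, hXx, hUu, hA2', ?_⟩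
  · intro β
    obtain ⟨a, b, k, e, f, g, i⟩ := main β (by rw [hXu]; simpa using hXx) 0
    rw [pd_pd_xu hS hU hp] at g
    rw [hXu] at e f g
    linear_combination pd bx (cX φ) p * e + (θ.A2 p.1 p.2.1
        * pd (0, 1, β) (pd (0, 1, β) (cX φ)) p - pd bt (cX φ) p + pd bt (cT φ) p *
        (cU φ p - (θ'.A11 (cT φ p) (cX φ p) * cX φ p + θ'.A10 (cT φ p) (cX φ p)))) * f
      - θ.A2 p.1 p.2.1 * pd bx (cX φ) p * g + pd bt (cT φ) p * pd bx (cX φ) p * i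
      - k * pd bx (cX φ) p * hA2'

theorem IsAdmissible.splitEqs (h : IsAdmissible Ω θ φ Ω' θ') (hp : p ∈ φ.source) :
    SplitEqs θ θ' φ p := by
  have hS := φ.open_source
  have hX := smooth_cX h.point.1
  obtain ⟨hTx, hTu⟩ := h.pd_T hp
  obtain ⟨hXu, hTt, hXx, hUu, hA2, poly⟩ := h.split_polynomial hp
  have hXuv : ∀ v, pd v (pd bu (cX φ)) p = 0 := fun v =>
    pd_eq_zero hS (fun q hq => (h.split_polynomial hq).1) hp v
  -- With X_u = 0 the identity is quadratic in β, so the values at 0, 1, -1 determine its three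
  -- coefficients.
  have p0 := poly 0
  have p1 := poly 1
  have p2 := poly (-1)
  rw [pd_pd_xu hS hX hp, hXuv, hXuv] at p0 p1 p2
  exact {
    Tx := hTx, Tu := hTu, Xu := hXu, Tt := hTt, Xx := hXx, Uu := hUu, A2 := hA2
    Uuu := by
      refine (mul_eq_zero.1 ?_).resolve_left (mul_ne_zero (h.A2_ne hp) hXx)
      linear_combination p0 - p1 / 2 - p2 / 2
    first := by linear_combination p1 / 2 - p2 / 2
    zeroth := by linear_combination p0 }

end Determination

/-! ### Arbitrary elements along maps -/

section Along

variable {E : Type*} [NormedAddCommGroup E] [NormedSpace ℝ E]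

theorem HasPd.along {h : ℝ → ℝ → ℝ} {Ω : Set (ℝ × ℝ)} (hΩ : IsOpen Ω) (hh : SmoothOn h Ω)
    {T X : E → ℝ} {v : E} {a b : ℝ} {z : E} (hz : (T z, X z) ∈ Ω) (hT : HasPd v T a z)
    (hX : HasPd v X b z) :
    HasPd v (fun z => h (T z) (X z)) (a * dt h (T z) (X z) + b * dx h (T z) (X z)) z := by
  have hd : DifferentiableAt ℝ (unc h) (T z, X z) := smooth_at hh hΩ hz
  rw [dt_eq hd, dx_eq hd]
  exact HasPd.comp_plane hd hT hX

theorem smooth_along {h : ℝ → ℝ → ℝ} {Ω : Set (ℝ × ℝ)} (hh : SmoothOn h Ω) {S : Set E}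
    {T X : E → ℝ} (hT : ContDiffOn ℝ ∞ T S) (hX : ContDiffOn ℝ ∞ X S)
    (hS : ∀ z ∈ S, (T z, X z) ∈ Ω) : ContDiffOn ℝ ∞ (fun z => h (T z) (X z)) S :=
  ContDiffOn.comp (g := unc h) hh (hT.prodMk hX) hS

end Along

/-! ### The determining equations, solved -/

/-- The components of a transformation satisfy the determining equations at `p`, where `A¹⁰`, … are
the values of the arbitrary elements at `p` and `B¹⁰`, … those at the image of `p`. -/
structure Det (A10 A11 A2 B10 B11 B2 : ℝ) (φ : Pt → Pt) (p : Pt) : Prop where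
  Tx : pd bx (cT φ) p = 0
  Tu : pd bu (cT φ) p = 0
  Xu : pd bu (cX φ) p = 0
  Tt : pd bt (cT φ) p ≠ 0
  Uu : pd bu (cU φ) p ≠ 0
  Xx : pd bx (cX φ) p = pd bu (cU φ) p * pd bt (cT φ) p
  Uuu : pd bu (pd bu (cU φ)) p = 0
  Uxu : pd bx (pd bu (cU φ)) p = 0
  Utu : pd bt (pd bu (cU φ)) p = -pd bx (cU φ) p
  Uxx : pd bx (pd bx (cU φ)) p = 0
  Utx : pd bt (pd bx (cU φ)) p = A11 * pd bx (cU φ) p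
  Ut : pd bt (cU φ) p = pd bx (cU φ) p * (A11 * p.2.1 + A10 - p.2.2)
  Xt : pd bt (cX φ) p = pd bu (cU φ) p * pd bt (cT φ) p * (A11 * p.2.1 + A10 - p.2.2)
    + (cU φ p - B11 * cX φ p - B10) * pd bt (cT φ) p
  B11 : B11 * (pd bt (cT φ) p ^ 2 * pd bu (cU φ) p)
    = A11 * (pd bu (cU φ) p * pd bt (cT φ) p) - pd bu (cU φ) p * pd bt (pd bt (cT φ)) p
      + 2 * pd bx (cU φ) p * pd bt (cT φ) p
  B2 : B2 = A2 * pd bu (cU φ) p ^ 2 * pd bt (cT φ) p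

/-! ### Differential consequences of the split equations -/

section Determination

variable {Ω Ω' : Set (ℝ × ℝ)} {θ θ' : ArbTuple} {φ : OpenPartialHomeomorph Pt Pt} {p : Pt}

theorem hasPd_source {h : ℝ → ℝ → ℝ} (hΩ : IsOpen Ω) (hh : SmoothOn h Ω) (hp : tx p ∈ Ω) (v : Pt) :
    HasPd v (fun p : Pt => h p.1 p.2.1) (v.1 * dt h p.1 p.2.1 + v.2.1 * dx h p.1 p.2.1) p :=
  HasPd.along (T := fun p : Pt => p.1) (X := fun p : Pt => p.2.1) hΩ hh hp
    (hasPd_t v p) (hasPd_x v p)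

theorem IsAdmissible.hasPd_target (h : IsAdmissible Ω θ φ Ω' θ') (hp : p ∈ φ.source)
    {f : ℝ → ℝ → ℝ} (hf : SmoothOn f Ω') (v : Pt) :
    HasPd v (fun p => f (cT φ p) (cX φ p))
      (pd v (cT φ) p * dt f (cT φ p) (cX φ p) + pd v (cX φ) p * dx f (cT φ p) (cX φ p)) p :=
  HasPd.along h.target.isOpen hf (h.target_mem p hp)
    (hasPd (smooth_cT h.point.1) φ.open_source hp v)
    (hasPd (smooth_cX h.point.1) φ.open_source hp v)

theorem IsAdmissible.hasPd_target_u (h : IsAdmissible Ω θ φ Ω' θ') (hp : p ∈ φ.source)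
    {f : ℝ → ℝ → ℝ} (hf : SmoothOn f Ω') :
    HasPd bu (fun p => f (cT φ p) (cX φ p)) 0 p :=
  (h.hasPd_target hp hf bu).val (by rw [(h.splitEqs hp).Tu, (h.splitEqs hp).Xu]; ring)

theorem IsAdmissible.hasPd_target_x (h : IsAdmissible Ω θ φ Ω' θ') (hp : p ∈ φ.source)
    {f : ℝ → ℝ → ℝ} (hf : SmoothOn f Ω') (hx : ∀ t x, (t, x) ∈ Ω' → dx f t x = 0) :
    HasPd bx (fun p => f (cT φ p) (cX φ p)) 0 p :=
  (h.hasPd_target hp hf bx).val (by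
    rw [(h.splitEqs hp).Tx, hx (cT φ p) (cX φ p) (h.target_mem p hp)]; ring)

theorem IsAdmissible.hasPd_target_t (h : IsAdmissible Ω θ φ Ω' θ') (hp : p ∈ φ.source)
    {f : ℝ → ℝ → ℝ} (hf : SmoothOn f Ω') (hx : ∀ t x, (t, x) ∈ Ω' → dx f t x = 0) :
    HasPd bt (fun p => f (cT φ p) (cX φ p))
      (pd bt (cT φ) p * dt f (cT φ p) (cX φ p)) p :=
  (h.hasPd_target hp hf bt).val (by rw [hx (cT φ p) (cX φ p) (h.target_mem p hp)]; ring)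

theorem IsAdmissible.pd_u_pd (h : IsAdmissible Ω θ φ Ω' θ') (hp : p ∈ φ.source) (v : Pt) :
    pd bu (pd v (cT φ)) p = 0 ∧ pd bx (pd v (cT φ)) p = 0 ∧ pd bu (pd v (cX φ)) p = 0 ∧
      pd bu (pd v (pd bu (cU φ))) p = 0 := by
  have hS := φ.open_source
  have hT := smooth_cT h.point.1
  have hX := smooth_cX h.point.1
  have hU := smooth_pd hS (smooth_cU h.point.1) bu
  rw [pd_comm hS hT hp bu v, pd_comm hS hT hp bx v, pd_comm hS hX hp bu v,
    pd_comm hS hU hp bu v]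
  exact ⟨pd_eq_zero hS (fun q hq => (h.splitEqs hq).Tu) hp v,
    pd_eq_zero hS (fun q hq => (h.splitEqs hq).Tx) hp v,
    pd_eq_zero hS (fun q hq => (h.splitEqs hq).Xu) hp v,
    pd_eq_zero hS (fun q hq => (h.splitEqs hq).Uuu) hp v⟩

theorem IsAdmissible.pd_u_pd_pd_X (h : IsAdmissible Ω θ φ Ω' θ') (hp : p ∈ φ.source) (v w : Pt) :
    pd bu (pd v (pd w (cX φ))) p = 0 := by
  have hS := φ.open_source
  rw [pd_comm hS (smooth_pd hS (smooth_cX h.point.1) w) hp bu v]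
  exact pd_eq_zero hS (fun q hq => (h.pd_u_pd hq w).2.2.1) hp v

/-- The bracket `A¹¹ x + A¹⁰ - u` and its derivative. -/
theorem IsAdmissible.hasPd_bracket_u (h : IsAdmissible Ω θ φ Ω' θ') (hp : p ∈ φ.source) :
    HasPd bu (fun p : Pt => θ.A11 p.1 p.2.1 * p.2.1 + θ.A10 p.1 p.2.1 - p.2.2) (-1) p := by
  have hm := h.source_mem p hp
  have h1 := hasPd_source h.source.isOpen h.source.smooth_A11 hm bu
  have h2 := hasPd_source h.source.isOpen h.source.smooth_A10 hm bu
  exact (((h1.mul (hasPd_x bu p)).add h2).sub (hasPd_u bu p)).val (by simp [bu])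

theorem IsAdmissible.hasPd_target_bracket_u (h : IsAdmissible Ω θ φ Ω' θ') (hp : p ∈ φ.source) :
    HasPd bu (fun p => cU φ p - (θ'.A11 (cT φ p) (cX φ p) * cX φ p + θ'.A10 (cT φ p) (cX φ p)))
      (pd bu (cU φ) p) p := by
  have hS := φ.open_source
  have h1 := h.hasPd_target_u hp h.target.smooth_A11
  have h2 := h.hasPd_target_u hp h.target.smooth_A10
  refine ((hasPd (smooth_cU h.point.1) hS hp bu).sub
    ((h1.mul (hasPd (smooth_cX h.point.1) hS hp bu)).add h2)).val ?_
  rw [(h.splitEqs hp).Xu]; ring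

theorem IsAdmissible.hasPd_A2_u (h : IsAdmissible Ω θ φ Ω' θ') (hp : p ∈ φ.source) :
    HasPd bu (fun p : Pt => θ.A2 p.1 p.2.1) 0 p :=
  (hasPd_source h.source.isOpen h.source.smooth_A2 (h.source_mem p hp) bu).val (by simp [bu])

/-- The u-derivative of the equation `first`: u enters only through the bracket A¹¹x + A¹⁰ - u and
through ũ, which leaves U_u(U_u T_t - X_x) = 0. -/
theorem IsAdmissible.pd_x_X (h : IsAdmissible Ω θ φ Ω' θ') (hp : p ∈ φ.source) :
    pd bx (cX φ) p = pd bu (cU φ) p * pd bt (cT φ) p := by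
  have hS := φ.open_source
  have hT := smooth_cT h.point.1
  have hX := smooth_cX h.point.1
  have hU := smooth_cU h.point.1
  have hz : ∀ q ∈ φ.source, pd bx (cX φ) q
        * (θ.A11 q.1 q.2.1 * q.2.1 + θ.A10 q.1 q.2.1 - q.2.2) * pd bu (cU φ) q
      - pd bt (cX φ) q * pd bu (cU φ) q
      + (cU φ q - (θ'.A11 (cT φ q) (cX φ q) * cX φ q + θ'.A10 (cT φ q) (cX φ q)))
        * pd bt (cT φ) q * pd bu (cU φ) q
      - θ.A2 q.1 q.2.1 * (2 * pd bx (cX φ) q * pd bx (pd bu (cU φ)) q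
      - pd bu (cU φ) q * pd bx (pd bx (cX φ)) q) = 0 := fun q hq => by
    linear_combination (h.splitEqs hq).first
  have hXx := (hasPd (smooth_pd hS hX bx) hS hp bu).val (h.pd_u_pd hp bx).2.2.1
  have hXt := (hasPd (smooth_pd hS hX bt) hS hp bu).val (h.pd_u_pd hp bt).2.2.1
  have hTt := (hasPd (smooth_pd hS hT bt) hS hp bu).val (h.pd_u_pd hp bt).1
  have hUu := (hasPd (smooth_pd hS hU bu) hS hp bu).val (h.splitEqs hp).Uuu
  have hUxu := (hasPd (smooth_pd hS (smooth_pd hS hU bu) bx) hS hp bu).val (h.pd_u_pd hp bx).2.2.2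
  have hXxx := (hasPd (smooth_pd hS (smooth_pd hS hX bx) bx) hS hp bu).val
    (h.pd_u_pd_pd_X hp bx bx)
  have hd := (((((hXx.mul (h.hasPd_bracket_u hp)).mul hUu).sub (hXt.mul hUu)).add
    (((h.hasPd_target_bracket_u hp).mul hTt).mul hUu)).sub ((h.hasPd_A2_u hp).mul
      ((((HasPd.const 2).mul hXx).mul hUxu).sub (hUu.mul hXxx)))).eq
  rw [pd_eq_zero hS hz hp] at hd
  refine sub_eq_zero.1 ((mul_eq_zero.1 ?_).resolve_right (h.splitEqs hp).Uu)
  linear_combination hd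

/-- Differentiating `zeroth` twice with respect to u leaves 2 U_u T_t U_xu = 0. With U_xu = 0 the
first u-derivative then reduces to U_tu = -U_x. -/
theorem IsAdmissible.pd_U (h : IsAdmissible Ω θ φ Ω' θ') (hp : p ∈ φ.source) :
    pd bx (pd bu (cU φ)) p = 0 ∧ pd bt (pd bu (cU φ)) p = -pd bx (cU φ) p := by
  have hS := φ.open_source
  have hT := smooth_cT h.point.1
  have hX := smooth_cX h.point.1
  have hU := smooth_cU h.point.1
  have hz : ∀ q ∈ φ.source, pd bx (cX φ) q * pd bt (cU φ) q - pd bt (cX φ) q * pd bx (cU φ) q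
      + (cU φ q - (θ'.A11 (cT φ q) (cX φ q) * cX φ q + θ'.A10 (cT φ q) (cX φ q)))
        * pd bt (cT φ) q * pd bx (cU φ) q
      - θ.A2 q.1 q.2.1 * (pd bx (cX φ) q * pd bx (pd bx (cU φ)) q
      - pd bx (cU φ) q * pd bx (pd bx (cX φ)) q) = 0 := fun q hq => by
    linear_combination (h.splitEqs hq).zeroth
  have hXv : ∀ v {q}, q ∈ φ.source → HasPd bu (pd v (cX φ)) 0 q := fun v q hq =>
    (hasPd (smooth_pd hS hX v) hS hq bu).val (h.pd_u_pd hq v).2.2.1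
  have hTt : ∀ {q}, q ∈ φ.source → HasPd bu (pd bt (cT φ)) 0 q := fun hq =>
    (hasPd (smooth_pd hS hT bt) hS hq bu).val (h.pd_u_pd hq bt).1
  have hXxx : ∀ {q}, q ∈ φ.source → HasPd bu (pd bx (pd bx (cX φ))) 0 q := fun hq =>
    (hasPd (smooth_pd hS (smooth_pd hS hX bx) bx) hS hq bu).val (h.pd_u_pd_pd_X hq bx bx)
  have hUv : ∀ v {q}, q ∈ φ.source → HasPd bu (pd v (cU φ)) (pd v (pd bu (cU φ)) q) q :=
    fun v q hq => (hasPd (smooth_pd hS hU v) hS hq bu).val (pd_comm hS hU hq bu v)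
  have hUxx : ∀ {q}, q ∈ φ.source →
      HasPd bu (pd bx (pd bx (cU φ))) (pd bx (pd bx (pd bu (cU φ))) q) q := fun {q} hq =>
    (hasPd (smooth_pd hS (smooth_pd hS hU bx) bx) hS hq bu).val (by
      rw [pd_comm hS (smooth_pd hS hU bx) hq bu bx]
      exact pd_congr hS (fun y hy => pd_comm hS hU hy bu bx) hq bx)
  have hUvu : ∀ v {q}, q ∈ φ.source → HasPd bu (pd v (pd bu (cU φ))) 0 q := fun v q hq =>
    (hasPd (smooth_pd hS (smooth_pd hS hU bu) v) hS hq bu).val (h.pd_u_pd hq v).2.2.2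
  have hUxxu : ∀ {q}, q ∈ φ.source → HasPd bu (pd bx (pd bx (pd bu (cU φ)))) 0 q := fun {q} hq =>
    (hasPd (smooth_pd hS (smooth_pd hS (smooth_pd hS hU bu) bx) bx) hS hq bu).val (by
      rw [pd_comm hS (smooth_pd hS (smooth_pd hS hU bu) bx) hq bu bx]
      exact pd_eq_zero hS (fun y hy => (h.pd_u_pd hy bx).2.2.2) hq bx)
  have hz1 : ∀ q ∈ φ.source, pd bx (cX φ) q * pd bt (pd bu (cU φ)) q
      - pd bt (cX φ) q * pd bx (pd bu (cU φ)) q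
      + pd bu (cU φ) q * pd bt (cT φ) q * pd bx (cU φ) q
      + (cU φ q - (θ'.A11 (cT φ q) (cX φ q) * cX φ q + θ'.A10 (cT φ q) (cX φ q)))
        * pd bt (cT φ) q * pd bx (pd bu (cU φ)) q
      - θ.A2 q.1 q.2.1 * (pd bx (cX φ) q * pd bx (pd bx (pd bu (cU φ))) q
      - pd bx (pd bu (cU φ)) q * pd bx (pd bx (cX φ)) q) = 0 := by
    intro q hq
    have hd := (((((hXv bx hq).mul (hUv bt hq)).sub ((hXv bt hq).mul (hUv bx hq))).add
      (((h.hasPd_target_bracket_u hq).mul (hTt hq)).mul (hUv bx hq))).sub ((h.hasPd_A2_u hq).mul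
      (((hXv bx hq).mul (hUxx hq)).sub ((hUv bx hq).mul (hXxx hq))))).eq
    rw [pd_eq_zero hS hz hq] at hd
    linear_combination -hd
  have hUu : ∀ {q}, q ∈ φ.source → HasPd bu (pd bu (cU φ)) 0 q := fun hq =>
    (hasPd (smooth_pd hS hU bu) hS hq bu).val (h.splitEqs hq).Uuu
  have hxu : ∀ q ∈ φ.source, pd bx (pd bu (cU φ)) q = 0 := by
    intro q hq
    have hd := ((((((hXv bx hq).mul (hUvu bt hq)).sub ((hXv bt hq).mul (hUvu bx hq))).add
      (((hUu hq).mul (hTt hq)).mul (hUv bx hq))).add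
      (((h.hasPd_target_bracket_u hq).mul (hTt hq)).mul (hUvu bx hq))).sub ((h.hasPd_A2_u hq).mul
      (((hXv bx hq).mul (hUxxu hq)).sub ((hUvu bx hq).mul (hXxx hq))))).eq
    rw [pd_eq_zero hS hz1 hq] at hd
    refine (mul_eq_zero.1 ?_).resolve_left
      (mul_ne_zero (h.splitEqs hq).Uu (h.splitEqs hq).Tt)
    linear_combination -hd / 2
  refine ⟨hxu p hp, ?_⟩
  have e := hz1 p hp
  rw [hxu p hp, pd_eq_zero hS hxu hp bx, h.pd_x_X hp] at e
  refine eq_neg_of_add_eq_zero_left ((mul_eq_zero.1 ?_).resolve_left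
    (mul_ne_zero (h.splitEqs hp).Uu (h.splitEqs hp).Tt))
  linear_combination e

/-- The remaining equations are compatibility conditions. U_xx = 0 follows by equating mixed
derivatives of U_u; the formula for the new A¹¹ follows by computing X_tx both from X_x = U_u T_t
and from the formula for X_t. -/
theorem IsAdmissible.det (h : IsAdmissible Ω θ φ Ω' θ') (hp : p ∈ φ.source) :
    Det (θ.A10 p.1 p.2.1) (θ.A11 p.1 p.2.1) (θ.A2 p.1 p.2.1) (θ'.A10 (cT φ p) (cX φ p))
      (θ'.A11 (cT φ p) (cX φ p)) (θ'.A2 (cT φ p) (cX φ p)) φ p := by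
  have hS := φ.open_source
  have hT := smooth_cT h.point.1
  have hX := smooth_cX h.point.1
  have hU := smooth_cU h.point.1
  have hXxx : ∀ q ∈ φ.source, pd bx (pd bx (cX φ)) q = 0 := by
    intro q hq
    rw [pd_congr hS (fun y hy => h.pd_x_X hy) hq,
      ((hasPd (smooth_pd hS hU bu) hS hq bx).mul (hasPd (smooth_pd hS hT bt) hS hq bx)).eq,
      (h.pd_U hq).1, (h.pd_u_pd hq bt).2.1]
    ring
  have hUxx : ∀ q ∈ φ.source, pd bx (pd bx (cU φ)) q = 0 := by
    intro q hq
    have e : pd bx (pd bt (pd bu (cU φ))) q = -pd bx (pd bx (cU φ)) q := by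
      rw [pd_congr hS (fun y hy => (h.pd_U hy).2) hq]
      exact (hasPd (smooth_pd hS hU bx) hS hq bx).neg.eq
    rw [pd_comm hS (smooth_pd hS hU bu) hq, pd_eq_zero hS (fun y hy => (h.pd_U hy).1) hq] at e
    linarith
  have hXt : ∀ q ∈ φ.source, pd bt (cX φ) q
      = pd bu (cU φ) q * pd bt (cT φ) q * (θ.A11 q.1 q.2.1 * q.2.1 + θ.A10 q.1 q.2.1 - q.2.2)
        + (cU φ q - θ'.A11 (cT φ q) (cX φ q) * cX φ q - θ'.A10 (cT φ q) (cX φ q))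
          * pd bt (cT φ) q := by
    intro q hq
    have e := (h.splitEqs hq).first
    rw [(h.pd_U hq).1, hXxx q hq, h.pd_x_X hq] at e
    refine mul_right_cancel₀ (h.splitEqs hq).Uu ?_
    linear_combination -e
  have hUt : ∀ q ∈ φ.source, pd bt (cU φ) q
      = pd bx (cU φ) q * (θ.A11 q.1 q.2.1 * q.2.1 + θ.A10 q.1 q.2.1 - q.2.2) := by
    intro q hq
    have e := (h.splitEqs hq).zeroth
    rw [hUxx q hq, hXxx q hq, h.pd_x_X hq, hXt q hq] at e
    refine mul_right_cancel₀ (mul_ne_zero (h.splitEqs hq).Uu (h.splitEqs hq).Tt) ?_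
    linear_combination e
  have hbr : HasPd bx (fun p : Pt => θ.A11 p.1 p.2.1 * p.2.1 + θ.A10 p.1 p.2.1 - p.2.2)
      (θ.A11 p.1 p.2.1) p := by
    have hm := h.source_mem p hp
    have h1 := hasPd_source h.source.isOpen h.source.smooth_A11 hm bx
    have h2 := hasPd_source h.source.isOpen h.source.smooth_A10 hm bx
    refine (((h1.mul (hasPd_x bx p)).add h2).sub (hasPd_u bx p)).val ?_
    rw [h.source.A11_x _ _ hm, h.source.A10_x _ _ hm]
    simp [bx]
  have hUtx : pd bt (pd bx (cU φ)) p = θ.A11 p.1 p.2.1 * pd bx (cU φ) p := by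
    rw [pd_comm hS hU hp, pd_congr hS hUt hp,
      ((hasPd (smooth_pd hS hU bx) hS hp bx).mul hbr).eq, hUxx p hp]
    ring
  have hB11 : θ'.A11 (cT φ p) (cX φ p) * (pd bt (cT φ) p ^ 2 * pd bu (cU φ) p)
    = θ.A11 p.1 p.2.1 * (pd bu (cU φ) p * pd bt (cT φ) p)
      - pd bu (cU φ) p * pd bt (pd bt (cT φ)) p + 2 * pd bx (cU φ) p * pd bt (cT φ) p := by
    have e1 : pd bx (pd bt (cX φ)) p = -pd bx (cU φ) p * pd bt (cT φ) p
        + pd bu (cU φ) p * pd bt (pd bt (cT φ)) p := by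
      rw [pd_comm hS hX hp, pd_congr hS (fun y hy => h.pd_x_X hy) hp,
        ((hasPd (smooth_pd hS hU bu) hS hp bt).mul (hasPd (smooth_pd hS hT bt) hS hp bt)).eq,
        (h.pd_U hp).2]
    have hTt := (hasPd (smooth_pd hS hT bt) hS hp bx).val (h.pd_u_pd hp bt).2.1
    have hUu := (hasPd (smooth_pd hS hU bu) hS hp bx).val (h.pd_U hp).1
    have hX' := (hasPd hX hS hp bx).val (h.pd_x_X hp)
    have hq := h.hasPd_target_x hp h.target.smooth_A11 h.target.A11_x
    have hr := h.hasPd_target_x hp h.target.smooth_A10 h.target.A10_x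
    rw [pd_congr hS hXt hp, (((hUu.mul hTt).mul hbr).add
      ((((hasPd hU hS hp bx).sub (hq.mul hX')).sub hr).mul hTt)).eq] at e1
    linear_combination -e1
  exact {
    Tx := (h.splitEqs hp).Tx, Tu := (h.splitEqs hp).Tu, Xu := (h.splitEqs hp).Xu
    Tt := (h.splitEqs hp).Tt, Uu := (h.splitEqs hp).Uu, Xx := h.pd_x_X hp
    Uuu := (h.splitEqs hp).Uuu, Uxu := (h.pd_U hp).1, Utu := (h.pd_U hp).2
    Uxx := hUxx p hp, Utx := hUtx, Ut := hUt p hp, Xt := hXt p hp, B11 := hB11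
    B2 := by
      have e := (h.splitEqs hp).A2
      rw [h.pd_x_X hp] at e
      refine mul_right_cancel₀ (h.splitEqs hp).Tt ?_
      linear_combination -e }

end Determination

/-! ### Sufficiency of the determining equations -/

/-- Along any graph, T_t times the defect of the target equation equals U_u times the defect of the
source equation, and both factors are nonzero. The determining equations are required on an open set
because they are differentiated to get X_xx = 0 and the second derivatives of T. -/
theorem connectsAt_of_det {S : Set Pt} (hS : IsOpen S) {φ : Pt → Pt} (hφ : ContDiffOn ℝ ∞ φ S)
    {θ θ' : ArbTuple} {A : Pt → ℝ × ℝ × ℝ × ℝ × ℝ × ℝ}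
    (hdet : ∀ p ∈ S, Det (A p).1 (A p).2.1 (A p).2.2.1 (A p).2.2.2.1 (A p).2.2.2.2.1
      (A p).2.2.2.2.2 φ p) {p : Pt} (hp : p ∈ S)
    (hA : A p = (θ.A10 p.1 p.2.1, θ.A11 p.1 p.2.1, θ.A2 p.1 p.2.1, θ'.A10 (cT φ p) (cX φ p),
      θ'.A11 (cT φ p) (cX φ p), θ'.A2 (cT φ p) (cX φ p))) :
    ConnectsAt φ θ θ' p := by
  intro f g hfp hg
  have hT := smooth_cT hφ
  have hX := smooth_cX hφ
  have hU := smooth_cU hφ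
  have hpe : ((p.1, p.2.1, f p.1 p.2.1) : Pt) = p := by rw [hfp]
  have d := hdet p hp
  rw [hA] at d
  simp only at d
  obtain ⟨h1, h2, h3⟩ := hg.jet_second hS hφ (by rw [hpe]; exact hp)
  have h3 := h3 (0, 1)
  simp only [hpe] at h1 h2 h3
  obtain ⟨O, hO, hz, hfO⟩ := hg.smooth_source.exists_open
  have hval : g (φ p).1 (φ p).2.1 = cU φ p := by
    have := hg.graph.self_of_nhds
    simp only [tAlong, xAlong, uAlong, hpe] at this
    exact this
  have hTT : ∀ v, pd v (pd bx (cT φ)) p = 0 ∧ pd v (pd bu (cT φ)) p = 0 := fun v =>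
    ⟨pd_eq_zero hS (fun q hq => (hdet q hq).Tx) hp v,
      pd_eq_zero hS (fun q hq => (hdet q hq).Tu) hp v⟩
  have hXu : ∀ v, pd v (pd bu (cX φ)) p = 0 := fun v =>
    pd_eq_zero hS (fun q hq => (hdet q hq).Xu) hp v
  have hXxx : pd bx (pd bx (cX φ)) p = 0 := by
    rw [pd_congr hS (fun y hy => (hdet y hy).Xx) hp,
      ((hasPd (smooth_pd hS hU bu) hS hp bx).mul (hasPd (smooth_pd hS hT bt) hS hp bx)).eq,
      d.Uxu, pd_comm hS hT hp, (hTT bt).1]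
    ring
  rw [← dxx_eq hO hfO hz] at h3
  simp only [zero_mul, one_mul, zero_add, pd_pd_xu hS hT hp, pd_pd_xu hS hX hp,
    pd_pd_xu hS hU hp, hTT, hXu, hXxx, d.Uuu, d.Uxu, d.Uxx, d.Tu, d.Xu] at h3
  have h3 := h3 (by rw [pd_pt, d.Tx, d.Tu]; ring)
  rw [pd_pt (cX φ), d.Xu, d.Xx] at h3
  rw [d.Tx, d.Tu, d.Xu, d.Xx] at h2
  rw [d.Tu, d.Xu, d.Ut, d.Xt] at h1
  unfold SolvesAt
  rw [hval, hfp]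
  set a := dt g (φ p).1 (φ p).2.1
  set b := dx g (φ p).1 (φ p).2.1
  set k := dx (dx g) (φ p).1 (φ p).2.1
  set α := dt f p.1 p.2.1
  set β := dx f p.1 p.2.1
  set γ := dx (dx f) p.1 p.2.1
  set W := pd bu (cU φ) p with hW
  set P := pd bt (cT φ) p with hP
  have hB2 := d.B2
  rw [← hW, ← hP] at hB2
  have hW0 : W ≠ 0 := d.Uu
  have hP0 : P ≠ 0 := d.Tt
  have key : P * (a + cU φ p * b - (θ'.A2 (cT φ p) (cX φ p) * k
        + (θ'.A11 (cT φ p) (cX φ p) * cX φ p + θ'.A10 (cT φ p) (cX φ p)) * b))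
      = W * (α + p.2.2 * β - (θ.A2 p.1 p.2.1 * γ
        + (θ.A11 p.1 p.2.1 * p.2.1 + θ.A10 p.1 p.2.1) * β)) := by
    linear_combination (-1 : ℝ) * h1 + (θ.A11 p.1 p.2.1 * p.2.1 + θ.A10 p.1 p.2.1 - p.2.2) * h2
      + θ.A2 p.1 p.2.1 * h3 - P * k * hB2
  change _ ↔ a + cU φ p * b = θ'.A2 (cT φ p) (cX φ p) * k
        + (θ'.A11 (cT φ p) (cX φ p) * cX φ p + θ'.A10 (cT φ p) (cX φ p)) * b
  rw [← sub_eq_zero, ← sub_eq_zero (a := a + cU φ p * b)]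
  constructor
  · intro e
    rw [e, mul_zero] at key
    exact (mul_eq_zero.1 key).resolve_left hP0
  · intro e
    rw [e, mul_zero] at key
    exact (mul_eq_zero.1 key.symm).resolve_left hW0

/-! ### Invariants -/

/-- The coefficient functions of a transformation: `W`, `R`, `v` are those of
`ũ = W u - R x + v`, `P` and `X` are those of `x̃ = P W x + X`, and `y`, `z` are the values
of `Y⁰, Y¹, Y²` before and after the transformation. -/
structure Frame (E : Type*) where
  W : E → ℝ
  R : E → ℝ
  P : E → ℝ
  v : E → ℝ
  X : E → ℝ
  y0 : E → ℝ
  y1 : E → ℝ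
  y2 : E → ℝ
  z0 : E → ℝ
  z1 : E → ℝ
  z2 : E → ℝ

namespace Frame

/-- The functions `c₁, c₀, c₂, δ, c₁', c₀', c₃`, which turn out to be constant. -/
noncomputable def inv {E : Type*} (F : Frame E) : Fin 7 → E → ℝ
  | 0 => fun z => F.R z * Real.exp (-F.y0 z)
  | 1 => fun z => F.W z - F.R z * Real.exp (-F.y0 z) * F.y1 z
  | 2 => fun z => F.v z + F.R z * Real.exp (-F.y0 z) * F.y2 z
  | 3 => fun z => F.P z * (F.W z * F.W z) * Real.exp (F.z0 z - F.y0 z)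
  | 4 => fun z => F.P z * F.W z * Real.exp (F.z0 z - F.y0 z)
      + F.R z * Real.exp (-F.y0 z) * F.z1 z
  | 5 => fun z => (F.W z - F.R z * Real.exp (-F.y0 z) * F.y1 z) * F.z1 z
      - F.y1 z * (F.P z * F.W z * Real.exp (F.z0 z - F.y0 z))
  | 6 => fun z => F.z2 z - F.P z * F.W z * Real.exp (F.z0 z - F.y0 z) * F.y2 z
      + F.X z * Real.exp (F.z0 z) - (F.v z + F.R z * Real.exp (-F.y0 z) * F.y2 z) * F.z1 z

/-! ### First integrals of the determining system -/

section Flow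

variable {E : Type*} [NormedAddCommGroup E] [NormedSpace ℝ E]

/-- All coefficient functions are smooth. -/
structure Smooth (F : Frame E) (S : Set E) : Prop where
  W : ContDiffOn ℝ ∞ F.W S
  R : ContDiffOn ℝ ∞ F.R S
  P : ContDiffOn ℝ ∞ F.P S
  v : ContDiffOn ℝ ∞ F.v S
  X : ContDiffOn ℝ ∞ F.X S
  y0 : ContDiffOn ℝ ∞ F.y0 S
  y1 : ContDiffOn ℝ ∞ F.y1 S
  y2 : ContDiffOn ℝ ∞ F.y2 S
  z0 : ContDiffOn ℝ ∞ F.z0 S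
  z1 : ContDiffOn ℝ ∞ F.z1 S
  z2 : ContDiffOn ℝ ∞ F.z2 S

theorem Smooth.inv {F : Frame E} {S : Set E} (h : F.Smooth S) (i : Fin 7) :
    ContDiffOn ℝ ∞ (F.inv i) S := by
  obtain ⟨hW, hR, hP, hv, hX, hy0, hy1, hy2, hz0, hz1, hz2⟩ := h
  fin_cases i <;> simp only [Frame.inv] <;> fun_prop

/-- The derivatives of the coefficient functions in the direction `d`, along which `t` changes
with the speed `τ`. -/
structure Flow (F : Frame E) (d : E) (τ a10 a11 b10 b11 P' X' : ℝ) (z : E) : Prop where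
  W : HasPd d F.W (F.R z * τ) z
  R : HasPd d F.R (a11 * F.R z * τ) z
  P : HasPd d F.P (P' * τ) z
  v : HasPd d F.v (-F.R z * a10 * τ) z
  X : HasPd d F.X (X' * τ) z
  y0 : HasPd d F.y0 (a11 * τ) z
  y1 : HasPd d F.y1 (Real.exp (F.y0 z) * τ) z
  y2 : HasPd d F.y2 (a10 * Real.exp (F.y0 z) * τ) z
  z0 : HasPd d F.z0 (b11 * F.P z * τ) z
  z1 : HasPd d F.z1 (Real.exp (F.z0 z) * F.P z * τ) z
  z2 : HasPd d F.z2 (b10 * Real.exp (F.z0 z) * F.P z * τ) z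
  rel11 : b11 * (F.P z ^ 2 * F.W z) = a11 * (F.W z * F.P z) - F.W z * P' - 2 * F.R z * F.P z
  rel10 : b10 * F.P z = F.W z * a10 * F.P z - X' + F.v z * F.P z - b11 * F.X z * F.P z

/-- R and exp Y⁰ solve the same linear equation, so R exp(-Y⁰) is constant; then W and v are
integrated by Y¹ and Y². By `rel11` the quantity P W² exp(z₀ - y₀) is constant and P W exp(z₀ - y₀)
has derivative -R P exp(z₀ - y₀), which the change of z₁ compensates. `rel10` does the same for z₂.
-/
theorem Flow.inv {F : Frame E} {d : E} {τ a10 a11 b10 b11 P' X' : ℝ} {z : E}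
    (h : F.Flow d τ a10 a11 b10 b11 P' X' z) (i : Fin 7) :
    HasPd d (F.inv i) 0 z := by
  have hexp : Real.exp (F.z0 z) = Real.exp (F.z0 z - F.y0 z) * Real.exp (F.y0 z) := by
    rw [← Real.exp_add]; ring_nf
  have hone : Real.exp (-F.y0 z) * Real.exp (F.y0 z) = 1 := by
    rw [← Real.exp_add]; simp
  have k1 := (h.R.mul h.y0.neg.exp).val (b := 0) (by ring)
  have kE := (h.z0.sub h.y0).exp
  have kPW := ((h.P.mul h.W).mul kE).val
    (b := -(F.R z * F.P z * Real.exp (F.z0 z - F.y0 z) * τ)) (by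
      linear_combination Real.exp (F.z0 z - F.y0 z) * τ * h.rel11)
  have kδ := ((h.P.mul (h.W.mul h.W)).mul kE).val (b := 0) (by
      linear_combination Real.exp (F.z0 z - F.y0 z) * τ * F.W z * h.rel11)
  fin_cases i
  · exact k1
  · exact (h.W.sub (k1.mul h.y1)).val (by linear_combination -F.R z * τ * hone)
  · exact (h.v.add (k1.mul h.y2)).val (by linear_combination F.R z * a10 * τ * hone)
  · exact kδ
  · refine (kPW.add (k1.mul h.z1)).val ?_
    rw [hexp]
    linear_combination F.R z * F.P z * Real.exp (F.z0 z - F.y0 z) * τ * hone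
  · refine (((h.W.sub (k1.mul h.y1)).mul h.z1).sub (h.y1.mul kPW)).val ?_
    rw [hexp]
    linear_combination -F.R z * F.y1 z * Real.exp (F.z0 z - F.y0 z) * F.P z * τ * hone
      - F.R z * τ * F.z1 z * hone
  · refine (((h.z2.sub (kPW.mul h.y2)).add (h.X.mul h.z0.exp)).sub
      ((h.v.add (k1.mul h.y2)).mul h.z1)).val ?_
    rw [hexp]
    linear_combination Real.exp (F.z0 z - F.y0 z) * Real.exp (F.y0 z) * τ * h.rel10
      - F.R z * F.P z * Real.exp (F.z0 z - F.y0 z) * τ * F.y2 z * hone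
      - F.R z * a10 * τ * F.z1 z * hone

end Flow

/-- The seven equations are solved for the unknowns. The relation for δ is an algebraic identity
between the invariants, and δP = P²W² exp(z₀ - y₀) explains the sign condition δ D_t T > 0. -/
theorem formulas {E : Type*} {F : Frame E} {z : E} {c : Fin 7 → ℝ} (hW : F.W z ≠ 0)
    (hP : F.P z ≠ 0) (h : ∀ i, F.inv i z = c i) :
    c 3 = c 4 * c 1 - c 5 * c 0 ∧ 0 < c 3 * F.P z ∧
    F.W z = c 0 * F.y1 z + c 1 ∧ F.R z = c 0 * Real.exp (F.y0 z) ∧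
    F.v z = c 2 - c 0 * F.y2 z ∧
    F.z0 z = F.y0 z + Real.log (c 3 / (F.P z * F.W z ^ 2)) ∧
    F.z1 z = (c 4 * F.y1 z + c 5) / F.W z ∧
    F.z2 z = c 3 * F.y2 z / F.W z - c 3 * F.X z * Real.exp (F.y0 z) / (F.P z * F.W z ^ 2)
      + c 2 * ((c 4 * F.y1 z + c 5) / F.W z) + c 6 := by
  have hexp : Real.exp (F.z0 z) = Real.exp (F.z0 z - F.y0 z) * Real.exp (F.y0 z) := by
    rw [← Real.exp_add]; ring_nf
  have hone : Real.exp (-F.y0 z) * Real.exp (F.y0 z) = 1 := by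
    rw [← Real.exp_add]; simp
  have h0 := h 0
  have h1 := h 1
  have h2 := h 2
  have h3 := h 3
  have h4 := h 4
  have h5 := h 5
  have h6 := h 6
  simp only [inv] at h0 h1 h2 h3 h4 h5 h6
  rw [h0] at h1 h2 h4 h5 h6
  rw [h1] at h5
  rw [h2, hexp] at h6
  have hWe : F.W z = c 0 * F.y1 z + c 1 := by linear_combination h1
  have hz1 : F.z1 z = (c 4 * F.y1 z + c 5) / F.W z := by
    rw [eq_div_iff hW, hWe]
    linear_combination F.y1 z * h4 + h5
  refine ⟨?_, ?_, hWe, ?_, by linear_combination h2, ?_, hz1, ?_⟩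
  · rw [← h3]
    linear_combination c 1 * h4 - c 0 * h5
      + F.P z * F.W z * Real.exp (F.z0 z - F.y0 z) * hWe
  · rw [← h3]
    have : 0 < F.P z ^ 2 * F.W z ^ 2 * Real.exp (F.z0 z - F.y0 z) := by positivity
    calc _ < _ := this
      _ = _ := by ring
  · linear_combination Real.exp (F.y0 z) * h0 - F.R z * hone
  · rw [← h3, show F.P z * (F.W z * F.W z) * Real.exp (F.z0 z - F.y0 z) / (F.P z * F.W z ^ 2)
      = Real.exp (F.z0 z - F.y0 z) by field_simp, Real.log_exp]
    ring
  · rw [← hz1, ← h3]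
    field_simp
    linear_combination h6

end Frame

/-! ### The coefficient functions of an admissible transformation -/

/-- The coefficient functions of the transformation `φ` between the equations with the arbitrary
elements `θ` and `θ'`. -/
noncomputable def frame (θ : ArbTuple) (φ : Pt → Pt) (θ' : ArbTuple) : Frame Pt where
  W := pd bu (cU φ)
  R := fun p => -pd bx (cU φ) p
  P := fun p => pd bx (cX φ) p / pd bu (cU φ) p
  v := fun p => cU φ p - pd bu (cU φ) p * p.2.2 - pd bx (cU φ) p * p.2.1
  X := fun p => cX φ p - pd bx (cX φ) p * p.2.1
  y0 := fun p => θ.Y0 p.1 p.2.1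
  y1 := fun p => θ.Y1 p.1 p.2.1
  y2 := fun p => θ.Y2 p.1 p.2.1
  z0 := fun p => θ'.Y0 (cT φ p) (cX φ p)
  z1 := fun p => θ'.Y1 (cT φ p) (cX φ p)
  z2 := fun p => θ'.Y2 (cT φ p) (cX φ p)

section Admissible

variable {Ω Ω' : Set (ℝ × ℝ)} {θ θ' : ArbTuple} {φ : OpenPartialHomeomorph Pt Pt} {p : Pt}

/-- P is defined through x- and u-derivatives because in the extended space these remain partial
derivatives, whereas T_t becomes a total derivative. -/
theorem IsAdmissible.frame_P (h : IsAdmissible Ω θ φ Ω' θ') (hp : p ∈ φ.source) :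
    (frame θ φ θ').P p = pd bt (cT φ) p := by
  change pd bx (cX φ) p / pd bu (cU φ) p = _
  rw [(h.det hp).Xx, mul_div_cancel_left₀ _ (h.det hp).Uu]

theorem IsAdmissible.smooth_frame (h : IsAdmissible Ω θ φ Ω' θ') :
    (frame θ φ θ').Smooth φ.source := by
  have hS := φ.open_source
  have hT := smooth_cT h.point.1
  have hX := smooth_cX h.point.1
  have hU := smooth_cU h.point.1
  have hUu := smooth_pd hS hU bu
  have hUx := smooth_pd hS hU bx
  have hXx := smooth_pd hS hX bx
  have hs : ∀ {f : ℝ → ℝ → ℝ}, SmoothOn f Ω →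
      ContDiffOn ℝ ∞ (fun p : Pt => f p.1 p.2.1) φ.source := fun hf =>
    smooth_along (T := fun p : Pt => p.1) (X := fun p : Pt => p.2.1) hf contDiffOn_fst
      (contDiff_fst.comp contDiff_snd).contDiffOn h.source_mem
  have ht : ∀ {f : ℝ → ℝ → ℝ}, SmoothOn f Ω' →
      ContDiffOn ℝ ∞ (fun p : Pt => f (cT φ p) (cX φ p)) φ.source := fun hf =>
    smooth_along hf hT hX h.target_mem
  exact {
    W := hUu
    R := hUx.neg
    P := hXx.div hUu fun p hp => (h.det hp).Uu
    v := by simp only [frame]; fun_prop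
    X := by simp only [frame]; fun_prop
    y0 := hs h.source.smooth_Y0, y1 := hs h.source.smooth_Y1, y2 := hs h.source.smooth_Y2
    z0 := ht h.target.smooth_Y0, z1 := ht h.target.smooth_Y1, z2 := ht h.target.smooth_Y2 }

/-- The determining equations in the language of frames. The speed d.1 is 0 in the directions of x
and u, which expresses that all the coefficients are functions of t. -/
theorem IsAdmissible.flow (h : IsAdmissible Ω θ φ Ω' θ') (hp : p ∈ φ.source) (d : Pt)
    (hd : d = bt ∨ d = bx ∨ d = bu) :
    (frame θ φ θ').Flow d d.1 (θ.A10 p.1 p.2.1) (θ.A11 p.1 p.2.1) (θ'.A10 (cT φ p) (cX φ p))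
      (θ'.A11 (cT φ p) (cX φ p)) (pd bt (pd bt (cT φ)) p)
      (pd bt (frame θ φ θ').X p) p := by
  have hS := φ.open_source
  have hT := smooth_cT h.point.1
  have hX := smooth_cX h.point.1
  have hU := smooth_cU h.point.1
  have D := h.det hp
  have hm := h.source_mem p hp
  have hF := h.smooth_frame
  have ht : ∀ v, pd v (pd bx (cX φ)) p = pd v (pd bu (cU φ)) p * pd bt (cT φ) p
      + pd bu (cU φ) p * pd v (pd bt (cT φ)) p := fun v => by
    rw [pd_congr hS (fun q hq => (h.det hq).Xx) hp]
    exact ((hasPd (smooth_pd hS hU bu) hS hp v).mul (hasPd (smooth_pd hS hT bt) hS hp v)).eq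
  have hTx : pd bx (pd bt (cT φ)) p = 0 := (h.pd_u_pd hp bt).2.1
  have hTu : pd bu (pd bt (cT φ)) p = 0 := (h.pd_u_pd hp bt).1
  have hUxu : pd bu (pd bx (cU φ)) p = 0 := by rw [pd_comm hS hU hp]; exact D.Uxu
  have hPc : Set.EqOn (frame θ φ θ').P (pd bt (cT φ)) φ.source := fun q hq => h.frame_P hq
  have hXv : ∀ v, HasPd v (frame θ φ θ').X (pd v (cX φ) p
      - (pd v (pd bx (cX φ)) p * p.2.1 + pd bx (cX φ) p * v.2.1)) p := fun v =>
    (hasPd hX hS hp v).sub ((hasPd (smooth_pd hS hX bx) hS hp v).mul (hasPd_x v p))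
  have hvv : ∀ v, HasPd v (frame θ φ θ').v (pd v (cU φ) p
      - (pd v (pd bu (cU φ)) p * p.2.2 + pd bu (cU φ) p * v.2.2)
      - (pd v (pd bx (cU φ)) p * p.2.1 + pd bx (cU φ) p * v.2.1)) p := fun v =>
    ((hasPd hU hS hp v).sub ((hasPd (smooth_pd hS hU bu) hS hp v).mul (hasPd_u v p))).sub
      ((hasPd (smooth_pd hS hU bx) hS hp v).mul (hasPd_x v p))
  have hPp := h.frame_P hp
  have hXeq : pd bt (frame θ φ θ').X p = pd bt (cX φ) p - pd bt (pd bx (cX φ)) p * p.2.1 := by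
    rw [(hXv bt).eq]; simp [bt]
  have hb11 := D.B11
  have hXt := D.Xt
  have hsrc : ∀ {f : ℝ → ℝ → ℝ}, SmoothOn f Ω → (∀ t x, (t, x) ∈ Ω → dx f t x = 0) →
      HasPd d (fun p : Pt => f p.1 p.2.1) (dt f p.1 p.2.1 * d.1) p := fun hf hx =>
    (hasPd_source h.source.isOpen hf hm d).val (by rw [hx _ _ hm]; ring)
  have htgt : ∀ {f : ℝ → ℝ → ℝ}, SmoothOn f Ω' → (∀ t x, (t, x) ∈ Ω' → dx f t x = 0) →
      HasPd d (fun p => f (cT φ p) (cX φ p))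
        (dt f (cT φ p) (cX φ p) * (frame θ φ θ').P p * d.1) p := fun hf hx =>
    (h.hasPd_target hp hf d).val (by
      rw [hx (cT φ p) (cX φ p) (h.target_mem p hp), hPp]
      rcases hd with rfl | rfl | rfl
      · simp [bt, mul_comm]
      · rw [D.Tx]; simp [bx]
      · rw [D.Tu]; simp [bu])
  exact {
    W := (hasPd (smooth_pd hS hU bu) hS hp d).val (by
      change _ = -pd bx (cU φ) p * d.1
      rcases hd with rfl | rfl | rfl
      · rw [D.Utu]; simp [bt]
      · rw [D.Uxu]; simp [bx]
      · rw [D.Uuu]; simp [bu])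
    R := (hasPd (smooth_pd hS hU bx) hS hp d).neg.val (by
      change _ = θ.A11 p.1 p.2.1 * -pd bx (cU φ) p * d.1
      rcases hd with rfl | rfl | rfl
      · rw [D.Utx]; simp [bt]
      · rw [D.Uxx]; simp [bx]
      · rw [hUxu]; simp [bu])
    P := ((hasPd (smooth_pd hS hT bt) hS hp d).congr_of_eqOn hS hp hPc).val (by
      rcases hd with rfl | rfl | rfl
      · simp [bt]
      · rw [hTx]; simp [bx]
      · rw [hTu]; simp [bu])
    v := (hvv d).val (by
      change _ = - -pd bx (cU φ) p * θ.A10 p.1 p.2.1 * d.1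
      rcases hd with rfl | rfl | rfl
      · rw [D.Utu, D.Utx, D.Ut]; simp [bt]; ring
      · rw [D.Uxu, D.Uxx]; simp [bx]
      · rw [D.Uuu, hUxu]; simp [bu])
    X := (hXv d).val (by
      rcases hd with rfl | rfl | rfl
      · rw [hXeq]; simp [bt]
      · rw [ht, hTx, D.Uxu]; simp [bx]
      · rw [ht, hTu, D.Uuu, D.Xu]; simp [bu])
    y0 := (hsrc h.source.smooth_Y0 h.source.Y0_x).val (by rw [h.source.Y0_t _ _ hm])
    y1 := (hsrc h.source.smooth_Y1 h.source.Y1_x).val (by rw [h.source.Y1_t _ _ hm]; rfl)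
    y2 := (hsrc h.source.smooth_Y2 h.source.Y2_x).val (by rw [h.source.Y2_t _ _ hm]; rfl)
    z0 := (htgt h.target.smooth_Y0 h.target.Y0_x).val (by
      rw [h.target.Y0_t (cT φ p) (cX φ p) (h.target_mem p hp)])
    z1 := (htgt h.target.smooth_Y1 h.target.Y1_x).val (by
      rw [h.target.Y1_t (cT φ p) (cX φ p) (h.target_mem p hp)]; rfl)
    z2 := (htgt h.target.smooth_Y2 h.target.Y2_x).val (by
      rw [h.target.Y2_t (cT φ p) (cX φ p) (h.target_mem p hp)]; rfl)
    rel11 := by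
      rw [hPp]
      change _ * (_ * pd bu (cU φ) p) = _ * (pd bu (cU φ) p * _) - pd bu (cU φ) p * _
        - 2 * -pd bx (cU φ) p * _
      linear_combination hb11
    rel10 := by
      rw [hXeq, hPp, hXt, ht, D.Utu]
      change _ = pd bu (cU φ) p * _ * _ - _
        + (cU φ p - pd bu (cU φ) p * p.2.2 - pd bx (cU φ) p * p.2.1) * _
        - _ * (cX φ p - pd bx (cX φ) p * p.2.1) * _
      rw [D.Xx]
      linear_combination -p.2.1 * hb11 }

theorem IsAdmissible.pd_inv (h : IsAdmissible Ω θ φ Ω' θ') (hp : p ∈ φ.source) (i : Fin 7)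
    (v : Pt) : pd v ((frame θ φ θ').inv i) p = 0 := by
  obtain ⟨v1, v2, v3⟩ := v
  rw [pd_pt, ((h.flow hp bt (by simp)).inv i).eq, ((h.flow hp bx (by simp)).inv i).eq,
    ((h.flow hp bu (by simp)).inv i).eq]
  ring

end Admissible

/-! ### Tuples of arbitrary elements with prescribed jets -/

theorem exists_primitive {g : ℝ → ℝ} (hg : ContDiff ℝ ∞ g) (t₀ c : ℝ) :
    ∃ G : ℝ → ℝ, ContDiff ℝ ∞ G ∧ (∀ t, HasDerivAt G (g t) t) ∧ G t₀ = c := by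
  have hd : ∀ t, HasDerivAt (fun t => c + ∫ s in t₀..t, g s) (g t) t := fun t =>
    (intervalIntegral.integral_hasDerivAt_right (hg.continuous.intervalIntegrable _ _)
      (hg.continuous.stronglyMeasurableAtFilter _ _) hg.continuous.continuousAt).const_add c
  refine ⟨_, contDiff_infty_iff_deriv.2 ⟨fun t => (hd t).differentiableAt, ?_⟩, hd, by simp⟩
  rw [show deriv (fun t => c + ∫ s in t₀..t, g s) = g from funext fun t => (hd t).deriv]
  exact hg

theorem smoothOn_of_time {h : ℝ → ℝ} (hh : ContDiff ℝ ∞ h) (Ω : Set (ℝ × ℝ)) :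
    SmoothOn (fun t _ => h t) Ω :=
  (hh.comp contDiff_fst).contDiffOn

theorem dx_of_time (h : ℝ → ℝ) (t x : ℝ) : dx (fun t _ => h t) t x = 0 := by
  simp [dx]

/-- A¹⁰, A¹¹, A² are affine with the prescribed slopes, and Y⁰, Y¹, Y² come from successive
integration. The first derivatives of the Y's are fixed by the auxiliary system, so j₁, …, j₄ are
all the freedom at first order. -/
theorem exists_isArbTuple (p : Pt) (w : Val) (hw : w.2.2.1 ≠ 0) (j₁ j₂ j₃ j₄ : ℝ) :
    ∃ (Ω : Set (ℝ × ℝ)) (θ : ArbTuple), IsArbTuple Ω θ ∧ tx p ∈ Ω ∧ θ.val p = w ∧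
      dt θ.A10 p.1 p.2.1 = j₁ ∧ dt θ.A11 p.1 p.2.1 = j₂ ∧ dt θ.A2 p.1 p.2.1 = j₃ ∧
      dx θ.A2 p.1 p.2.1 = j₄ := by
  obtain ⟨t₀, x₀, u₀⟩ := p
  obtain ⟨a10, a11, a2, y0, y1, y2⟩ := w
  have hlin : ∀ a j : ℝ, ContDiff ℝ ∞ (fun t => a + j * (t - t₀)) := fun a j => by fun_prop
  have hlin' : ∀ a j t : ℝ, HasDerivAt (fun t => a + j * (t - t₀)) j t := fun a j t => by
    simpa using (((hasDerivAt_id t).sub_const t₀).const_mul j).const_add a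
  obtain ⟨Y0, sY0, dY0, vY0⟩ := exists_primitive (hlin a11 j₂) t₀ y0
  obtain ⟨Y1, sY1, dY1, vY1⟩ := exists_primitive (Real.contDiff_exp.comp sY0) t₀ y1
  obtain ⟨Y2, sY2, dY2, vY2⟩ := exists_primitive
    ((hlin a10 j₁).mul (Real.contDiff_exp.comp sY0)) t₀ y2
  have sA2 : ContDiff ℝ ∞ (unc fun t x => a2 + j₃ * (t - t₀) + j₄ * (x - x₀)) := by
    unfold unc; fun_prop
  refine ⟨{z | a2 + j₃ * (z.1 - t₀) + j₄ * (z.2 - x₀) ≠ 0},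
    ⟨fun t _ => a10 + j₁ * (t - t₀), fun t _ => a11 + j₂ * (t - t₀),
      fun t x => a2 + j₃ * (t - t₀) + j₄ * (x - x₀), fun t _ => Y0 t, fun t _ => Y1 t,
      fun t _ => Y2 t⟩, ?_, ?_, ?_, ?_, ?_, ?_, ?_⟩
  · exact {
      isOpen := isOpen_ne_fun sA2.continuous continuous_const
      smooth_A10 := smoothOn_of_time (hlin _ _) _
      smooth_A11 := smoothOn_of_time (hlin _ _) _
      smooth_A2 := sA2.contDiffOn
      smooth_Y0 := smoothOn_of_time sY0 _
      smooth_Y1 := smoothOn_of_time sY1 _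
      smooth_Y2 := smoothOn_of_time sY2 _
      A10_x := fun t x _ => dx_of_time _ t x
      A11_x := fun t x _ => dx_of_time _ t x
      Y0_x := fun t x _ => dx_of_time _ t x
      Y1_x := fun t x _ => dx_of_time _ t x
      Y2_x := fun t x _ => dx_of_time _ t x
      A2_ne := fun t x h => h
      Y0_t := fun t x _ => (dY0 t).deriv
      Y1_t := fun t x _ => (dY1 t).deriv
      Y2_t := fun t x _ => (dY2 t).deriv }
  · change a2 + j₃ * (t₀ - t₀) + j₄ * (x₀ - x₀) ≠ 0
    rw [sub_self, sub_self, mul_zero, mul_zero, add_zero, add_zero]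
    exact hw
  · simp [ArbTuple.val, vY0, vY1, vY2]
  · exact (hlin' a10 j₁ t₀).deriv
  · exact (hlin' a11 j₂ t₀).deriv
  · change deriv (fun t => a2 + j₃ * (t - t₀) + j₄ * (x₀ - x₀)) t₀ = j₃
    exact ((hlin' a2 j₃ t₀).add_const _).deriv
  · change deriv (fun x => a2 + j₃ * (t₀ - t₀) + j₄ * (x - x₀)) x₀ = j₄
    have := (((hasDerivAt_id x₀).sub_const x₀).const_mul j₄).const_add (a2 + j₃ * (t₀ - t₀))
    exact this.deriv.trans (mul_one _)

/-! ### The extended space -/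

/-- The direction of `t`. -/
def et : Ext := (bt, 0)
/-- The direction of `x`. -/
def ex : Ext := (bx, 0)
/-- The direction of `u`. -/
def eu : Ext := (bu, 0)
/-- The direction of `A¹⁰`. -/
def e10 : Ext := (0, (1, 0, 0, 0, 0, 0))
/-- The direction of `A¹¹`. -/
def e11 : Ext := (0, (0, 1, 0, 0, 0, 0))
/-- The direction of `A²`. -/
def e2 : Ext := (0, (0, 0, 1, 0, 0, 0))
/-- The direction of `Y⁰`. -/
def f0 : Ext := (0, (0, 0, 0, 1, 0, 0))
/-- The direction of `Y¹`. -/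
def f1 : Ext := (0, (0, 0, 0, 0, 1, 0))
/-- The direction of `Y²`. -/
def f2 : Ext := (0, (0, 0, 0, 0, 0, 1))

theorem pd_ext (F : Ext → ℝ) (z d : Ext) :
    pd d F z = d.1.1 * pd et F z + d.1.2.1 * pd ex F z + d.1.2.2 * pd eu F z
      + d.2.1 * pd e10 F z + d.2.2.1 * pd e11 F z + d.2.2.2.1 * pd e2 F z
      + d.2.2.2.2.1 * pd f0 F z + d.2.2.2.2.2.1 * pd f1 F z + d.2.2.2.2.2.2 * pd f2 F z := by
  simp only [← pd_smul_vec, ← pd_add_vec]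
  congr 1
  obtain ⟨⟨d1, d2, d3⟩, d4, d5, d6, d7, d8, d9⟩ := d
  simp [et, ex, eu, e10, e11, e2, f0, f1, f2, bt, bx, bu]

/-- The coordinate `A¹⁰`. -/
def v10 (z : Ext) : ℝ := z.2.1
/-- The coordinate `A¹¹`. -/
def v11 (z : Ext) : ℝ := z.2.2.1
/-- The coordinate `A²`. -/
def v2 (z : Ext) : ℝ := z.2.2.2.1
/-- The coordinate `Y⁰`. -/
def w0 (z : Ext) : ℝ := z.2.2.2.2.1
/-- The coordinate `Y¹`. -/
def w1 (z : Ext) : ℝ := z.2.2.2.2.2.1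
/-- The coordinate `Y²`. -/
def w2 (z : Ext) : ℝ := z.2.2.2.2.2.2

theorem hasPd_v10 (d z : Ext) : HasPd d v10 d.2.1 z := hasPd_snd (hasPd_fst (hasPd_id _ _))
theorem hasPd_v11 (d z : Ext) : HasPd d v11 d.2.2.1 z :=
  hasPd_snd (hasPd_snd (hasPd_fst (hasPd_id _ _)))
theorem hasPd_v2 (d z : Ext) : HasPd d v2 d.2.2.2.1 z :=
  hasPd_snd (hasPd_snd (hasPd_snd (hasPd_fst (hasPd_id _ _))))
theorem hasPd_w0 (d z : Ext) : HasPd d w0 d.2.2.2.2.1 z :=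
  hasPd_snd (hasPd_snd (hasPd_snd (hasPd_snd (hasPd_fst (hasPd_id _ _)))))
theorem hasPd_w1 (d z : Ext) : HasPd d w1 d.2.2.2.2.2.1 z :=
  hasPd_snd (hasPd_snd (hasPd_snd (hasPd_snd (hasPd_snd (hasPd_fst (hasPd_id _ _))))))
theorem hasPd_w2 (d z : Ext) : HasPd d w2 d.2.2.2.2.2.2 z :=
  hasPd_snd (hasPd_snd (hasPd_snd (hasPd_snd (hasPd_snd (hasPd_snd (hasPd_id _ _))))))

theorem smooth_v10 : ContDiff ℝ ∞ v10 := by unfold v10; fun_prop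
theorem smooth_v11 : ContDiff ℝ ∞ v11 := by unfold v11; fun_prop
theorem smooth_v2 : ContDiff ℝ ∞ v2 := by unfold v2; fun_prop
theorem smooth_w0 : ContDiff ℝ ∞ w0 := by unfold w0; fun_prop
theorem smooth_w1 : ContDiff ℝ ∞ w1 := by unfold w1; fun_prop
theorem smooth_w2 : ContDiff ℝ ∞ w2 := by unfold w2; fun_prop

/-- The total derivative with respect to `t`, where `j₁`, `j₂`, `j₃` are the derivatives of
`A¹⁰`, `A¹¹` and `A²`. -/
noncomputable def total (j₁ j₂ j₃ : ℝ) (F : Ext → ℝ) (z : Ext) : ℝ :=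
  pd et F z + j₁ * pd e10 F z + j₂ * pd e11 F z + j₃ * pd e2 F z + v11 z * pd f0 F z
    + Real.exp (w0 z) * pd f1 F z + v10 z * Real.exp (w0 z) * pd f2 F z

/-- The graph of a tuple of arbitrary elements. -/
def sec (θ : ArbTuple) (p : Pt) : Ext := (p, θ.val p)

section Section

variable {Ω : Set (ℝ × ℝ)} {θ : ArbTuple} {p : Pt}

theorem IsArbTuple.hasFDerivAt_sec (h : IsArbTuple Ω θ) (hp : tx p ∈ Ω) :
    ∃ L : Pt →L[ℝ] Ext, HasFDerivAt (sec θ) L p ∧ ∀ d, L d = (d,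
      (d.1 * dt θ.A10 p.1 p.2.1, d.1 * dt θ.A11 p.1 p.2.1,
        d.1 * dt θ.A2 p.1 p.2.1 + d.2.1 * dx θ.A2 p.1 p.2.1, d.1 * θ.A11 p.1 p.2.1,
        d.1 * Real.exp (θ.Y0 p.1 p.2.1), d.1 * (θ.A10 p.1 p.2.1 * Real.exp (θ.Y0 p.1 p.2.1)))) := by
  have hs : ∀ {f : ℝ → ℝ → ℝ}, SmoothOn f Ω → ∀ d : Pt,
      HasPd d (fun p : Pt => f p.1 p.2.1) (d.1 * dt f p.1 p.2.1 + d.2.1 * dx f p.1 p.2.1) p :=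
    fun hf d => hasPd_source h.isOpen hf hp d
  refine ⟨_, (hasFDerivAt_id p).prodMk
    ((hs h.smooth_A10 0).hasFDerivAt.prodMk ((hs h.smooth_A11 0).hasFDerivAt.prodMk
      ((hs h.smooth_A2 0).hasFDerivAt.prodMk ((hs h.smooth_Y0 0).hasFDerivAt.prodMk
        ((hs h.smooth_Y1 0).hasFDerivAt.prodMk (hs h.smooth_Y2 0).hasFDerivAt))))), fun d => ?_⟩
  have e1 := (hs h.smooth_A10 d).eq
  have e2 := (hs h.smooth_A11 d).eq
  have e3 := (hs h.smooth_A2 d).eq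
  have e4 := (hs h.smooth_Y0 d).eq
  have e5 := (hs h.smooth_Y1 d).eq
  have e6 := (hs h.smooth_Y2 d).eq
  rw [h.A10_x _ _ hp, mul_zero, add_zero] at e1
  rw [h.A11_x _ _ hp, mul_zero, add_zero] at e2
  rw [h.Y0_x _ _ hp, h.Y0_t _ _ hp, mul_zero, add_zero] at e4
  rw [h.Y1_x _ _ hp, h.Y1_t _ _ hp, mul_zero, add_zero] at e5
  rw [h.Y2_x _ _ hp, h.Y2_t _ _ hp, mul_zero, add_zero] at e6
  exact Prod.ext rfl (Prod.ext e1 (Prod.ext e2 (Prod.ext e3 (Prod.ext e4 (Prod.ext e5 e6)))))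

theorem IsArbTuple.smooth_sec (h : IsArbTuple Ω θ) : ContDiffOn ℝ ∞ (sec θ) (tx ⁻¹' Ω) := by
  have hs : ∀ {f : ℝ → ℝ → ℝ}, SmoothOn f Ω →
      ContDiffOn ℝ ∞ (fun p : Pt => f p.1 p.2.1) (tx ⁻¹' Ω) := fun hf =>
    smooth_along (T := fun p : Pt => p.1) (X := fun p : Pt => p.2.1) hf contDiffOn_fst
      (contDiff_fst.comp contDiff_snd).contDiffOn fun z hz => hz
  exact contDiffOn_id.prodMk ((hs h.smooth_A10).prodMk ((hs h.smooth_A11).prodMk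
    ((hs h.smooth_A2).prodMk ((hs h.smooth_Y0).prodMk ((hs h.smooth_Y1).prodMk
      (hs h.smooth_Y2))))))

theorem continuous_tx : Continuous tx := by unfold tx; fun_prop

theorem IsArbTuple.isOpen_preimage (h : IsArbTuple Ω θ) : IsOpen (tx ⁻¹' Ω) :=
  h.isOpen.preimage continuous_tx

theorem IsArbTuple.hasPd_sec (h : IsArbTuple Ω θ) (hp : tx p ∈ Ω) {F : Ext → ℝ}
    (hF : DifferentiableAt ℝ F (sec θ p)) :
    HasPd bu (fun q => F (sec θ q)) (pd eu F (sec θ p)) p ∧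
    HasPd bx (fun q => F (sec θ q))
      (pd ex F (sec θ p) + dx θ.A2 p.1 p.2.1 * pd e2 F (sec θ p)) p ∧
    HasPd bt (fun q => F (sec θ q))
      (total (dt θ.A10 p.1 p.2.1) (dt θ.A11 p.1 p.2.1) (dt θ.A2 p.1 p.2.1) F (sec θ p)) p := by
  obtain ⟨L, hL, hLv⟩ := h.hasFDerivAt_sec hp
  refine ⟨(HasPd.comp hF hL bu).val ?_, (HasPd.comp hF hL bx).val ?_,
    (HasPd.comp hF hL bt).val ?_⟩
  · rw [pd_ext, hLv]; simp [bu]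
  · rw [pd_ext, hLv]; simp [bx]
  · rw [pd_ext, hLv]
    simp only [bt, one_mul, zero_mul, add_zero]
    rfl

end Section

/-! ### Components of transformations of the extended space -/

/-- The `t`-component. -/
def eT (e : Ext → Ext) (z : Ext) : ℝ := (e z).1.1
/-- The `x`-component. -/
def eX (e : Ext → Ext) (z : Ext) : ℝ := (e z).1.2.1
/-- The `u`-component. -/
def eU (e : Ext → Ext) (z : Ext) : ℝ := (e z).1.2.2

section Components

variable {e : Ext → Ext} {S : Set Ext}

theorem smooth_comp_ext {g : Ext → ℝ} (hg : ContDiff ℝ ∞ g) (he : ContDiffOn ℝ ∞ e S) :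
    ContDiffOn ℝ ∞ (fun z => g (e z)) S := hg.comp_contDiffOn he

theorem smooth_eT (he : ContDiffOn ℝ ∞ e S) : ContDiffOn ℝ ∞ (eT e) S := he.fst.fst
theorem smooth_eX (he : ContDiffOn ℝ ∞ e S) : ContDiffOn ℝ ∞ (eX e) S := he.fst.snd.fst
theorem smooth_eU (he : ContDiffOn ℝ ∞ e S) : ContDiffOn ℝ ∞ (eU e) S := he.fst.snd.snd

end Components

section Generated

variable {Ω Ω' : Set (ℝ × ℝ)} {θ θ' : ArbTuple} {φ : OpenPartialHomeomorph Pt Pt} {p : Pt}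
  {e : OpenPartialHomeomorph Ext Ext}

theorem Generates.mem (h : Generates e θ φ θ') (hp : p ∈ φ.source) : sec θ p ∈ e.source :=
  (h p hp).1

theorem Generates.apply (h : Generates e θ φ θ') (hp : p ∈ φ.source) :
    e (sec θ p) = (φ p, θ'.val (φ p)) := (h p hp).2

/-- The source of all splitting: a point with A² ≠ 0 lies on graphs with arbitrary j₁, …, j₄, and
the chain rule makes every derivative of a substituted function affine in these parameters. -/
theorem IsGenEquiv.realize (he : IsGenEquiv e) {z : Ext} (hz : z ∈ e.source) (h2 : v2 z ≠ 0)
    (j₁ j₂ j₃ j₄ : ℝ) :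
    ∃ (Ω Ω' : Set (ℝ × ℝ)) (θ θ' : ArbTuple) (φ : OpenPartialHomeomorph Pt Pt),
      IsAdmissible Ω θ φ Ω' θ' ∧ Generates e θ φ θ' ∧ z.1 ∈ φ.source ∧ sec θ z.1 = z ∧
      ∀ {F : Pt → ℝ} {G : Ext → ℝ}, DifferentiableAt ℝ G z →
        Set.EqOn F (fun q => G (sec θ q)) φ.source →
        pd bu F z.1 = pd eu G z ∧ pd bx F z.1 = pd ex G z + j₄ * pd e2 G z ∧
          pd bt F z.1 = total j₁ j₂ j₃ G z := by
  obtain ⟨Ω, θ, hθ, hpΩ, hval, h1, h2', h3, h4⟩ := exists_isArbTuple z.1 z.2 h2 j₁ j₂ j₃ j₄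
  have hs : sec θ z.1 = z := Prod.ext rfl hval
  obtain ⟨φ, Ω', θ', hp, hadm, hgen⟩ := he.2 Ω θ hθ z.1 hpΩ (by
    change sec θ z.1 ∈ _; rw [hs]; exact hz)
  refine ⟨Ω, Ω', θ, θ', φ, hadm, hgen, hp, hs, fun {F G} hG hFG => ?_⟩
  obtain ⟨k1, k2, k3⟩ := hθ.hasPd_sec hpΩ (F := G) (by rw [hs]; exact hG)
  rw [hs] at k1 k2 k3
  rw [h4] at k2
  rw [h1, h2', h3] at k3
  rw [pd_congr φ.open_source hFG hp, pd_congr φ.open_source hFG hp,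
    pd_congr φ.open_source hFG hp]
  exact ⟨k1.eq, k2.eq, k3.eq⟩

end Generated

/-! ### Functions that are constant along graphs -/

/-- The total derivative is affine in A¹⁰ and A¹¹. When neither G nor M depends on them, their
coefficients exp(Y⁰) G_{Y²} and G_{Y⁰} must vanish. -/
theorem pd_Y_eq_zero {S : Set Ext} (hS : IsOpen S) {G M : Ext → ℝ} (hG : ContDiffOn ℝ ∞ G S)
    (h10 : ∀ z ∈ S, pd e10 G z = 0) (h11 : ∀ z ∈ S, pd e11 G z = 0)
    (hM : ∀ z ∈ S, total 0 0 0 G z = M z)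
    (hM10 : ∀ z ∈ S, pd e10 M z = 0) (hM11 : ∀ z ∈ S, pd e11 M z = 0) {z : Ext} (hz : z ∈ S) :
    pd f0 G z = 0 ∧ pd f2 G z = 0 ∧ pd et G z + Real.exp (w0 z) * pd f1 G z = M z := by
  have hg : ∀ d k, HasPd d (pd k G) (pd d (pd k G) z) z := fun d k =>
    hasPd (smooth_pd hS hG k) hS hz d
  have h10' : ∀ k, HasPd e10 (pd k G) 0 z := fun k => (hg e10 k).val (by
    rw [pd_comm hS hG hz]; exact pd_eq_zero hS h10 hz k)
  have h11' : ∀ k, HasPd e11 (pd k G) 0 z := fun k => (hg e11 k).val (by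
    rw [pd_comm hS hG hz]; exact pd_eq_zero hS h11 hz k)
  have ht : ∀ z ∈ S, pd et G z + v11 z * pd f0 G z + Real.exp (w0 z) * pd f1 G z
      + v10 z * Real.exp (w0 z) * pd f2 G z = M z := by
    intro z hz
    rw [← hM z hz, total]; ring
  have k10 := (((h10' et).add ((hasPd_v11 e10 z).mul (h10' f0))).add
    ((hasPd_w0 e10 z).exp.mul (h10' f1))).add
    (((hasPd_v10 e10 z).mul (hasPd_w0 e10 z).exp).mul (h10' f2))
  have k11 := (((h11' et).add ((hasPd_v11 e11 z).mul (h11' f0))).add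
    ((hasPd_w0 e11 z).exp.mul (h11' f1))).add
    (((hasPd_v10 e11 z).mul (hasPd_w0 e11 z).exp).mul (h11' f2))
  have q10 := k10.eq
  have q11 := k11.eq
  rw [pd_congr hS ht hz, hM10 z hz] at q10
  rw [pd_congr hS ht hz, hM11 z hz] at q11
  have q2 : pd f2 G z = 0 := by simpa [e10] using q10.symm
  have q0 : pd f0 G z = 0 := by simpa [e11] using q11.symm
  refine ⟨q0, q2, ?_⟩
  rw [← ht z hz, q0, q2]; ring

/-- After G_{Y⁰} = G_{Y²} = 0, the equation G_t + exp(Y⁰) G_{Y¹} = 0 remains; differentiating it in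
Y⁰ separates the two terms. -/
theorem pd_eq_zero_of_total {S : Set Ext} (hS : IsOpen S) {G : Ext → ℝ} (hG : ContDiffOn ℝ ∞ G S)
    (hx : ∀ z ∈ S, pd ex G z = 0) (hu : ∀ z ∈ S, pd eu G z = 0)
    (h10 : ∀ z ∈ S, pd e10 G z = 0) (h11 : ∀ z ∈ S, pd e11 G z = 0)
    (h2 : ∀ z ∈ S, pd e2 G z = 0) (ht : ∀ z ∈ S, total 0 0 0 G z = 0) {z : Ext} (hz : z ∈ S)
    (d : Ext) : pd d G z = 0 := by
  have hc : ∀ d, ∀ z ∈ S, pd d (fun _ : Ext => (0 : ℝ)) z = 0 := fun d z _ => (HasPd.const 0).eq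
  have h := fun z hz => pd_Y_eq_zero hS (z := z) hG h10 h11 (M := fun _ => 0) ht (hc _) (hc _) hz
  have hf1 : pd f1 G z = 0 := by
    have hg : ∀ k, HasPd f0 (pd k G) 0 z := fun k =>
      (hasPd (smooth_pd hS hG k) hS hz f0).val (by
        rw [pd_comm hS hG hz]; exact pd_eq_zero hS (fun y hy => (h y hy).1) hz k)
    have q := ((hg et).add ((hasPd_w0 f0 z).exp.mul (hg f1))).eq
    rw [pd_eq_zero hS (fun y hy => (h y hy).2.2) hz] at q
    simpa [f0] using q.symm
  obtain ⟨h0, h2', h1⟩ := h z hz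
  rw [hf1, mul_zero, add_zero] at h1
  rw [pd_ext, h1, hx z hz, hu z hz, h10 z hz, h11 z hz, h2 z hz, h0, hf1, h2']
  ring

theorem total_injective {G : Ext → ℝ} {z : Ext} {c : ℝ} (h : ∀ j₁ j₂ j₃, total j₁ j₂ j₃ G z = c) :
    pd e10 G z = 0 ∧ pd e11 G z = 0 ∧ pd e2 G z = 0 ∧ total 0 0 0 G z = c := by
  have h0 := h 0 0 0
  have h1 := h 1 0 0
  have h2 := h 0 1 0
  have h3 := h 0 0 1
  refine ⟨?_, ?_, ?_, h0⟩ <;> unfold total at h0 h1 h2 h3 <;> linarith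

/-! ### The regular part of the domain of a generalized equivalence transformation -/

/-- The points of the domain at which `A² ≠ 0`. -/
def reg (e : OpenPartialHomeomorph Ext Ext) : Set Ext := e.source ∩ {z | v2 z ≠ 0}

theorem isOpen_reg (e : OpenPartialHomeomorph Ext Ext) : IsOpen (reg e) :=
  e.open_source.inter (isOpen_ne_fun smooth_v2.continuous continuous_const)

/-- The coefficient functions of a transformation of the extended space. -/
noncomputable def extFrame (e : Ext → Ext) : Frame Ext where
  W := pd eu (eU e)
  R := fun z => -pd ex (eU e) z
  P := fun z => pd ex (eX e) z / pd eu (eU e) z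
  v := fun z => eU e z - pd eu (eU e) z * z.1.2.2 - pd ex (eU e) z * z.1.2.1
  X := fun z => eX e z - pd ex (eX e) z * z.1.2.1
  y0 := w0
  y1 := w1
  y2 := w2
  z0 := fun z => w0 (e z)
  z1 := fun z => w1 (e z)
  z2 := fun z => w2 (e z)

theorem smooth_extFrame {e : Ext → Ext} {S : Set Ext} (hS : IsOpen S) (he : ContDiffOn ℝ ∞ e S)
    (hW : ∀ z ∈ S, pd eu (eU e) z ≠ 0) : (extFrame e).Smooth S := by
  have hX := smooth_eX he
  have hU := smooth_eU he
  have hUu := smooth_pd hS hU eu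
  have hUx := smooth_pd hS hU ex
  have hXx := smooth_pd hS hX ex
  exact {
    W := hUu
    R := hUx.neg
    P := hXx.div hUu hW
    v := by simp only [extFrame]; fun_prop
    X := by simp only [extFrame]; fun_prop
    y0 := smooth_w0.contDiffOn, y1 := smooth_w1.contDiffOn, y2 := smooth_w2.contDiffOn
    z0 := smooth_comp_ext (g := w0) smooth_w0 he, z1 := smooth_comp_ext (g := w1) smooth_w1 he
    z2 := smooth_comp_ext (g := w2) smooth_w2 he }

/-! ### Splitting with respect to derivatives of the arbitrary elements -/

section Generated

variable {Ω Ω' : Set (ℝ × ℝ)} {θ θ' : ArbTuple} {φ : OpenPartialHomeomorph Pt Pt} {p : Pt}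
  {e : OpenPartialHomeomorph Ext Ext} {z : Ext}

theorem Generates.eqOn_T (h : Generates e θ φ θ') :
    Set.EqOn (fun q => eT e (sec θ q)) (cT φ) φ.source := fun q hq => by
  simp only [eT, h.apply hq]; rfl

theorem Generates.eqOn_X (h : Generates e θ φ θ') :
    Set.EqOn (fun q => eX e (sec θ q)) (cX φ) φ.source := fun q hq => by
  simp only [eX, h.apply hq]; rfl

theorem Generates.eqOn_U (h : Generates e θ φ θ') :
    Set.EqOn (fun q => eU e (sec θ q)) (cU φ) φ.source := fun q hq => by
  simp only [eU, h.apply hq]; rfl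

theorem Generates.mem_reg (hg : Generates e θ φ θ') (ha : IsAdmissible Ω θ φ Ω' θ')
    (hp : p ∈ φ.source) : sec θ p ∈ reg e := ⟨hg.mem hp, ha.A2_ne hp⟩

variable (he : IsGenEquiv e)

include he

theorem IsGenEquiv.smooth_reg : ContDiffOn ℝ ∞ e (reg e) := he.1.1.mono fun _ h => h.1

theorem IsGenEquiv.pd_eu {G : Ext → ℝ} (hG : ContDiffOn ℝ ∞ G (reg e)) (hz : z ∈ reg e) {c : ℝ}
    (h : ∀ (Ω Ω' : Set (ℝ × ℝ)) (θ θ' : ArbTuple) (φ : OpenPartialHomeomorph Pt Pt),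
      IsAdmissible Ω θ φ Ω' θ' → Generates e θ φ θ' → z.1 ∈ φ.source → sec θ z.1 = z →
      pd bu (fun q => G (sec θ q)) z.1 = c) : pd eu G z = c := by
  obtain ⟨Ω, Ω', θ, θ', φ, ha, hg, hp, hs, k⟩ := he.realize hz.1 hz.2 0 0 0 0
  rw [← h _ _ _ _ _ ha hg hp hs, (k (smooth_at hG (isOpen_reg e) hz) fun q _ => rfl).1]

/-- The value c is the same for all tuples through z, whereas A²_x is arbitrary, so its coefficient
vanishes. -/
theorem IsGenEquiv.pd_ex {G : Ext → ℝ} (hG : ContDiffOn ℝ ∞ G (reg e)) (hz : z ∈ reg e) {c : ℝ}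
    (h : ∀ (Ω Ω' : Set (ℝ × ℝ)) (θ θ' : ArbTuple) (φ : OpenPartialHomeomorph Pt Pt),
      IsAdmissible Ω θ φ Ω' θ' → Generates e θ φ θ' → z.1 ∈ φ.source → sec θ z.1 = z →
      pd bx (fun q => G (sec θ q)) z.1 = c) : pd ex G z = c ∧ pd e2 G z = 0 := by
  have key : ∀ j, pd ex G z + j * pd e2 G z = c := by
    intro j
    obtain ⟨Ω, Ω', θ, θ', φ, ha, hg, hp, hs, k⟩ := he.realize hz.1 hz.2 0 0 0 j
    rw [← h _ _ _ _ _ ha hg hp hs, (k (smooth_at hG (isOpen_reg e) hz) fun q _ => rfl).2.1]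
  have k0 := key 0
  have k1 := key 1
  constructor <;> linarith

theorem IsGenEquiv.total_eq {G : Ext → ℝ} (hG : ContDiffOn ℝ ∞ G (reg e)) (hz : z ∈ reg e) {c : ℝ}
    (h : ∀ (Ω Ω' : Set (ℝ × ℝ)) (θ θ' : ArbTuple) (φ : OpenPartialHomeomorph Pt Pt),
      IsAdmissible Ω θ φ Ω' θ' → Generates e θ φ θ' → z.1 ∈ φ.source → sec θ z.1 = z →
      pd bt (fun q => G (sec θ q)) z.1 = c) :
    pd e10 G z = 0 ∧ pd e11 G z = 0 ∧ pd e2 G z = 0 ∧ total 0 0 0 G z = c := by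
  refine total_injective fun j₁ j₂ j₃ => ?_
  obtain ⟨Ω, Ω', θ, θ', φ, ha, hg, hp, hs, k⟩ := he.realize hz.1 hz.2 j₁ j₂ j₃ 0
  rw [← h _ _ _ _ _ ha hg hp hs, (k (smooth_at hG (isOpen_reg e) hz) fun q _ => rfl).2.2]

theorem IsGenEquiv.pd_T (hz : z ∈ reg e) :
    pd eu (eT e) z = 0 ∧ pd ex (eT e) z = 0 ∧ pd e2 (eT e) z = 0 :=
  ⟨he.pd_eu (smooth_eT he.smooth_reg) hz fun _ _ _ _ φ ha hg hp _ => by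
      rw [pd_congr φ.open_source hg.eqOn_T hp]; exact (ha.det hp).Tu,
    he.pd_ex (smooth_eT he.smooth_reg) hz fun _ _ _ _ φ ha hg hp _ => by
      rw [pd_congr φ.open_source hg.eqOn_T hp]; exact (ha.det hp).Tx⟩

theorem IsGenEquiv.pd_eu_X (hz : z ∈ reg e) : pd eu (eX e) z = 0 :=
  he.pd_eu (smooth_eX he.smooth_reg) hz fun _ _ _ _ φ ha hg hp _ => by
    rw [pd_congr φ.open_source hg.eqOn_X hp]; exact (ha.det hp).Xu

omit he in
theorem Generates.eqOn_W (he : IsGenEquiv e) (hg : Generates e θ φ θ')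
    (ha : IsAdmissible Ω θ φ Ω' θ') :
    Set.EqOn (fun q => pd eu (eU e) (sec θ q)) (pd bu (cU φ)) φ.source := fun q hq => by
  rw [← pd_congr φ.open_source hg.eqOn_U hq]
  exact (ha.source.hasPd_sec (ha.source_mem q hq) (smooth_at (smooth_eU he.smooth_reg)
    (isOpen_reg e) (hg.mem_reg ha hq))).1.eq.symm

theorem IsGenEquiv.W_ne (hz : z ∈ reg e) : pd eu (eU e) z ≠ 0 := by
  obtain ⟨Ω, Ω', θ, θ', φ, ha, hg, hp, hs, k⟩ := he.realize hz.1 hz.2 0 0 0 0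
  have := hg.eqOn_W he ha hp
  simp only [hs] at this
  rw [this]
  exact (ha.det hp).Uu

/-- In U_tu = -U_x the left-hand side does not involve A²_x, whereas the right-hand side contains it
with the coefficient -∂U/∂A². -/
theorem IsGenEquiv.pd_e2_U (hz : z ∈ reg e) : pd e2 (eU e) z = 0 := by
  have hS := isOpen_reg e
  have hU := smooth_eU he.smooth_reg
  have hWe := (he.pd_ex (smooth_pd hS hU eu) hz fun _ _ _ _ φ ha hg hp _ => by
    rw [pd_congr φ.open_source (hg.eqOn_W he ha) hp]; exact (ha.det hp).Uxu).2
  have key : ∀ j, total 0 0 0 (pd eu (eU e)) z = -(pd ex (eU e) z + j * pd e2 (eU e) z) := by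
    intro j
    obtain ⟨Ω, Ω', θ, θ', φ, ha, hg, hp, hs, k⟩ := he.realize hz.1 hz.2 0 0 0 j
    rw [← (k (smooth_at (smooth_pd hS hU eu) hS hz) (hg.eqOn_W he ha).symm).2.2,
      ← (k (smooth_at hU hS hz) hg.eqOn_U.symm).2.1]
    exact (ha.det hp).Utu
  linarith [key 0, key 1]

/-- In X_x = U_u T_t only the left-hand side can contain A²_x, and only the right-hand side A¹⁰_t
and A¹¹_t; all three coefficients vanish. -/
theorem IsGenEquiv.pd_X_T (hz : z ∈ reg e) : pd e2 (eX e) z = 0 ∧ pd e10 (eT e) z = 0 ∧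
    pd e11 (eT e) z = 0 ∧ pd ex (eX e) z = pd eu (eU e) z * total 0 0 0 (eT e) z := by
  have hS := isOpen_reg e
  have hX := smooth_eX he.smooth_reg
  have hT := smooth_eT he.smooth_reg
  have key : ∀ j₁ j₂ j, pd ex (eX e) z + j * pd e2 (eX e) z
      = pd eu (eU e) z * total j₁ j₂ 0 (eT e) z := by
    intro j₁ j₂ j
    obtain ⟨Ω, Ω', θ, θ', φ, ha, hg, hp, hs, k⟩ := he.realize hz.1 hz.2 j₁ j₂ 0 j
    have hW := hg.eqOn_W he ha hp
    simp only [hs] at hW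
    rw [hW, ← (k (smooth_at hX hS hz) hg.eqOn_X.symm).2.1,
      ← (k (smooth_at hT hS hz) hg.eqOn_T.symm).2.2]
    exact (ha.det hp).Xx
  have hW := he.W_ne hz
  have k0 := key 0 0 0
  refine ⟨by linarith [key 0 0 1], mul_left_cancel₀ hW ?_, mul_left_cancel₀ hW ?_, by
    linarith⟩
  · have k1 := key 1 0 0
    unfold total at k0 k1
    linear_combination k0 - k1
  · have k1 := key 0 1 0
    unfold total at k0 k1
    linear_combination k0 - k1

omit he in
-- The x-derivatives of substituted components agree with partial derivatives only because the x-
-- and u-components do not depend on A².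
theorem Generates.frame_eq (he : IsGenEquiv e) (hg : Generates e θ φ θ')
    (ha : IsAdmissible Ω θ φ Ω' θ') {q : Pt} (hq : q ∈ φ.source) :
    (extFrame e).W (sec θ q) = (frame θ φ θ').W q ∧ (extFrame e).R (sec θ q) = (frame θ φ θ').R q ∧
    (extFrame e).P (sec θ q) = (frame θ φ θ').P q ∧ (extFrame e).v (sec θ q) = (frame θ φ θ').v q ∧
    (extFrame e).X (sec θ q) = (frame θ φ θ').X q ∧
    (extFrame e).z0 (sec θ q) = (frame θ φ θ').z0 q ∧
    (extFrame e).z1 (sec θ q) = (frame θ φ θ').z1 q ∧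
    (extFrame e).z2 (sec θ q) = (frame θ φ θ').z2 q := by
  have hS := isOpen_reg e
  have hr := hg.mem_reg ha hq
  have hW : pd eu (eU e) (sec θ q) = pd bu (cU φ) q := hg.eqOn_W he ha hq
  have hUx : pd ex (eU e) (sec θ q) = pd bx (cU φ) q := by
    rw [← pd_congr φ.open_source hg.eqOn_U hq, (ha.source.hasPd_sec (ha.source_mem q hq)
      (smooth_at (smooth_eU he.smooth_reg) hS hr)).2.1.eq, he.pd_e2_U hr]
    ring
  have hXx : pd ex (eX e) (sec θ q) = pd bx (cX φ) q := by
    rw [← pd_congr φ.open_source hg.eqOn_X hq, (ha.source.hasPd_sec (ha.source_mem q hq)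
      (smooth_at (smooth_eX he.smooth_reg) hS hr)).2.1.eq, (he.pd_X_T hr).1]
    ring
  have hUe : eU e (sec θ q) = cU φ q := hg.eqOn_U hq
  have hXe : eX e (sec θ q) = cX φ q := hg.eqOn_X hq
  have hval := hg.apply hq
  simp only [extFrame, frame, hW, hUx, hXx, hUe, hXe, hval, true_and]
  exact ⟨rfl, rfl, rfl, rfl, rfl⟩

omit he in
theorem Generates.inv_eq (he : IsGenEquiv e) (hg : Generates e θ φ θ')
    (ha : IsAdmissible Ω θ φ Ω' θ') (i : Fin 7) :
    Set.EqOn (fun q => (extFrame e).inv i (sec θ q)) ((frame θ φ θ').inv i) φ.source := by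
  intro q hq
  obtain ⟨h1, h2, h3, h4, h5, h6, h7, h8⟩ := hg.frame_eq he ha hq
  have k0 : (extFrame e).y0 (sec θ q) = (frame θ φ θ').y0 q := rfl
  have k1 : (extFrame e).y1 (sec θ q) = (frame θ φ θ').y1 q := rfl
  have k2 : (extFrame e).y2 (sec θ q) = (frame θ φ θ').y2 q := rfl
  fin_cases i <;> simp only [Frame.inv, h1, h2, h3, h4, h5, h6, h7, h8, k0, k1, k2]

theorem IsGenEquiv.smooth_frame_reg : (extFrame e).Smooth (reg e) :=
  smooth_extFrame (isOpen_reg e) he.smooth_reg fun _ hz => he.W_ne hz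

theorem IsGenEquiv.pd_inv (hz : z ∈ reg e) (i : Fin 7) (d : Ext) :
    pd d ((extFrame e).inv i) z = 0 := by
  have hS := isOpen_reg e
  have hG := he.smooth_frame_reg.inv i
  have hx := fun z (hz : z ∈ reg e) => he.pd_ex hG hz (c := 0) fun _ _ _ _ φ ha hg hp _ => by
    rw [pd_congr φ.open_source (hg.inv_eq he ha i) hp]; exact ha.pd_inv hp i _
  have ht := fun z (hz : z ∈ reg e) => he.total_eq hG hz (c := 0) fun _ _ _ _ φ ha hg hp _ => by
    rw [pd_congr φ.open_source (hg.inv_eq he ha i) hp]; exact ha.pd_inv hp i _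
  exact pd_eq_zero_of_total hS hG (fun z hz => (hx z hz).1)
    (fun z hz => he.pd_eu hG hz fun _ _ _ _ φ ha hg hp _ => by
      rw [pd_congr φ.open_source (hg.inv_eq he ha i) hp]; exact ha.pd_inv hp i _)
    (fun z hz => (ht z hz).1) (fun z hz => (ht z hz).2.1) (fun z hz => (ht z hz).2.2.1)
    (fun z hz => (ht z hz).2.2.2) hz d

/-- The formula for the new A¹¹ expresses the total derivative of P by quantities determined by z
alone, so it cannot contain the derivatives of A¹⁰, A¹¹, A². The next lemma treats X through the new
A¹⁰ in the same way. -/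
theorem IsGenEquiv.frame_P (hz : z ∈ reg e) :
    pd e10 (extFrame e).P z = 0 ∧ pd e11 (extFrame e).P z = 0 ∧
    pd e2 (extFrame e).P z = 0 ∧ v11 (e z) * ((extFrame e).P z ^ 2 * (extFrame e).W z)
      = v11 z * ((extFrame e).W z * (extFrame e).P z)
        - (extFrame e).W z * total 0 0 0 (extFrame e).P z
        - 2 * (extFrame e).R z * (extFrame e).P z := by
  have hW : (extFrame e).W z ≠ 0 := he.W_ne hz
  have h := he.total_eq he.smooth_frame_reg.P hz
    (c := (v11 z * ((extFrame e).W z * (extFrame e).P z)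
        - 2 * (extFrame e).R z * (extFrame e).P z
        - v11 (e z) * ((extFrame e).P z ^ 2 * (extFrame e).W z)) / (extFrame e).W z)
    fun Ω Ω' θ θ' φ ha hg hp hs => by
      rw [pd_congr φ.open_source (fun q hq => (hg.frame_eq he ha hq).2.2.1) hp]
      have hfl := ha.flow hp bt (by simp)
      have hfe := hg.frame_eq he ha hp
      have hval := hg.apply hp
      rw [hs] at hfe hval
      have hv : θ.A11 z.1.1 z.1.2.1 = v11 z := congrArg v11 hs
      rw [eq_div_iff hW, hfl.P.eq, hfe.1, hfe.2.1, hfe.2.2.1, hval, ← hv]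
      have := hfl.rel11
      change _ * 1 * _ = θ.A11 z.1.1 z.1.2.1 * _ - _
        - θ'.A11 (cT φ z.1) (cX φ z.1) * _
      linear_combination this
  refine ⟨h.1, h.2.1, h.2.2.1, ?_⟩
  rw [h.2.2.2]
  field_simp
  ring

theorem IsGenEquiv.frame_X (hz : z ∈ reg e) :
    pd eu (extFrame e).X z = 0 ∧ pd ex (extFrame e).X z = 0 ∧ pd e2 (extFrame e).X z = 0 ∧
    pd e10 (extFrame e).X z = 0 ∧ pd e11 (extFrame e).X z = 0 ∧
    v10 (e z) * (extFrame e).P z = (extFrame e).W z * v10 z * (extFrame e).P z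
      - total 0 0 0 (extFrame e).X z + (extFrame e).v z * (extFrame e).P z
      - v11 (e z) * (extFrame e).X z * (extFrame e).P z := by
  have hX := he.smooth_frame_reg.X
  have hxx := he.pd_ex hX hz (c := 0) fun _ _ _ _ φ ha hg hp _ => by
      rw [pd_congr φ.open_source (fun q hq => (hg.frame_eq he ha hq).2.2.2.2.1) hp,
        (ha.flow hp bx (by simp)).X.eq]; simp [bx]
  have h := he.total_eq hX hz
    (c := (extFrame e).W z * v10 z * (extFrame e).P z + (extFrame e).v z * (extFrame e).P z
      - v11 (e z) * (extFrame e).X z * (extFrame e).P z - v10 (e z) * (extFrame e).P z)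
    fun Ω Ω' θ θ' φ ha hg hp hs => by
      rw [pd_congr φ.open_source (fun q hq => (hg.frame_eq he ha hq).2.2.2.2.1) hp]
      have hfl := ha.flow hp bt (by simp)
      have hfe := hg.frame_eq he ha hp
      have hval := hg.apply hp
      rw [hs] at hfe hval
      have hv : θ.A10 z.1.1 z.1.2.1 = v10 z := congrArg v10 hs
      rw [hfe.1, hfe.2.2.1, hfe.2.2.2.1, hfe.2.2.2.2.1, hval, ← hv]
      have := hfl.rel10
      change _ = _ * θ.A10 z.1.1 z.1.2.1 * _ + _ - θ'.A11 (cT φ z.1) (cX φ z.1) * _ * _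
        - θ'.A10 (cT φ z.1) (cX φ z.1) * _
      linear_combination this
  refine ⟨he.pd_eu hX hz fun _ _ _ _ φ ha hg hp _ => by
      rw [pd_congr φ.open_source (fun q hq => (hg.frame_eq he ha hq).2.2.2.2.1) hp,
        (ha.flow hp bu (by simp)).X.eq]; simp [bu], hxx.1, hxx.2, h.1, h.2.1, ?_⟩
  rw [h.2.2.2]
  ring

/-- The total derivative P of T is free of A¹⁰ and A¹¹, hence T is free of Y⁰ and Y². The total
derivative of X enters the new A¹⁰, where A¹⁰ and A¹¹ are allowed; this is why X keeps all four
arguments. -/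
theorem IsGenEquiv.pd_Y_T (hz : z ∈ reg e) : pd f0 (eT e) z = 0 ∧ pd f2 (eT e) z = 0 ∧
    pd et (eT e) z + Real.exp (w0 z) * pd f1 (eT e) z = (extFrame e).P z :=
  pd_Y_eq_zero (isOpen_reg e) (smooth_eT he.smooth_reg) (fun _ hz => (he.pd_X_T hz).2.1)
    (fun _ hz => (he.pd_X_T hz).2.2.1)
    (fun z hz => by
      change _ = pd ex (eX e) z / pd eu (eU e) z
      rw [(he.pd_X_T hz).2.2.2, mul_div_cancel_left₀ _ (he.W_ne hz)])
    (fun _ hz => (he.frame_P hz).1) (fun _ hz => (he.frame_P hz).2.1) hz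

theorem IsGenEquiv.P_ne (hz : z ∈ reg e) : (extFrame e).P z ≠ 0 := by
  obtain ⟨Ω, Ω', θ, θ', φ, ha, hg, hp, hs, k⟩ := he.realize hz.1 hz.2 0 0 0 0
  have hfe := (hg.frame_eq he ha hp).2.2.1
  rw [hs] at hfe
  rw [hfe, ha.frame_P hp]
  exact (ha.det hp).Tt

theorem IsGenEquiv.v2_eq (hz : z ∈ reg e) :
    v2 (e z) = (extFrame e).P z * (extFrame e).W z ^ 2 * v2 z := by
  obtain ⟨Ω, Ω', θ, θ', φ, ha, hg, hp, hs, k⟩ := he.realize hz.1 hz.2 0 0 0 0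
  have hfe := hg.frame_eq he ha hp
  have hval := hg.apply hp
  rw [hs] at hfe hval
  have hv : θ.A2 z.1.1 z.1.2.1 = v2 z := congrArg v2 hs
  rw [hfe.1, hfe.2.2.1, hval, ← hv, ha.frame_P hp]
  refine (ha.det hp).B2.trans ?_
  change θ.A2 _ _ * (pd bu (cU φ) z.1) ^ 2 * _ = _ * (pd bu (cU φ) z.1) ^ 2 * θ.A2 _ _
  ring

end Generated

/-! ### Extension to the points with `A² = 0` -/

/-- Tuples avoid A² = 0, so identities are carried to such points by continuity, approaching along
the A²-axis. -/
theorem eq_of_eq_regular {U : Set Ext} (hU : IsOpen U) {F G : Ext → ℝ} (hF : ContinuousOn F U)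
    (hG : ContinuousOn G U) (h : ∀ z ∈ U, v2 z ≠ 0 → F z = G z) {z : Ext} (hz : z ∈ U) :
    F z = G z := by
  by_cases h2 : v2 z = 0
  swap
  · exact h z hz h2
  have hl : Filter.Tendsto (fun s : ℝ => z + s • e2) (𝓝[≠] 0) (𝓝 z) := by
    have : Continuous (fun s : ℝ => z + s • e2) := by fun_prop
    have h3 := this.tendsto 0
    simp only [zero_smul, add_zero] at h3
    exact h3.mono_left nhdsWithin_le_nhds
  have hF' := (hF.continuousAt (hU.mem_nhds hz)).tendsto.comp hl
  have hG' := (hG.continuousAt (hU.mem_nhds hz)).tendsto.comp hl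
  refine tendsto_nhds_unique_of_eventuallyEq hF' hG' ?_
  filter_upwards [hl.eventually (hU.mem_nhds hz), self_mem_nhdsWithin] with s hs hs0
  refine h _ hs ?_
  have : v2 (z + s • e2) = v2 z + s := by simp [v2, e2]
  rw [this, h2, zero_add]
  exact hs0

/-- A limit of nonzero values may vanish, so continuity is not enough; here F is constant along the
A²-axis and equals its value at a nearby regular point. -/
theorem ne_zero_of_regular {U : Set Ext} (hU : IsOpen U) {F : Ext → ℝ} (hF : ContDiffOn ℝ ∞ F U)
    (h2 : ∀ z ∈ U, v2 z ≠ 0 → pd e2 F z = 0) (h : ∀ z ∈ U, v2 z ≠ 0 → F z ≠ 0) {z : Ext}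
    (hz : z ∈ U) : F z ≠ 0 := by
  by_cases hv : v2 z = 0
  swap
  · exact h z hz hv
  have hd : ∀ z ∈ U, pd e2 F z = 0 := fun z hz =>
    eq_of_eq_regular hU (smooth_pd hU hF e2).continuousOn continuousOn_const h2 hz
  obtain ⟨r, hr, hb⟩ := Metric.isOpen_iff.1 hU z hz
  have hl : Filter.Tendsto (fun s : ℝ => z + s • e2) (𝓝[≠] 0) (𝓝 z) := by
    have : Continuous (fun s : ℝ => z + s • e2) := by fun_prop
    have h3 := this.tendsto 0
    simp only [zero_smul, add_zero] at h3
    exact h3.mono_left nhdsWithin_le_nhds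
  obtain ⟨s, hs, hs0⟩ :=
    ((hl.eventually (Metric.ball_mem_nhds z hr)).and self_mem_nhdsWithin).exists
  have he : F z = F (z + s • e2) := by
    refine eq_of_segment (convex_ball z r) Metric.isOpen_ball (hF.mono hb)
      (Metric.mem_ball_self hr) hs fun w hw => ?_
    rw [add_sub_cancel_left, pd_smul_vec, hd w (hb hw), mul_zero]
  rw [he]
  refine h _ (hb hs) ?_
  have : v2 (z + s • e2) = v2 z + s := by simp [v2, e2]
  rw [this, hv, zero_add]
  exact hs0

theorem smooth_total {S : Set Ext} (hS : IsOpen S) {F : Ext → ℝ} (hF : ContDiffOn ℝ ∞ F S)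
    (j₁ j₂ j₃ : ℝ) : ContDiffOn ℝ ∞ (total j₁ j₂ j₃ F) S := by
  have h := fun d => smooth_pd hS hF d
  have a := (smooth_v10.contDiffOn (s := S))
  have b := (smooth_v11.contDiffOn (s := S))
  have c := (smooth_w0.contDiffOn (s := S))
  have h1 := h et
  have h2 := h e10
  have h3 := h e11
  have h4 := h e2
  have h5 := h f0
  have h6 := h f1
  have h7 := h f2
  unfold total
  fun_prop

section Source

variable {e : OpenPartialHomeomorph Ext Ext} {z : Ext} (he : IsGenEquiv e)

theorem eq_of_eq_reg {F G : Ext → ℝ} (hF : ContDiffOn ℝ ∞ F e.source)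
    (hG : ContDiffOn ℝ ∞ G e.source) (h : ∀ z ∈ reg e, F z = G z) (hz : z ∈ e.source) :
    F z = G z :=
  eq_of_eq_regular e.open_source hF.continuousOn hG.continuousOn (fun z hz h2 => h z ⟨hz, h2⟩) hz

theorem pd_eq_zero_of_reg {F : Ext → ℝ} (hF : ContDiffOn ℝ ∞ F e.source) {d : Ext}
    (h : ∀ z ∈ reg e, pd d F z = 0) (hz : z ∈ e.source) : pd d F z = 0 :=
  eq_of_eq_reg (smooth_pd e.open_source hF d) (contDiffOn_const (c := 0)) h hz

include he

theorem IsGenEquiv.source_W_ne (hz : z ∈ e.source) : (extFrame e).W z ≠ 0 := by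
  have hU := smooth_eU he.1.1
  refine ne_zero_of_regular e.open_source (smooth_pd e.open_source hU eu) ?_
    (fun z hz h2 => he.W_ne ⟨hz, h2⟩) hz
  intro z hz h2
  rw [pd_comm e.open_source hU hz]
  exact pd_eq_zero (isOpen_reg e) (fun _ hy => he.pd_e2_U hy) ⟨hz, h2⟩ eu

theorem IsGenEquiv.smooth_frame : (extFrame e).Smooth e.source :=
  smooth_extFrame e.open_source he.1.1 fun _ hz => he.source_W_ne hz

theorem IsGenEquiv.source_P_ne (hz : z ∈ e.source) : (extFrame e).P z ≠ 0 :=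
  ne_zero_of_regular e.open_source he.smooth_frame.P
    (fun _ hz h2 => (he.frame_P ⟨hz, h2⟩).2.2.1) (fun _ hz h2 => he.P_ne ⟨hz, h2⟩) hz

theorem IsGenEquiv.source_inv (hz : z ∈ e.source) (i : Fin 7) (d : Ext) :
    pd d ((extFrame e).inv i) z = 0 :=
  pd_eq_zero_of_reg (he.smooth_frame.inv i) (fun _ hz => he.pd_inv hz i d) hz

theorem IsGenEquiv.source_T (hz : z ∈ e.source) {d : Ext} (ht : d.1.1 = 0)
    (h1 : d.2.2.2.2.2.1 = 0) : pd d (eT e) z = 0 := by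
  refine pd_eq_zero_of_reg (smooth_eT he.1.1) (fun z hz => ?_) hz
  rw [pd_ext, ht, h1, (he.pd_T hz).1, (he.pd_T hz).2.1, (he.pd_T hz).2.2, (he.pd_X_T hz).2.1,
    (he.pd_X_T hz).2.2.1, (he.pd_Y_T hz).1, (he.pd_Y_T hz).2.1]
  ring

theorem IsGenEquiv.source_X (hz : z ∈ e.source) {d : Ext} (ht : d.1.1 = 0)
    (h1 : d.2.2.2.2 = 0) : pd d (extFrame e).X z = 0 := by
  refine pd_eq_zero_of_reg he.smooth_frame.X (fun z hz => ?_) hz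
  obtain ⟨k1, k2, k3, k4, k5, -⟩ := he.frame_X hz
  rw [pd_ext, ht, h1, k1, k2, k3, k4, k5]
  simp

theorem IsGenEquiv.source_total_T (hz : z ∈ e.source) :
    total 0 0 0 (eT e) z = (extFrame e).P z := by
  refine eq_of_eq_reg (smooth_total e.open_source (smooth_eT he.1.1) _ _ _) he.smooth_frame.P
    (fun z hz => ?_) hz
  rw [← (he.pd_Y_T hz).2.2, total, (he.pd_Y_T hz).1, (he.pd_Y_T hz).2.1]
  ring

theorem IsGenEquiv.source_v11 (hz : z ∈ e.source) :
    v11 (e z) * ((extFrame e).P z ^ 2 * (extFrame e).W z)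
      = v11 z * ((extFrame e).W z * (extFrame e).P z)
        - (extFrame e).W z * total 0 0 0 (extFrame e).P z
        - 2 * (extFrame e).R z * (extFrame e).P z := by
  have h := he.smooth_frame
  have hP := h.P
  have hW := h.W
  have hR := h.R
  have ht := smooth_total e.open_source h.P 0 0 0
  have h1 := smooth_comp_ext (g := v11) smooth_v11 he.1.1
  have h2 := smooth_v11.contDiffOn (s := e.source)
  exact eq_of_eq_reg (F := fun z => v11 (e z) * ((extFrame e).P z ^ 2 * (extFrame e).W z))
    (G := fun z => v11 z * ((extFrame e).W z * (extFrame e).P z)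
        - (extFrame e).W z * total 0 0 0 (extFrame e).P z
        - 2 * (extFrame e).R z * (extFrame e).P z)
    (by fun_prop) (by fun_prop) (fun _ hz => (he.frame_P hz).2.2.2) hz

theorem IsGenEquiv.source_v10 (hz : z ∈ e.source) :
    v10 (e z) * (extFrame e).P z = (extFrame e).W z * v10 z * (extFrame e).P z
      - total 0 0 0 (extFrame e).X z + (extFrame e).v z * (extFrame e).P z
      - v11 (e z) * (extFrame e).X z * (extFrame e).P z := by
  have h := he.smooth_frame
  have hP := h.P
  have hW := h.W
  have hv := h.v
  have hX := h.X
  have ht := smooth_total e.open_source h.X 0 0 0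
  have h1 := smooth_comp_ext (g := v11) smooth_v11 he.1.1
  have h2 := smooth_comp_ext (g := v10) smooth_v10 he.1.1
  have h3 := smooth_v10.contDiffOn (s := e.source)
  exact eq_of_eq_reg (F := fun z => v10 (e z) * (extFrame e).P z)
    (G := fun z => (extFrame e).W z * v10 z * (extFrame e).P z
      - total 0 0 0 (extFrame e).X z + (extFrame e).v z * (extFrame e).P z
      - v11 (e z) * (extFrame e).X z * (extFrame e).P z)
    (by fun_prop) (by fun_prop) (fun _ hz => (he.frame_X hz).2.2.2.2.2) hz

theorem IsGenEquiv.source_v2 (hz : z ∈ e.source) :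
    v2 (e z) = (extFrame e).P z * (extFrame e).W z ^ 2 * v2 z := by
  have h := he.smooth_frame
  have hP := h.P
  have hW := h.W
  have h3 := smooth_v2.contDiffOn (s := e.source)
  exact eq_of_eq_reg (F := fun z => v2 (e z))
    (G := fun z => (extFrame e).P z * (extFrame e).W z ^ 2 * v2 z)
    (smooth_comp_ext (g := v2) smooth_v2 he.1.1) (by fun_prop) (fun _ hz => he.v2_eq hz) hz

end Source

/-! ### Functions of a part of the variables -/

/-- Two points of U with the same projection are joined by a segment in U along which F is constant,
so f is well defined. It is smooth because locally it is F composed with an affine section z + σ(w -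
πz). -/
theorem exists_factor {E E' : Type*} [NormedAddCommGroup E] [NormedSpace ℝ E]
    [NormedAddCommGroup E'] [NormedSpace ℝ E'] {U : Set E} (hU : IsOpen U) (hc : Convex ℝ U)
    {F : E → ℝ} (hF : ContDiffOn ℝ ∞ F U) (π : E →L[ℝ] E') (σ : E' →L[ℝ] E)
    (hσ : ∀ w, π (σ w) = w) (h : ∀ z ∈ U, ∀ d, π d = 0 → pd d F z = 0) :
    ∃ f : E' → ℝ, (∀ z ∈ U, f (π z) = F z) ∧ ContDiffOn ℝ ∞ f (π '' U) := by
  classical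
  let f : E' → ℝ := fun w => if h : ∃ z ∈ U, π z = w then F h.choose else 0
  have hf : ∀ z ∈ U, f (π z) = F z := by
    intro z hz
    have hex : ∃ z' ∈ U, π z' = π z := ⟨z, hz, rfl⟩
    simp only [f, dif_pos hex]
    refine eq_of_segment hc hU hF hex.choose_spec.1 hz fun w hw => h w hw _ ?_
    rw [map_sub, hex.choose_spec.2, sub_self]
  refine ⟨f, hf, ?_⟩
  rintro _ ⟨z, hz, rfl⟩
  have hl : ContDiff ℝ ∞ (fun w => z + σ (w - π z)) := by fun_prop
  have hz0 : z + σ (π z - π z) = z := by simp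
  have h1 : ContDiffAt ℝ ∞ (fun w => F (z + σ (w - π z))) (π z) :=
    ContDiffAt.comp (g := F) (f := fun w => z + σ (w - π z)) (π z)
      (by rw [hz0]; exact hF.contDiffAt (hU.mem_nhds hz)) hl.contDiffAt
  refine (h1.congr_of_eventuallyEq ?_).contDiffWithinAt
  have h2 : ∀ᶠ w in 𝓝 (π z), z + σ (w - π z) ∈ U :=
    hl.continuous.continuousAt.preimage_mem_nhds (by rw [hz0]; exact hU.mem_nhds hz)
  filter_upwards [h2] with w hw
  rw [← hf _ hw, map_add, hσ]
  congr 1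
  abel

theorem Dbar_lift (a b : ℝ) (T : ℝ → ℝ → ℝ) (t y0 y1 y2 : ℝ) :
    Dbar a b (lift T) t y0 y1 y2
      = deriv (fun s => T s y1) t + Real.exp y0 * deriv (fun s => T t s) y1 := by
  simp [Dbar, lift]

/-- Φ is controlled only where it represents G; since U is open, each coordinate line stays in U for
a short time, which is enough for the one-variable derivatives. -/
theorem total_eq_Dbar {U : Set Ext} (hU : IsOpen U) {G : Ext → ℝ} (hG : ContDiffOn ℝ ∞ G U)
    {Φ : ℝ → ℝ → ℝ → ℝ → ℝ} (h : ∀ z ∈ U, G z = Φ z.1.1 (w0 z) (w1 z) (w2 z)) {z : Ext}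
    (hz : z ∈ U) :
    Dbar (v10 z) (v11 z) Φ z.1.1 (w0 z) (w1 z) (w2 z) = total 0 0 0 G z := by
  have key : ∀ (d : Ext) (g : ℝ → ℝ) (s₀ : ℝ),
      (∀ s, Φ (z + (s - s₀) • d).1.1 (w0 (z + (s - s₀) • d)) (w1 (z + (s - s₀) • d))
        (w2 (z + (s - s₀) • d)) = g s) → deriv g s₀ = pd d G z := by
    intro d g s₀ hg
    have h1 : HasDerivAt (fun s : ℝ => z + (s - s₀) • d) d s₀ := by
      simpa using (((hasDerivAt_id s₀).sub_const s₀).smul_const d).const_add z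
    have hz0 : z + (s₀ - s₀) • d = z := by simp
    have h2 : HasDerivAt (fun s : ℝ => G (z + (s - s₀) • d)) (pd d G z) s₀ := by
      have h3 : HasFDerivAt G (fderiv ℝ G z) (z + (s₀ - s₀) • d) := by
        rw [hz0]; exact (smooth_at hG hU hz).hasFDerivAt
      exact h3.comp_hasDerivAt s₀ h1
    refine (h2.congr_of_eventuallyEq ?_).deriv
    have h4 : ∀ᶠ s in 𝓝 s₀, z + (s - s₀) • d ∈ U :=
      h1.continuousAt.preimage_mem_nhds (by rw [hz0]; exact hU.mem_nhds hz)
    filter_upwards [h4] with s hs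
    rw [h _ hs, hg]
  have kt := key et (fun s => Φ s (w0 z) (w1 z) (w2 z)) z.1.1 (by
    intro s; simp [et, bt, w0, w1, w2])
  have k0 := key f0 (fun s => Φ z.1.1 s (w1 z) (w2 z)) (w0 z) (by
    intro s; simp [f0, w0, w1, w2])
  have k1 := key f1 (fun s => Φ z.1.1 (w0 z) s (w2 z)) (w1 z) (by
    intro s; simp [f1, w0, w1, w2])
  have k2 := key f2 (fun s => Φ z.1.1 (w0 z) (w1 z) s) (w2 z) (by
    intro s; simp [f2, w0, w1, w2])
  rw [Dbar, kt, k0, k1, k2, total]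
  ring

/-! ### Generalized equivalence transformations with convex domains -/

/-- The projection to the variables `t` and `Y¹`. -/
noncomputable def projT : Ext →L[ℝ] ℝ × ℝ :=
  (ContinuousLinearMap.fst ℝ ℝ (ℝ × ℝ) ∘L ContinuousLinearMap.fst ℝ Pt Val).prod
    (ContinuousLinearMap.fst ℝ ℝ ℝ ∘L ContinuousLinearMap.snd ℝ ℝ (ℝ × ℝ) ∘L
      ContinuousLinearMap.snd ℝ ℝ (ℝ × ℝ × ℝ) ∘L ContinuousLinearMap.snd ℝ ℝ (ℝ × ℝ × ℝ × ℝ) ∘L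
      ContinuousLinearMap.snd ℝ ℝ (ℝ × ℝ × ℝ × ℝ × ℝ) ∘L ContinuousLinearMap.snd ℝ Pt Val)

/-- The projection to the variables `t`, `Y⁰`, `Y¹`, `Y²`. -/
noncomputable def projX : Ext →L[ℝ] ℝ × ℝ × ℝ × ℝ :=
  (ContinuousLinearMap.fst ℝ ℝ (ℝ × ℝ) ∘L ContinuousLinearMap.fst ℝ Pt Val).prod
    (ContinuousLinearMap.snd ℝ ℝ (ℝ × ℝ × ℝ) ∘L ContinuousLinearMap.snd ℝ ℝ (ℝ × ℝ × ℝ × ℝ) ∘L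
      ContinuousLinearMap.snd ℝ ℝ (ℝ × ℝ × ℝ × ℝ × ℝ) ∘L ContinuousLinearMap.snd ℝ Pt Val)

theorem IsGenEquiv.hasForm {e : OpenPartialHomeomorph Ext Ext} (he : IsGenEquiv e)
    (hc : Convex ℝ e.source) : HasForm e := by
  have hS := e.open_source
  obtain ⟨fT, hfT, sfT⟩ := exists_factor hS hc (smooth_eT he.1.1) projT
    ((ContinuousLinearMap.fst ℝ ℝ ℝ).smulRight et + (ContinuousLinearMap.snd ℝ ℝ ℝ).smulRight f1)
    (fun w => by simp [projT, et, f1, bt])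
    (fun z hz d hd => he.source_T hz (congrArg Prod.fst hd) (congrArg Prod.snd hd))
  obtain ⟨fX, hfX, sfX⟩ := exists_factor hS hc he.smooth_frame.X projX
    ((ContinuousLinearMap.fst ℝ ℝ (ℝ × ℝ × ℝ)).smulRight et
      + (ContinuousLinearMap.inr ℝ Pt Val ∘L ContinuousLinearMap.inr ℝ ℝ _ ∘L
        ContinuousLinearMap.inr ℝ ℝ _ ∘L ContinuousLinearMap.inr ℝ ℝ (ℝ × ℝ × ℝ)) ∘L
        ContinuousLinearMap.snd ℝ ℝ (ℝ × ℝ × ℝ))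
    (fun w => by simp [projX, et, bt])
    (fun z hz d hd => he.source_X hz (congrArg Prod.fst hd) (congrArg Prod.snd hd))
  obtain ⟨c, hcc⟩ : ∃ c : Fin 7 → ℝ, ∀ z ∈ e.source, ∀ i, (extFrame e).inv i z = c i := by
    by_cases hne : e.source.Nonempty
    · obtain ⟨z₀, hz₀⟩ := hne
      exact ⟨fun i => (extFrame e).inv i z₀, fun z hz i =>
        eq_of_pd_zero hc hS (he.smooth_frame.inv i) (fun w hw d => he.source_inv hw i d) hz hz₀⟩
    · exact ⟨0, fun z hz => absurd ⟨z, hz⟩ hne⟩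
  by_cases hne : e.source.Nonempty
  swap
  · refine ⟨0, 0, 0, 0, 0, 0, 0, 0, 0, by simp, contDiffOn_const, contDiffOn_const, ?_⟩
    intro t x u a10 a11 a2 y0 y1 y2 hz
    exact absurd ⟨_, hz⟩ hne
  -- A relation between constants, read off at any one point; hence the separate treatment of an
  -- empty domain.
  have hδ : c 3 = c 4 * c 1 - c 5 * c 0 := by
    obtain ⟨z, hz⟩ := hne
    exact (Frame.formulas (he.source_W_ne hz) (he.source_P_ne hz) (hcc z hz)).1
  -- The invariants are numbered c₁, c₀, c₂, δ, c₁', c₀', c₃, hence the permuted indices.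
  refine ⟨fun t y1 => fT (t, y1), fun t y0 y1 y2 => fX (t, y0, y1, y2), c 1, c 0, c 2, c 6, c 5,
    c 4, c 3, hδ, ?_, ?_, ?_⟩
  · refine sfT.mono ?_
    rintro ⟨t, y1⟩ ⟨x, u, a10, a11, a2, y0, y2, hz⟩
    exact ⟨_, hz, rfl⟩
  · refine sfX.mono ?_
    rintro ⟨t, y0, y1, y2⟩ ⟨x, u, a10, a11, a2, hz⟩
    exact ⟨_, hz, rfl⟩
  intro t x u a10 a11 a2 y0 y1 y2 hz X0 DX0 DT DDT U B
  set z : Ext := ((t, x, u), (a10, a11, a2, y0, y1, y2)) with hzdef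
  have hW := he.source_W_ne hz
  have hP := he.source_P_ne hz
  obtain ⟨-, hpos, eW, eR, ev, ez0, ez1, ez2⟩ := Frame.formulas hW hP (hcc z hz)
  have hX0 : X0 = (extFrame e).X z := hfX z hz
  have hDX0 : DX0 = total 0 0 0 (extFrame e).X z :=
    total_eq_Dbar hS he.smooth_frame.X (Φ := fun t y0 y1 y2 => fX (t, y0, y1, y2))
      (fun z hz => (hfX z hz).symm) hz
  -- The values a, b stay free: in `DDT` the inner derivative keeps the A¹⁰, A¹¹ of one point while
  -- the outer one moves the point.
  have hDT' : ∀ z ∈ e.source, ∀ a b, (extFrame e).P z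
      = Dbar a b (lift fun t y1 => fT (t, y1)) z.1.1 (w0 z) (w1 z) (w2 z) := by
    intro z hz a b
    rw [← he.source_total_T hz, ← total_eq_Dbar hS (smooth_eT he.1.1)
      (Φ := lift fun t y1 => fT (t, y1)) (fun z hz => (hfT z hz).symm) hz, Dbar_lift, Dbar_lift]
  have hDT : DT = (extFrame e).P z := (hDT' z hz _ _).symm
  have hDDT : DDT = total 0 0 0 (extFrame e).P z :=
    total_eq_Dbar hS he.smooth_frame.P
      (Φ := Dbar a10 a11 (lift fun t y1 => fT (t, y1))) (fun z hz => hDT' z hz _ _) hz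
  have hU : U = (extFrame e).W z := eW.symm
  have eR' : (extFrame e).R z = c 0 * Real.exp y0 := eR
  have ev' : (extFrame e).v z = c 2 - c 0 * y2 := ev
  have h11 : v11 (e z) = 1 / DT * B := by
    have h := he.source_v11 hz
    simp only [B]
    rw [hDT, hDDT, hU]
    have ha : v11 z = a11 := rfl
    rw [ha, eR'] at h
    field_simp
    linear_combination h
  have h10 : v10 (e z) = U * a10 - DX0 / DT + c 2 - c 0 * y2 - X0 / DT * B := by
    have h := he.source_v10 hz
    have ha : v10 z = a10 := rfl
    rw [ha, h11, ev'] at h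
    rw [← hDT] at hP h
    rw [← hU, ← hDX0, ← hX0] at h
    field_simp at h ⊢
    linear_combination h
  refine ⟨by rw [hU]; exact hW, by rw [hDT]; exact hpos, ?_⟩
  have hx : pd ex (eX e) z = DT * U := by
    rw [hDT, hU]
    change _ = pd ex (eX e) z / pd eu (eU e) z * pd eu (eU e) z
    rw [div_mul_cancel₀]
    exact hW
  refine Prod.ext (Prod.ext ?_ (Prod.ext ?_ ?_)) (Prod.ext h10 (Prod.ext h11 (Prod.ext ?_
    (Prod.ext ?_ (Prod.ext ?_ ?_)))))
  · exact (hfT z hz).symm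
  · change eX e z = DT * U * x + X0
    rw [hX0, ← hx]
    change _ = _ + (eX e z - pd ex (eX e) z * x)
    ring
  · change eU e z = U * u - c 0 * Real.exp y0 * x + c 2 - c 0 * y2
    have hv : (extFrame e).v z = eU e z - (extFrame e).W z * u + (extFrame e).R z * x := by
      change eU e z - pd eu (eU e) z * u - pd ex (eU e) z * x
        = eU e z - pd eu (eU e) z * u + -pd ex (eU e) z * x
      ring
    rw [hU]
    rw [eR'] at hv
    linear_combination ev' - hv
  · change v2 (e z) = DT * U ^ 2 * a2
    rw [he.source_v2 hz, hDT, hU]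
    rfl
  · change (extFrame e).z0 z = y0 + Real.log (c 3 / (DT * U ^ 2))
    rw [ez0, hDT, hU]
    rfl
  · change (extFrame e).z1 z = (c 4 * y1 + c 5) / U
    rw [ez1, hU]
    rfl
  · change (extFrame e).z2 z = c 3 * y2 / U - c 3 * X0 * Real.exp y0 / (DT * U ^ 2)
      + c 2 * ((c 4 * y1 + c 5) / U) + c 6
    rw [ez2, hDT, hU, hX0]
    rfl

/-! ### Tuples of arbitrary elements from maps to the extended space -/

/-- The derivatives of the map `F` at `q` are those of a map of the form
`q ↦ (φ q, θ.val (φ q))`, where `φ` is a point transformation with `φᵗ = φᵗ(t)`,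
`φˣ = φˣ(t, x)`, and `θ` is a tuple of arbitrary elements. -/
structure Graphlike (F : Pt → Ext) (q : Pt) : Prop where
  Tx : pd bx (cT fun q => (F q).1) q = 0
  Tu : pd bu (cT fun q => (F q).1) q = 0
  Tt : pd bt (cT fun q => (F q).1) q ≠ 0
  Xu : pd bu (cX fun q => (F q).1) q = 0
  Xx : pd bx (cX fun q => (F q).1) q ≠ 0
  Uu : pd bu (cU fun q => (F q).1) q ≠ 0
  time : ∀ g : Ext → ℝ, g = v10 ∨ g = v11 ∨ g = w0 ∨ g = w1 ∨ g = w2 →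
    pd bx (fun q => g (F q)) q = 0 ∧ pd bu (fun q => g (F q)) q = 0
  A2u : pd bu (fun q => v2 (F q)) q = 0
  A2_ne : v2 (F q) ≠ 0
  Y0 : pd bt (fun q => w0 (F q)) q = v11 (F q) * pd bt (cT fun q => (F q).1) q
  Y1 : pd bt (fun q => w1 (F q)) q = Real.exp (w0 (F q)) * pd bt (cT fun q => (F q).1) q
  Y2 : pd bt (fun q => w2 (F q)) q
    = v10 (F q) * Real.exp (w0 (F q)) * pd bt (cT fun q => (F q).1) q

/-- The embedding of the `(t, x)`-plane at the level `u`. -/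
def level (u : ℝ) (z : ℝ × ℝ) : Pt := (z.1, z.2, u)

theorem smooth_level (u : ℝ) : ContDiff ℝ ∞ (level u) := by unfold level; fun_prop

theorem HasPd.level {u : ℝ} {z : ℝ × ℝ} {G : Pt → ℝ} (hG : DifferentiableAt ℝ G (level u z))
    (a b : ℝ) : HasPd (a, b) (fun z => G (BurgersL0.level u z))
      (a * pd bt G (BurgersL0.level u z) + b * pd bx G (BurgersL0.level u z)) z := by
  have h : HasFDerivAt (BurgersL0.level u) ((ContinuousLinearMap.fst ℝ ℝ ℝ).prod
      ((ContinuousLinearMap.snd ℝ ℝ ℝ).prod 0)) z :=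
    hasFDerivAt_fst.prodMk (hasFDerivAt_snd.prodMk (hasFDerivAt_const u z))
  refine (HasPd.comp hG h (a, b)).val ?_
  rw [show ((ContinuousLinearMap.fst ℝ ℝ ℝ).prod ((ContinuousLinearMap.snd ℝ ℝ ℝ).prod
    (0 : ℝ × ℝ →L[ℝ] ℝ))) (a, b) = (a, b, 0) from rfl, pd_pt]
  ring

theorem level_mem_ball {p q : Pt} {ε : ℝ} (hq : q ∈ Metric.ball p ε) :
    level p.2.2 (tx q) ∈ Metric.ball p ε := by
  rw [Metric.mem_ball, Prod.dist_eq, Prod.dist_eq] at hq ⊢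
  have h1 := (max_lt_iff.1 hq).1
  have h2 := (max_lt_iff.1 (max_lt_iff.1 hq).2).1
  refine max_lt h1 (max_lt h2 ?_)
  simpa [level] using dist_nonneg.trans_lt h1

theorem eq_level {p q : Pt} {ε : ℝ} {G : Pt → ℝ} (hG : ContDiffOn ℝ ∞ G (Metric.ball p ε))
    (h : ∀ q ∈ Metric.ball p ε, pd bu G q = 0) (hq : q ∈ Metric.ball p ε) :
    G (level p.2.2 (tx q)) = G q := by
  refine eq_of_segment (convex_ball p ε) Metric.isOpen_ball hG (level_mem_ball hq) hq
    fun w hw => ?_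
  rw [show q - level p.2.2 (tx q) = (q.2.2 - p.2.2) • bu by
    ext <;> simp [level, tx, bu], pd_smul_vec,
    h w hw, mul_zero]

theorem fderiv_injective_of_triangular {Φ : Pt → Pt} {p : Pt} (hd : DifferentiableAt ℝ Φ p)
    (hTx : pd bx (cT Φ) p = 0) (hTu : pd bu (cT Φ) p = 0) (hTt : pd bt (cT Φ) p ≠ 0)
    (hXu : pd bu (cX Φ) p = 0) (hXx : pd bx (cX Φ) p ≠ 0) (hUu : pd bu (cU Φ) p ≠ 0) :
    Function.Injective (fderiv ℝ Φ p) := by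
  rw [injective_iff_map_eq_zero]
  rintro ⟨a, b, c⟩ hv
  have h1 : pd (a, b, c) (cT Φ) p = 0 :=
    ((hasPd_components hd (a, b, c)).1).trans (by rw [hv]; rfl)
  have h2 : pd (a, b, c) (cX Φ) p = 0 :=
    ((hasPd_components hd (a, b, c)).2.1).trans (by rw [hv]; rfl)
  have h3 : pd (a, b, c) (cU Φ) p = 0 :=
    ((hasPd_components hd (a, b, c)).2.2).trans (by rw [hv]; rfl)
  rw [pd_pt] at h1 h2 h3
  rw [hTx, hTu, mul_zero, mul_zero, add_zero, add_zero] at h1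
  obtain rfl := (mul_eq_zero.1 h1).resolve_right hTt
  rw [hXu, zero_mul, mul_zero, add_zero, zero_add] at h2
  obtain rfl := (mul_eq_zero.1 h2).resolve_right hXx
  rw [zero_mul, zero_mul, zero_add, zero_add] at h3
  obtain rfl := (mul_eq_zero.1 h3).resolve_right hUu
  rfl

/-- The t- and x-components do not depend on u and give a local diffeomorphism k of the plane. The
tuple consists of the remaining components of F composed with k⁻¹ at a fixed level of u; in a ball
the level is irrelevant because these components do not depend on u. -/
theorem Graphlike.exists_tuple {N : Set Pt} (hN : IsOpen N) {F : Pt → Ext}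
    (hF : ContDiffOn ℝ ∞ F N) (h : ∀ q ∈ N, Graphlike F q) {p : Pt} (hp : p ∈ N) :
    ∃ (φ : OpenPartialHomeomorph Pt Pt) (Ω : Set (ℝ × ℝ)) (θ : ArbTuple),
      p ∈ φ.source ∧ φ.source ⊆ N ∧ IsPointTransformation φ ∧ IsArbTuple Ω θ ∧
      (∀ q, φ q = (F q).1) ∧ ∀ q ∈ φ.source, tx (φ q) ∈ Ω ∧ θ.val (φ q) = (F q).2 := by
  obtain ⟨ε, hε, hB⟩ := Metric.isOpen_iff.1 hN p hp
  have hBo : IsOpen (Metric.ball p ε) := Metric.isOpen_ball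
  have hpB : p ∈ Metric.ball p ε := Metric.mem_ball_self hε
  have hFB := hF.mono hB
  set Φ : Pt → Pt := fun q => (F q).1 with hΦ
  have hΦB : ContDiffOn ℝ ∞ Φ (Metric.ball p ε) := hFB.fst
  have hT := smooth_cT hΦB
  have hX := smooth_cX hΦB
  set j := level p.2.2 with hj
  have hjo : IsOpen (j ⁻¹' Metric.ball p ε) := hBo.preimage (smooth_level _).continuous
  have hcomp : ∀ {G : Pt → ℝ}, ContDiffOn ℝ ∞ G (Metric.ball p ε) →
      ContDiffOn ℝ ∞ (fun z => G (j z)) (j ⁻¹' Metric.ball p ε) := fun hG =>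
    hG.comp (smooth_level _).contDiffOn fun z hz => hz
  have hH : ContDiffOn ℝ ∞ (fun z => (cT Φ (j z), cX Φ (j z))) (j ⁻¹' Metric.ball p ε) :=
    (hcomp hT).prodMk (hcomp hX)
  have hder : ∀ {G : Pt → ℝ}, ContDiffOn ℝ ∞ G (Metric.ball p ε) → ∀ {z}, j z ∈ Metric.ball p ε →
      ∀ a b, HasPd (a, b) (fun z => G (j z)) (a * pd bt G (j z) + b * pd bx G (j z)) z :=
    fun hG _ hz a b => HasPd.level (smooth_at hG hBo hz) a b
  have hinj : Function.Injective (fderiv ℝ (fun z => (cT Φ (j z), cX Φ (j z))) (tx p)) := by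
    rw [injective_iff_map_eq_zero]
    rintro ⟨a, b⟩ hv
    have hT' := hder hT (z := tx p) hpB a b
    have hX' := hder hX (z := tx p) hpB a b
    rw [(hT'.hasFDerivAt.prodMk hX'.hasFDerivAt).fderiv] at hv
    have h1 := hT'.eq.symm.trans (congrArg Prod.fst hv)
    have h2 := hX'.eq.symm.trans (congrArg Prod.snd hv)
    change a * pd bt (cT Φ) p + b * pd bx (cT Φ) p = 0 at h1
    change a * pd bt (cX Φ) p + b * pd bx (cX Φ) p = 0 at h2
    rw [(h p hp).Tx, mul_zero, add_zero] at h1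
    obtain rfl := (mul_eq_zero.1 h1).resolve_right (h p hp).Tt
    rw [zero_mul, zero_add] at h2
    obtain rfl := (mul_eq_zero.1 h2).resolve_right (h p hp).Xx
    rfl
  obtain ⟨k, hpk, hkB, hk, hkp⟩ := exists_local_pointTransformation hjo hH (z := tx p) hpB hinj
  -- The domain of φ lies over that of k, so that k⁻¹ recovers the projection of q from that of its
  -- image.
  obtain ⟨φ, hpφ, hφS, hφ, hφp⟩ := exists_local_pointTransformation
    (S := Metric.ball p ε ∩ tx ⁻¹' k.source) (hBo.inter (k.open_source.preimage continuous_tx))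
    (Φ := Φ) (hΦB.mono fun q hq => hq.1) (z := p) ⟨hpB, hpk⟩
    (fderiv_injective_of_triangular (smooth_at hΦB hBo hpB) (h p hp).Tx (h p hp).Tu (h p hp).Tt
      (h p hp).Xu (h p hp).Xx (h p hp).Uu)
  have hmem : ∀ {w}, w ∈ k.target → j (k.symm w) ∈ Metric.ball p ε := fun hw =>
    hkB (k.map_target hw)
  have hright : ∀ {w}, w ∈ k.target → (cT Φ (j (k.symm w)), cX Φ (j (k.symm w))) = w := by
    intro w hw
    rw [← hk (k.symm w), k.right_inv hw]
  have hsm : ∀ {g : Ext → ℝ}, ContDiff ℝ ∞ g →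
      ContDiffOn ℝ ∞ (fun q => g (F q)) (Metric.ball p ε) := fun hg => hg.comp_contDiffOn hFB
  have hsmooth : ∀ {g : Ext → ℝ}, ContDiff ℝ ∞ g →
      SmoothOn (fun t x => g (F (j (k.symm (t, x))))) k.target := fun hg =>
    (hcomp (hsm hg)).comp hkp.2 fun w hw => hmem hw
  have hchain : ∀ {g : Ext → ℝ}, ContDiff ℝ ∞ g → ∀ t x, (t, x) ∈ k.target → ∀ a b,
      (a * pd bt (cT Φ) (j (k.symm (t, x))) + b * pd bx (cT Φ) (j (k.symm (t, x))))
          * dt (fun t x => g (F (j (k.symm (t, x))))) t x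
        + (a * pd bt (cX Φ) (j (k.symm (t, x))) + b * pd bx (cX Φ) (j (k.symm (t, x))))
          * dx (fun t x => g (F (j (k.symm (t, x))))) t x
        = a * pd bt (fun q => g (F q)) (j (k.symm (t, x)))
          + b * pd bx (fun q => g (F q)) (j (k.symm (t, x))) := by
    intro g hg t x hw a b
    have hz := hmem hw
    have h1 := HasPd.along (T := fun z => cT Φ (j z)) (X := fun z => cX Φ (j z)) k.open_target
      (hsmooth hg) (z := k.symm (t, x)) (by rw [hright hw]; exact hw) (hder hT hz a b)
      (hder hX hz a b)
    have e1 : cT Φ (j (k.symm (t, x))) = t := congrArg Prod.fst (hright hw)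
    have e2 : cX Φ (j (k.symm (t, x))) = x := congrArg Prod.snd (hright hw)
    rw [e1, e2] at h1
    rw [← h1.eq, ← (hder (hsm hg) hz a b).eq]
    refine pd_congr k.open_source (fun z hz => ?_) (k.map_target hw) _
    rw [← hk z, k.left_inv hz]
  have hx0 : ∀ {g : Ext → ℝ}, ContDiff ℝ ∞ g →
      (g = v10 ∨ g = v11 ∨ g = w0 ∨ g = w1 ∨ g = w2) → ∀ t x, (t, x) ∈ k.target →
      dx (fun t x => g (F (j (k.symm (t, x))))) t x = 0 := by
    intro g hg hg' t x hw
    have h1 := hchain hg t x hw 0 1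
    have hG := h _ (hB (hmem hw))
    rw [hG.Tx, (hG.time g hg').1] at h1
    refine (mul_eq_zero.1 (?_ : pd bx (cX Φ) (j (k.symm (t, x))) * _ = 0)).resolve_left hG.Xx
    linear_combination h1
  have ht0 : ∀ {g : Ext → ℝ}, ContDiff ℝ ∞ g →
      (g = v10 ∨ g = v11 ∨ g = w0 ∨ g = w1 ∨ g = w2) → ∀ t x, (t, x) ∈ k.target → ∀ {c : ℝ},
      pd bt (fun q => g (F q)) (j (k.symm (t, x))) = c * pd bt (cT Φ) (j (k.symm (t, x))) →
      dt (fun t x => g (F (j (k.symm (t, x))))) t x = c := by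
    intro g hg hg' t x hw c hc
    have h1 := hchain hg t x hw 1 0
    have hG := h _ (hB (hmem hw))
    rw [hx0 hg hg' t x hw, hc] at h1
    refine mul_left_cancel₀ hG.Tt ?_
    linear_combination h1
  refine ⟨φ, k.target, ⟨fun t x => v10 (F (j (k.symm (t, x)))),
    fun t x => v11 (F (j (k.symm (t, x)))), fun t x => v2 (F (j (k.symm (t, x)))), fun t x => w0 (F (j (k.symm (t, x)))),
    fun t x => w1 (F (j (k.symm (t, x)))), fun t x => w2 (F (j (k.symm (t, x))))⟩, hpφ,
    fun q hq => hB (hφS hq).1, hφp, ?_, hφ, fun q hq => ?_⟩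
  · exact {
      isOpen := k.open_target
      smooth_A10 := hsmooth smooth_v10
      smooth_A11 := hsmooth smooth_v11
      smooth_A2 := hsmooth smooth_v2
      smooth_Y0 := hsmooth smooth_w0
      smooth_Y1 := hsmooth smooth_w1
      smooth_Y2 := hsmooth smooth_w2
      A10_x := hx0 smooth_v10 (by simp)
      A11_x := hx0 smooth_v11 (by simp)
      Y0_x := hx0 smooth_w0 (by simp)
      Y1_x := hx0 smooth_w1 (by simp)
      Y2_x := hx0 smooth_w2 (by simp)
      A2_ne := fun t x hw => (h _ (hB (hmem hw))).A2_ne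
      Y0_t := fun t x hw => ht0 smooth_w0 (by simp) t x hw (h _ (hB (hmem hw))).Y0
      Y1_t := fun t x hw => ht0 smooth_w1 (by simp) t x hw (h _ (hB (hmem hw))).Y1
      Y2_t := fun t x hw => ht0 smooth_w2 (by simp) t x hw (h _ (hB (hmem hw))).Y2 }
  · obtain ⟨hqB, hqk⟩ := hφS hq
    have hlev : ∀ {G : Pt → ℝ}, ContDiffOn ℝ ∞ G (Metric.ball p ε) →
        (∀ q ∈ Metric.ball p ε, pd bu G q = 0) → G (j (tx q)) = G q := fun hG h0 =>
      eq_level hG h0 hqB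
    have htx : tx (φ q) = k (tx q) := by
      rw [hφ, hk, hlev hT fun q hq => (h q (hB hq)).Tu, hlev hX fun q hq => (h q (hB hq)).Xu]
      rfl
    have hsym : k.symm ((φ q).1, (φ q).2.1) = tx q := by
      change k.symm (tx (φ q)) = tx q
      rw [htx, k.left_inv hqk]
    refine ⟨htx ▸ k.map_source hqk, ?_⟩
    have hgl : ∀ {g : Ext → ℝ}, ContDiff ℝ ∞ g → (∀ q ∈ N, pd bu (fun q => g (F q)) q = 0) →
        g (F (j (k.symm ((φ q).1, (φ q).2.1)))) = g (F q) := fun hg h0 => by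
      rw [hsym]; exact hlev (hsm hg) fun q hq => h0 q (hB hq)
    exact Prod.ext (hgl smooth_v10 fun q hq => ((h q hq).time v10 (by simp)).2)
      (Prod.ext (hgl smooth_v11 fun q hq => ((h q hq).time v11 (by simp)).2)
      (Prod.ext (hgl smooth_v2 fun q hq => (h q hq).A2u)
      (Prod.ext (hgl smooth_w0 fun q hq => ((h q hq).time w0 (by simp)).2)
      (Prod.ext (hgl smooth_w1 fun q hq => ((h q hq).time w1 (by simp)).2)
      (hgl smooth_w2 fun q hq => ((h q hq).time w2 (by simp)).2)))))

/-! ### Functions of time -/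

/-- `f` is smooth on `N` and its derivatives with respect to `x` and `u` vanish. -/
structure Timely (N : Set Pt) (f : Pt → ℝ) : Prop where
  smooth : ContDiffOn ℝ ∞ f N
  dx : ∀ q ∈ N, pd bx f q = 0
  du : ∀ q ∈ N, pd bu f q = 0

namespace Timely

variable {N : Set Pt} {f : Pt → ℝ} {q : Pt}

theorem hasPd (h : Timely N f) (hN : IsOpen N) (hq : q ∈ N) (d : Pt) :
    HasPd d f (d.1 * pd bt f q) q :=
  (BurgersL0.hasPd h.smooth hN hq d).val (by
    obtain ⟨a, b, c⟩ := d
    rw [pd_pt, h.dx q hq, h.du q hq]; ring)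

theorem pd_bt (h : Timely N f) (hN : IsOpen N) : Timely N (pd bt f) where
  smooth := smooth_pd hN h.smooth bt
  dx q hq := by rw [pd_comm hN h.smooth hq]; exact pd_eq_zero hN h.dx hq bt
  du q hq := by rw [pd_comm hN h.smooth hq]; exact pd_eq_zero hN h.du hq bt

end Timely

/-! ### The explicit family along a tuple of arbitrary elements -/

/-- The functions and constants which define a transformation of the explicit family along the graph
of a tuple of arbitrary elements. -/
structure FormData (N : Set Pt) where
  (T X a10 a11 a2 y0 y1 y2 : Pt → ℝ)
  (c0 c1 c2 c3 c0' c1' δ : ℝ)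
  isOpen : IsOpen N
  timely_T : Timely N T
  timely_X : Timely N X
  timely_a10 : Timely N a10
  timely_a11 : Timely N a11
  timely_y0 : Timely N y0
  timely_y1 : Timely N y1
  timely_y2 : Timely N y2
  smooth_a2 : ContDiffOn ℝ ∞ a2 N
  a2_u : ∀ q ∈ N, pd bu a2 q = 0
  a2_ne : ∀ q ∈ N, a2 q ≠ 0
  y0_t : ∀ q ∈ N, pd bt y0 q = a11 q
  y1_t : ∀ q ∈ N, pd bt y1 q = Real.exp (y0 q)
  y2_t : ∀ q ∈ N, pd bt y2 q = a10 q * Real.exp (y0 q)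
  delta : δ = c1' * c0 - c0' * c1
  W_ne : ∀ q ∈ N, c1 * y1 q + c0 ≠ 0
  pos : ∀ q ∈ N, 0 < δ * pd bt T q

namespace FormData

variable {N : Set Pt} (D : FormData N) {q : Pt}

/-- The coefficient of `u` in the `u`-component. -/
noncomputable def W (q : Pt) : ℝ := D.c1 * D.y1 q + D.c0

/-- The transformed value of `A¹¹`, up to the derivative of the `t`-component. -/
noncomputable def B (q : Pt) : ℝ :=
  D.a11 q - pd bt (pd bt D.T) q / pd bt D.T q - 2 * D.c1 * Real.exp (D.y0 q) / D.W q

/-- The transformed value of `A¹¹`. -/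
noncomputable def b11 (q : Pt) : ℝ := 1 / pd bt D.T q * D.B q

/-- The transformed value of `A¹⁰`. -/
noncomputable def b10 (q : Pt) : ℝ :=
  D.W q * D.a10 q - pd bt D.X q / pd bt D.T q + D.c2 - D.c1 * D.y2 q
    - D.X q / pd bt D.T q * D.B q

/-- The transformed value of `A²`. -/
noncomputable def b2 (q : Pt) : ℝ := pd bt D.T q * D.W q ^ 2 * D.a2 q

/-- The transformed value of `Y⁰`. -/
noncomputable def z0 (q : Pt) : ℝ := D.y0 q + Real.log (D.δ / (pd bt D.T q * D.W q ^ 2))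

/-- The transformed value of `Y¹`. -/
noncomputable def z1 (q : Pt) : ℝ := (D.c1' * D.y1 q + D.c0') / D.W q

/-- The transformed value of `Y²`. -/
noncomputable def z2 (q : Pt) : ℝ :=
  D.δ * D.y2 q / D.W q - D.δ * D.X q * Real.exp (D.y0 q) / (pd bt D.T q * D.W q ^ 2)
    + D.c2 * D.z1 q + D.c3

/-- The transformation of the `(t, x, u)`-space. -/
noncomputable def map (q : Pt) : Pt :=
  (D.T q, pd bt D.T q * D.W q * q.2.1 + D.X q,
    D.W q * q.2.2 - D.c1 * Real.exp (D.y0 q) * q.2.1 + D.c2 - D.c1 * D.y2 q)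

/-- The transformation along the graph of the tuple of arbitrary elements. -/
noncomputable def extMap (q : Pt) : Ext :=
  (D.map q, (D.b10 q, D.b11 q, D.b2 q, D.z0 q, D.z1 q, D.z2 q))

variable (hq : q ∈ N)

include hq

theorem P_ne : pd bt D.T q ≠ 0 := right_ne_zero_of_mul (D.pos q hq).ne'

theorem δ_ne : D.δ ≠ 0 := left_ne_zero_of_mul (D.pos q hq).ne'

theorem quot_pos : 0 < D.δ / (pd bt D.T q * D.W q ^ 2) := by
  have hW : D.W q ≠ 0 := D.W_ne q hq
  rw [← mul_div_mul_right _ _ (D.P_ne hq)]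
  have := D.P_ne hq
  exact div_pos (D.pos q hq) (by
    rw [show pd bt D.T q * D.W q ^ 2 * pd bt D.T q = (pd bt D.T q * D.W q) ^ 2 by ring]
    positivity)

theorem exp_z0 :
    Real.exp (D.z0 q) = Real.exp (D.y0 q) * (D.δ / (pd bt D.T q * D.W q ^ 2)) := by
  rw [z0, Real.exp_add, Real.exp_log (D.quot_pos hq)]

theorem hasPd_P (d : Pt) : HasPd d (pd bt D.T) (d.1 * pd bt (pd bt D.T) q) q :=
  (D.timely_T.pd_bt D.isOpen).hasPd D.isOpen hq d

theorem hasPd_X (d : Pt) : HasPd d D.X (d.1 * pd bt D.X q) q := D.timely_X.hasPd D.isOpen hq d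

theorem hasPd_y0 (d : Pt) : HasPd d D.y0 (d.1 * D.a11 q) q :=
  (D.timely_y0.hasPd D.isOpen hq d).val (by rw [D.y0_t q hq])

theorem hasPd_y1 (d : Pt) : HasPd d D.y1 (d.1 * Real.exp (D.y0 q)) q :=
  (D.timely_y1.hasPd D.isOpen hq d).val (by rw [D.y1_t q hq])

theorem hasPd_y2 (d : Pt) : HasPd d D.y2 (d.1 * (D.a10 q * Real.exp (D.y0 q))) q :=
  (D.timely_y2.hasPd D.isOpen hq d).val (by rw [D.y2_t q hq])

theorem hasPd_W (d : Pt) : HasPd d D.W (d.1 * (D.c1 * Real.exp (D.y0 q))) q :=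
  (((HasPd.const D.c1).mul (D.hasPd_y1 hq d)).add (HasPd.const D.c0)).val (by ring)

theorem hasPd_R (d : Pt) : HasPd d (fun q => D.c1 * Real.exp (D.y0 q))
    (d.1 * (D.a11 q * (D.c1 * Real.exp (D.y0 q)))) q :=
  ((HasPd.const D.c1).mul (D.hasPd_y0 hq d).exp).val (by ring)

theorem hasPd_mapX (d : Pt) : HasPd d (cX D.map)
    (d.1 * (pd bt (pd bt D.T) q * D.W q * q.2.1
      + pd bt D.T q * (D.c1 * Real.exp (D.y0 q)) * q.2.1 + pd bt D.X q)
      + d.2.1 * (pd bt D.T q * D.W q)) q :=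
  ((((D.hasPd_P hq d).mul (D.hasPd_W hq d)).mul (hasPd_x d q)).add (D.hasPd_X hq d)).val (by ring)

theorem hasPd_mapU (d : Pt) : HasPd d (cU D.map)
    (d.1 * (D.c1 * Real.exp (D.y0 q) * q.2.2 - D.a11 q * (D.c1 * Real.exp (D.y0 q)) * q.2.1
      - D.c1 * (D.a10 q * Real.exp (D.y0 q)))
      - d.2.1 * (D.c1 * Real.exp (D.y0 q)) + d.2.2 * D.W q) q :=
  (((((D.hasPd_W hq d).mul (hasPd_u d q)).sub ((D.hasPd_R hq d).mul (hasPd_x d q))).add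
    (HasPd.const D.c2)).sub ((HasPd.const D.c1).mul (D.hasPd_y2 hq d))).val (by ring)

/-- Directions with d.1 = 0 suffice here, since the class imposes no condition on the t-derivatives
of A¹¹ and A¹⁰. -/
theorem hasPd_B {d : Pt} (hd : d.1 = 0) : HasPd d D.B 0 q :=
  ((((D.timely_a11.hasPd D.isOpen hq d).sub
    ((((D.timely_T.pd_bt D.isOpen).pd_bt D.isOpen).hasPd D.isOpen hq d).div (D.hasPd_P hq d)
      (D.P_ne hq))).sub (((HasPd.const (2 * D.c1)).mul (D.hasPd_y0 hq d).exp).div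
        (D.hasPd_W hq d) (D.W_ne q hq)))).val (by rw [hd]; ring)

theorem hasPd_b11 {d : Pt} (hd : d.1 = 0) : HasPd d D.b11 0 q :=
  (((HasPd.const 1).div (D.hasPd_P hq d) (D.P_ne hq)).mul (D.hasPd_B hq hd)).val (by
    rw [hd]; ring)

theorem hasPd_b10 {d : Pt} (hd : d.1 = 0) : HasPd d D.b10 0 q :=
  ((((((D.hasPd_W hq d).mul (D.timely_a10.hasPd D.isOpen hq d)).sub
    (((D.timely_X.pd_bt D.isOpen).hasPd D.isOpen hq d).div (D.hasPd_P hq d) (D.P_ne hq))).add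
    (HasPd.const D.c2)).sub ((HasPd.const D.c1).mul (D.hasPd_y2 hq d))).sub
    (((D.hasPd_X hq d).div (D.hasPd_P hq d) (D.P_ne hq)).mul (D.hasPd_B hq hd))).val (by
      rw [hd]; ring)

theorem hasPd_b2 : HasPd bu D.b2 0 q := by
  have h := (((D.hasPd_P hq bu).mul ((D.hasPd_W hq bu).mul (D.hasPd_W hq bu))).mul
    (hasPd D.smooth_a2 D.isOpen hq bu)).val (b := 0) (by rw [D.a2_u q hq]; simp [bu])
  exact h.congr_of_eqOn D.isOpen hq fun q _ => by simp only [b2, sq]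

/-- The logarithmic derivative of T_t W² is T_tt/T_t + 2c₁ exp(Y⁰)/W, exactly what is subtracted
from A¹¹ in `B`. -/
theorem hasPd_z0 (d : Pt) : HasPd d D.z0 (d.1 * (D.b11 q * pd bt D.T q)) q := by
  have hP := D.P_ne hq
  have hW : D.W q ≠ 0 := D.W_ne q hq
  have hδ := D.δ_ne hq
  have h := (D.hasPd_y0 hq d).add (((HasPd.const D.δ).div ((D.hasPd_P hq d).mul
    ((D.hasPd_W hq d).mul (D.hasPd_W hq d))) (by positivity)).log (by positivity))
  refine (h.val ?_).congr_of_eqOn D.isOpen hq fun q _ => by simp only [z0, sq]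
  rw [b11, B]
  field_simp
  ring

/-- A fractional linear function of Y¹ with determinant δ has t-derivative δ exp(Y⁰)/W², and this is
exp(z₀) T_t by the choice of z₀. -/
theorem hasPd_z1 (d : Pt) :
    HasPd d D.z1 (d.1 * (Real.exp (D.z0 q) * pd bt D.T q)) q := by
  have hP := D.P_ne hq
  have hW : D.W q ≠ 0 := D.W_ne q hq
  refine ((((HasPd.const D.c1').mul (D.hasPd_y1 hq d)).add (HasPd.const D.c0')).div
    (D.hasPd_W hq d) hW).val ?_
  rw [D.exp_z0 hq, D.delta]
  field_simp
  rw [W]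
  ring

theorem hasPd_z2 (d : Pt) :
    HasPd d D.z2 (d.1 * (D.b10 q * Real.exp (D.z0 q) * pd bt D.T q)) q := by
  have hP := D.P_ne hq
  have hW : D.W q ≠ 0 := D.W_ne q hq
  have h := (((((HasPd.const D.δ).mul (D.hasPd_y2 hq d)).div (D.hasPd_W hq d) hW).sub
    ((((HasPd.const D.δ).mul (D.hasPd_X hq d)).mul (D.hasPd_y0 hq d).exp).div
      ((D.hasPd_P hq d).mul ((D.hasPd_W hq d).mul (D.hasPd_W hq d))) (by positivity))).add
    ((HasPd.const D.c2).mul (D.hasPd_z1 hq d))).add (HasPd.const D.c3)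
  refine (h.val ?_).congr_of_eqOn D.isOpen hq fun q _ => by simp only [z2, sq]
  rw [D.exp_z0 hq, b10, B]
  field_simp
  ring

theorem graphlike : Graphlike D.extMap q := by
  have hP := D.P_ne hq
  have hW : D.W q ≠ 0 := D.W_ne q hq
  have e0 := fun d => (D.hasPd_z0 hq d).eq
  have e1 := fun d => (D.hasPd_z1 hq d).eq
  have e2 := fun d => (D.hasPd_z2 hq d).eq
  have t0 : ∀ d : Pt, d.1 = 0 → ∀ g : Ext → ℝ, g = v10 ∨ g = v11 ∨ g = w0 ∨ g = w1 ∨ g = w2 →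
      pd d (fun q => g (D.extMap q)) q = 0 := by
    rintro d hd g (rfl | rfl | rfl | rfl | rfl)
    · exact (D.hasPd_b10 hq hd).eq
    · exact (D.hasPd_b11 hq hd).eq
    · exact (e0 d).trans (by rw [hd, zero_mul])
    · exact (e1 d).trans (by rw [hd, zero_mul])
    · exact (e2 d).trans (by rw [hd, zero_mul])
  have hTt : pd bt (cT fun q => (D.extMap q).1) q = pd bt D.T q := rfl
  exact {
    Tx := D.timely_T.dx q hq
    Tu := D.timely_T.du q hq
    Tt := hP
    Xu := (D.hasPd_mapX hq bu).eq.trans (by simp [bu])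
    Xx := by
      rw [show pd bx (cX fun q => (D.extMap q).1) q = _ from (D.hasPd_mapX hq bx).eq]
      simp [bx, hP, hW]
    Uu := by
      rw [show pd bu (cU fun q => (D.extMap q).1) q = _ from (D.hasPd_mapU hq bu).eq]
      simp [bu, hW]
    time := fun g hg => ⟨t0 bx rfl g hg, t0 bu rfl g hg⟩
    A2u := (D.hasPd_b2 hq).eq
    A2_ne := mul_ne_zero (mul_ne_zero hP (pow_ne_zero 2 hW)) (D.a2_ne q hq)
    Y0 := (e0 bt).trans (one_mul _)
    Y1 := (e1 bt).trans (one_mul _)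
    Y2 := (e2 bt).trans (one_mul _) }

theorem det : Det (D.a10 q) (D.a11 q) (D.a2 q) (D.b10 q) (D.b11 q) (D.b2 q) D.map q := by
  have hP := D.P_ne hq
  have hW : D.W q ≠ 0 := D.W_ne q hq
  have hN := D.isOpen
  have hUu : Set.EqOn (pd bu (cU D.map)) D.W N := fun q hq =>
    (D.hasPd_mapU hq bu).eq.trans (by simp [bu])
  have hUx : Set.EqOn (pd bx (cU D.map)) (fun q => -(D.c1 * Real.exp (D.y0 q))) N := fun q hq =>
    (D.hasPd_mapU hq bx).eq.trans (by simp [bx])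
  have hT : pd bt (cT D.map) = pd bt D.T := rfl
  have hUt := (D.hasPd_mapU hq bt).eq
  have hXt := (D.hasPd_mapX hq bt).eq
  exact {
    Tx := D.timely_T.dx q hq
    Tu := D.timely_T.du q hq
    Xu := (D.hasPd_mapX hq bu).eq.trans (by simp [bu])
    Tt := hP
    Uu := by rw [hUu hq]; exact hW
    Xx := (D.hasPd_mapX hq bx).eq.trans (by rw [hUu hq, hT]; simp [bx, mul_comm])
    Uuu := by rw [pd_congr hN hUu hq, (D.hasPd_W hq bu).eq]; simp [bu]
    Uxu := by rw [pd_congr hN hUu hq, (D.hasPd_W hq bx).eq]; simp [bx]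
    Utu := by rw [pd_congr hN hUu hq, hUx hq, (D.hasPd_W hq bt).eq]; simp [bt]
    Uxx := by rw [pd_congr hN hUx hq, (D.hasPd_R hq bx).neg.eq]; simp [bx]
    Utx := by rw [pd_congr hN hUx hq, hUx hq, (D.hasPd_R hq bt).neg.eq]; simp [bt]
    Ut := by rw [hUt, hUx hq]; simp only [bt]; ring
    Xt := by
      rw [hXt, hUu hq, hT, b10, b11, B, show bt.1 = 1 from rfl, show bt.2.1 = 0 from rfl]
      simp only [cU, cX, map]
      field_simp
      ring
    B11 := by
      rw [hUu hq, hT, hUx hq, b11, B]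
      field_simp
      ring
    B2 := by rw [hUu hq, hT, b2]; ring }

end FormData

/-! ### The transformations of the explicit family -/

theorem pd_eq_zero_of_factor {U : Set Ext} (hU : IsOpen U) {G : Ext → ℝ}
    (hG : ContDiffOn ℝ ∞ G U) {Φ : ℝ → ℝ → ℝ → ℝ → ℝ}
    (h : ∀ z ∈ U, G z = Φ z.1.1 (w0 z) (w1 z) (w2 z)) {z d : Ext} (hz : z ∈ U)
    (ht : d.1.1 = 0) (hY : d.2.2.2.2 = 0) : pd d G z = 0 := by
  have h1 : HasDerivAt (fun s : ℝ => z + s • d) d 0 := by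
    simpa using ((hasDerivAt_id (0 : ℝ)).smul_const d).const_add z
  have hz0 : z + (0 : ℝ) • d = z := by simp
  have h2 : HasDerivAt (fun s : ℝ => G (z + s • d)) (pd d G z) 0 := by
    have h3 : HasFDerivAt G (fderiv ℝ G z) (z + (0 : ℝ) • d) := by
      rw [hz0]; exact (smooth_at hG hU hz).hasFDerivAt
    exact h3.comp_hasDerivAt 0 h1
  refine h2.unique ((hasDerivAt_const (0 : ℝ) (G z)).congr_of_eventuallyEq ?_)
  have h4 : ∀ᶠ s in 𝓝 (0 : ℝ), z + s • d ∈ U :=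
    h1.continuousAt.preimage_mem_nhds (by rw [hz0]; exact hU.mem_nhds hz)
  filter_upwards [h4] with s hs
  rw [h _ hs, h z hz]
  simp [w0, w1, w2, ht, hY]

section Section

variable {Ω : Set (ℝ × ℝ)} {θ : ArbTuple}

theorem IsArbTuple.timely (hθ : IsArbTuple Ω θ) {f : ℝ → ℝ → ℝ} (hf : SmoothOn f Ω)
    (hx : ∀ t x, (t, x) ∈ Ω → BurgersL0.dx f t x = 0) :
    Timely (tx ⁻¹' Ω) (fun q => f q.1 q.2.1) where
  smooth := smooth_along (T := fun p : Pt => p.1) (X := fun p : Pt => p.2.1) hf contDiffOn_fst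
    (contDiff_fst.comp contDiff_snd).contDiffOn fun z hz => hz
  dx q hq := (hasPd_source hθ.isOpen hf hq bx).eq.trans (by
    rw [hx q.1 q.2.1 hq]; simp [bx])
  du q hq := (hasPd_source hθ.isOpen hf hq bu).eq.trans (by simp [bu])

theorem Timely.mono {N N' : Set Pt} {f : Pt → ℝ} (h : Timely N f) (hN : N' ⊆ N) : Timely N' f :=
  ⟨h.smooth.mono hN, fun q hq => h.dx q (hN hq), fun q hq => h.du q (hN hq)⟩

/-- The part of the `(t, x, u)`-space over which the graph of `θ` runs in `U`. -/
def domainOver (Ω : Set (ℝ × ℝ)) (θ : ArbTuple) (U : Set Ext) : Set Pt := tx ⁻¹' Ω ∩ sec θ ⁻¹' U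

theorem IsArbTuple.isOpen_domainOver (hθ : IsArbTuple Ω θ) {U : Set Ext} (hU : IsOpen U) :
    IsOpen (domainOver Ω θ U) :=
  hθ.smooth_sec.continuousOn.isOpen_inter_preimage hθ.isOpen_preimage hU

theorem IsArbTuple.pd_bt (hθ : IsArbTuple Ω θ) {f : ℝ → ℝ → ℝ} (hf : SmoothOn f Ω) {q : Pt}
    (hq : tx q ∈ Ω) : pd bt (fun q : Pt => f q.1 q.2.1) q = BurgersL0.dt f q.1 q.2.1 :=
  (hasPd_source hθ.isOpen hf hq bt).eq.trans (by simp [bt])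

theorem IsArbTuple.timely_sec (hθ : IsArbTuple Ω θ) {U : Set Ext} (hU : IsOpen U) {G : Ext → ℝ}
    (hG : ContDiffOn ℝ ∞ G U) {Φ : ℝ → ℝ → ℝ → ℝ → ℝ}
    (h : ∀ z ∈ U, G z = Φ z.1.1 (w0 z) (w1 z) (w2 z)) :
    Timely (domainOver Ω θ U) (fun q => G (sec θ q)) ∧ ∀ q ∈ domainOver Ω θ U,
      pd bt (fun q => G (sec θ q)) q = Dbar (θ.A10 q.1 q.2.1) (θ.A11 q.1 q.2.1) Φ q.1
        (θ.Y0 q.1 q.2.1) (θ.Y1 q.1 q.2.1) (θ.Y2 q.1 q.2.1) := by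
  have hk := fun q (hq : q ∈ domainOver Ω θ U) => hθ.hasPd_sec hq.1 (smooth_at hG hU hq.2)
  have h0 : ∀ q ∈ domainOver Ω θ U, ∀ d : Ext, d.1.1 = 0 → d.2.2.2.2 = 0 → pd d G (sec θ q) = 0 :=
    fun q hq d hd hd' => pd_eq_zero_of_factor hU hG h hq.2 hd hd'
  refine ⟨⟨hG.comp (hθ.smooth_sec.mono fun q hq => hq.1) fun q hq => hq.2, fun q hq => ?_,
    fun q hq => ?_⟩, fun q hq => ?_⟩
  · rw [(hk q hq).2.1.eq, h0 q hq ex rfl rfl, h0 q hq e2 rfl rfl]; ring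
  · rw [(hk q hq).1.eq, h0 q hq eu rfl rfl]
  · rw [(hk q hq).2.2.eq]
    refine Eq.trans ?_ (total_eq_Dbar hU hG h hq.2).symm
    rw [total, total, h0 q hq e10 rfl rfl, h0 q hq e11 rfl rfl, h0 q hq e2 rfl rfl]
    ring

end Section

/-- Along a tuple the restricted total derivatives become t-derivatives and the form turns into a
`FormData`. Then `FormData.graphlike` provides the target tuple, and `FormData.det` shows that the
equations are connected. Convexity plays no role in this direction. -/
theorem HasForm.isGenEquiv {e : OpenPartialHomeomorph Ext Ext} (he : IsPointTransformation e)
    (hf : HasForm e) : IsGenEquiv e := by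
  obtain ⟨T, X, c0, c1, c2, c3, c0', c1', δ, hδ, -, -, hform⟩ := hf
  have hS := e.open_source
  have hform' := fun (z : Ext) (hz : z ∈ e.source) =>
    hform z.1.1 z.1.2.1 z.1.2.2 (v10 z) (v11 z) (v2 z) (w0 z) (w1 z) (w2 z) hz
  -- As T does not involve Y⁰ and Y², its derivative does not see A¹⁰ and A¹¹; normalizing them to 0
  -- makes D_t T one function that can be differentiated again.
  have hfun : ∀ a b, Dbar a b (lift T) = Dbar 0 0 (lift T) := fun a b => by
    funext t y0 y1 y2; rw [Dbar_lift, Dbar_lift]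
  simp only [hfun] at hform'
  have sT := smooth_eT he.1
  have fT : ∀ z ∈ e.source, eT e z = lift T z.1.1 (w0 z) (w1 z) (w2 z) := fun z hz =>
    congrArg (fun z : Ext => z.1.1) (hform' z hz).2.2
  have sP := smooth_total hS sT 0 0 0
  have fP : ∀ z ∈ e.source, total 0 0 0 (eT e) z
      = Dbar 0 0 (lift T) z.1.1 (w0 z) (w1 z) (w2 z) := fun z hz => by
    rw [← total_eq_Dbar hS sT fT hz, hfun]
  -- X is recovered from the x-component of e and so inherits smoothness on the source.
  have sX : ContDiffOn ℝ ∞ (fun z => eX e z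
      - total 0 0 0 (eT e) z * (c1 * w1 z + c0) * z.1.2.1) e.source := by
    have h1 := smooth_eX he.1
    have h2 := smooth_w1.contDiffOn (s := e.source)
    fun_prop
  have fX : ∀ z ∈ e.source, eX e z - total 0 0 0 (eT e) z * (c1 * w1 z + c0) * z.1.2.1
      = X z.1.1 (w0 z) (w1 z) (w2 z) := fun z hz => by
    have := congrArg (fun z : Ext => z.1.2.1) (hform' z hz).2.2
    rw [fP z hz, show eX e z = _ from this]
    ring
  refine ⟨he, fun Ω θ hθ p hpΩ hpe => ?_⟩
  obtain ⟨tT, dT⟩ := hθ.timely_sec hS sT fT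
  obtain ⟨tP, dP⟩ := hθ.timely_sec hS sP fP
  obtain ⟨tX, dX⟩ := hθ.timely_sec hS sX fX
  have hN : IsOpen (domainOver Ω θ e.source) := hθ.isOpen_domainOver hS
  have hsub : domainOver Ω θ e.source ⊆ tx ⁻¹' Ω := fun q hq => hq.1
  have dT' : Set.EqOn (pd bt fun q => eT e (sec θ q))
      (fun q => total 0 0 0 (eT e) (sec θ q)) (domainOver Ω θ e.source) := fun q hq => by
    rw [dT q hq, hfun]; exact (fP _ hq.2).symm
  let D : FormData (domainOver Ω θ e.source) := {
    T := fun q => eT e (sec θ q)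
    X := fun q => eX e (sec θ q) - total 0 0 0 (eT e) (sec θ q) * (c1 * w1 (sec θ q) + c0) * q.2.1
    a10 := fun q => θ.A10 q.1 q.2.1
    a11 := fun q => θ.A11 q.1 q.2.1
    a2 := fun q => θ.A2 q.1 q.2.1
    y0 := fun q => θ.Y0 q.1 q.2.1
    y1 := fun q => θ.Y1 q.1 q.2.1
    y2 := fun q => θ.Y2 q.1 q.2.1
    c0 := c0, c1 := c1, c2 := c2, c3 := c3, c0' := c0', c1' := c1', δ := δ
    isOpen := hN
    timely_T := tT
    timely_X := tX
    timely_a10 := (hθ.timely hθ.smooth_A10 hθ.A10_x).mono hsub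
    timely_a11 := (hθ.timely hθ.smooth_A11 hθ.A11_x).mono hsub
    timely_y0 := (hθ.timely hθ.smooth_Y0 hθ.Y0_x).mono hsub
    timely_y1 := (hθ.timely hθ.smooth_Y1 hθ.Y1_x).mono hsub
    timely_y2 := (hθ.timely hθ.smooth_Y2 hθ.Y2_x).mono hsub
    smooth_a2 := (smooth_along (T := fun p : Pt => p.1) (X := fun p : Pt => p.2.1) hθ.smooth_A2
      contDiffOn_fst (contDiff_fst.comp contDiff_snd).contDiffOn fun z hz => hz.1)
    a2_u := fun q hq => (hasPd_source hθ.isOpen hθ.smooth_A2 hq.1 bu).eq.trans (by simp [bu])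
    a2_ne := fun q hq => hθ.A2_ne _ _ hq.1
    y0_t := fun q hq => (hθ.pd_bt hθ.smooth_Y0 hq.1).trans (hθ.Y0_t _ _ hq.1)
    y1_t := fun q hq => (hθ.pd_bt hθ.smooth_Y1 hq.1).trans (hθ.Y1_t _ _ hq.1)
    y2_t := fun q hq => (hθ.pd_bt hθ.smooth_Y2 hq.1).trans (hθ.Y2_t _ _ hq.1)
    delta := hδ
    W_ne := fun q hq => (hform' _ hq.2).1
    pos := fun q hq => by rw [(dT' hq).trans (fP _ hq.2)]; exact (hform' _ hq.2).2.1 }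
  have heq : Set.EqOn (fun q => e (sec θ q)) D.extMap (domainOver Ω θ e.source) := fun q hq => by
    have h := (hform' _ hq.2).2.2
    have k1 : Dbar 0 0 (lift T) (sec θ q).1.1 (w0 (sec θ q)) (w1 (sec θ q)) (w2 (sec θ q))
        = pd bt D.T q := by rw [← fP _ hq.2]; exact (dT' hq).symm
    have k2 : Dbar (v10 (sec θ q)) (v11 (sec θ q)) (Dbar 0 0 (lift T)) (sec θ q).1.1
        (w0 (sec θ q)) (w1 (sec θ q)) (w2 (sec θ q)) = pd bt (pd bt D.T) q := by
      rw [pd_congr hN dT' hq]; exact (dP q hq).symm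
    have k3 : Dbar (v10 (sec θ q)) (v11 (sec θ q)) X (sec θ q).1.1
        (w0 (sec θ q)) (w1 (sec θ q)) (w2 (sec θ q)) = pd bt D.X q := (dX q hq).symm
    have k4 : X (sec θ q).1.1 (w0 (sec θ q)) (w1 (sec θ q)) (w2 (sec θ q)) = D.X q :=
      (fX _ hq.2).symm
    have k5 : T (sec θ q).1.1 (w1 (sec θ q)) = D.T q := (fT _ hq.2).symm
    rw [k1, k2, k3, k4, k5] at h
    exact h
  have hsm : ContDiffOn ℝ ∞ D.extMap (domainOver Ω θ e.source) :=
    (he.1.comp (hθ.smooth_sec.mono hsub) fun q hq => hq.2).congr fun q hq => (heq hq).symm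
  obtain ⟨φ, Ω', θ', hpφ, hφN, hφ, hθ', hφD, hval⟩ := Graphlike.exists_tuple hN hsm
    (fun q hq => D.graphlike hq) (p := p) ⟨hpΩ, hpe⟩
  have hφ' : (φ : Pt → Pt) = D.map := funext hφD
  refine ⟨φ, Ω', θ', hpφ, ⟨hθ, hθ', hφ, fun q hq => (hφN hq).1, fun q hq => (hval q hq).1,
    fun q hq => ?_⟩, fun q hq => ⟨(hφN hq).2, ?_⟩⟩
  · refine connectsAt_of_det φ.open_source hφ.1 (A := fun q => (D.a10 q, D.a11 q, D.a2 q, D.b10 q,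
      D.b11 q, D.b2 q)) (fun q hq => ?_) hq ?_
    · rw [hφ']; exact D.det (hφN hq)
    · have hv := (hval q hq).2
      have e1 : θ'.A10 (cT φ q) (cX φ q) = D.b10 q := congrArg (fun v : Val => v.1) hv
      have e2 : θ'.A11 (cT φ q) (cX φ q) = D.b11 q := congrArg (fun v : Val => v.2.1) hv
      have e3 : θ'.A2 (cT φ q) (cX φ q) = D.b2 q := congrArg (fun v : Val => v.2.2.1) hv
      rw [e1, e2, e3]
  · rw [(hval q hq).2, hφD]
    exact heq (hφN hq)

/-! ### Transformations of the explicit family whose parameter functions depend on `t` -/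

theorem Dbar_time (a b : ℝ) (f : ℝ → ℝ) (t y0 y1 y2 : ℝ) :
    Dbar a b (fun t _ _ _ => f t) t y0 y1 y2 = deriv f t := by
  simp [Dbar]

/-- A transformation of the explicit family with `T` and `X` depending on `t` only. -/
noncomputable def timeForm (τ χ : ℝ → ℝ) (c0 c1 c2 c3 c0' c1' δ : ℝ) (z : Ext) : Ext :=
  ((τ z.1.1, deriv τ z.1.1 * (c1 * w1 z + c0) * z.1.2.1 + χ z.1.1,
    (c1 * w1 z + c0) * z.1.2.2 - c1 * Real.exp (w0 z) * z.1.2.1 + c2 - c1 * w2 z),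
   ((c1 * w1 z + c0) * v10 z - deriv χ z.1.1 / deriv τ z.1.1 + c2 - c1 * w2 z
      - χ z.1.1 / deriv τ z.1.1 * (v11 z - deriv (deriv τ) z.1.1 / deriv τ z.1.1
        - 2 * c1 * Real.exp (w0 z) / (c1 * w1 z + c0)),
    1 / deriv τ z.1.1 * (v11 z - deriv (deriv τ) z.1.1 / deriv τ z.1.1
        - 2 * c1 * Real.exp (w0 z) / (c1 * w1 z + c0)),
    deriv τ z.1.1 * (c1 * w1 z + c0) ^ 2 * v2 z,
    w0 z + Real.log (δ / (deriv τ z.1.1 * (c1 * w1 z + c0) ^ 2)),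
    (c1' * w1 z + c0') / (c1 * w1 z + c0),
    δ * w2 z / (c1 * w1 z + c0)
      - δ * χ z.1.1 * Real.exp (w0 z) / (deriv τ z.1.1 * (c1 * w1 z + c0) ^ 2)
      + c2 * ((c1' * w1 z + c0') / (c1 * w1 z + c0)) + c3))

/-! ### The time-dependent subfamily consists of point transformations -/

section TimeForm

variable {τ χ : ℝ → ℝ} {c0 c1 c2 c3 c0' c1' δ : ℝ} {I : Set ℝ}

theorem smooth_timeForm (hI : IsOpen I) (hτ : ContDiffOn ℝ ∞ τ I) (hχ : ContDiffOn ℝ ∞ χ I)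
    (hpos : ∀ t ∈ I, 0 < δ * deriv τ t) :
    ContDiffOn ℝ ∞ (timeForm τ χ c0 c1 c2 c3 c0' c1' δ)
      {z | z.1.1 ∈ I ∧ c1 * w1 z + c0 ≠ 0} := by
  set S : Set Ext := {z | z.1.1 ∈ I ∧ c1 * w1 z + c0 ≠ 0}
  have hτ' := hτ.deriv_of_isOpen (m := ∞) hI (by simp)
  have hτ'' := hτ'.deriv_of_isOpen (m := ∞) hI (by simp)
  have hχ' := hχ.deriv_of_isOpen (m := ∞) hI (by simp)
  have ht : ContDiffOn ℝ ∞ (fun z : Ext => z.1.1) S := by fun_prop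
  have sτ : ContDiffOn ℝ ∞ (fun z : Ext => τ z.1.1) S := hτ.comp ht fun z hz => hz.1
  have sP : ContDiffOn ℝ ∞ (fun z : Ext => deriv τ z.1.1) S := hτ'.comp ht fun z hz => hz.1
  have sQ : ContDiffOn ℝ ∞ (fun z : Ext => deriv (deriv τ) z.1.1) S :=
    hτ''.comp ht fun z hz => hz.1
  have sχ : ContDiffOn ℝ ∞ (fun z : Ext => χ z.1.1) S := hχ.comp ht fun z hz => hz.1
  have sχ' : ContDiffOn ℝ ∞ (fun z : Ext => deriv χ z.1.1) S := hχ'.comp ht fun z hz => hz.1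
  have s10 := smooth_v10.contDiffOn (s := S)
  have s11 := smooth_v11.contDiffOn (s := S)
  have s2 := smooth_v2.contDiffOn (s := S)
  have q0 := smooth_w0.contDiffOn (s := S)
  have q1 := smooth_w1.contDiffOn (s := S)
  have q2 := smooth_w2.contDiffOn (s := S)
  have sW : ContDiffOn ℝ ∞ (fun z : Ext => c1 * w1 z + c0) S := by fun_prop
  have nP : ∀ z ∈ S, deriv τ z.1.1 ≠ 0 := fun z hz => right_ne_zero_of_mul (hpos _ hz.1).ne'
  have nW : ∀ z ∈ S, c1 * w1 z + c0 ≠ 0 := fun z hz => hz.2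
  have sPW : ContDiffOn ℝ ∞ (fun z : Ext => deriv τ z.1.1 * (c1 * w1 z + c0) ^ 2) S := by fun_prop
  have nPW : ∀ z ∈ S, deriv τ z.1.1 * (c1 * w1 z + c0) ^ 2 ≠ 0 := fun z hz =>
    mul_ne_zero (nP z hz) (pow_ne_zero 2 (nW z hz))
  have sB := (s11.sub (sQ.div sP nP)).sub
    ((show ContDiffOn ℝ ∞ (fun z : Ext => 2 * c1 * Real.exp (w0 z)) S by fun_prop).div sW nW)
  have sM := (show ContDiffOn ℝ ∞ (fun z : Ext => c1' * w1 z + c0') S by fun_prop).div sW nW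
  have sL := ((contDiffOn_const (c := δ)).div sPW nPW).log fun z hz =>
    div_ne_zero (left_ne_zero_of_mul (hpos _ hz.1).ne') (nPW z hz)
  have sx : ContDiffOn ℝ ∞ (fun z : Ext => z.1.2.1) S := by fun_prop
  refine (sτ.prodMk (ContDiffOn.prodMk (((sP.mul sW).mul sx).add sχ) (by fun_prop))).prodMk
    (ContDiffOn.prodMk ?_ (ContDiffOn.prodMk ?_ (ContDiffOn.prodMk ?_
      (ContDiffOn.prodMk ?_ (ContDiffOn.prodMk sM ?_)))))
  · exact ((((sW.mul s10).sub (sχ'.div sP nP)).add contDiffOn_const).sub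
      (contDiffOn_const.mul q2)).sub ((sχ.div sP nP).mul sB)
  · exact (contDiffOn_const.div sP nP).mul sB
  · fun_prop
  · exact q0.add sL
  · exact ((((contDiffOn_const.mul q2).div sW nW).sub
      (((contDiffOn_const.mul sχ).mul q0.exp).div sPW nPW)).add (contDiffOn_const.mul sM)).add contDiffOn_const

/-- The domain c₁Y¹ + c₀ ≠ 0 may be disconnected, so injectivity is checked globally. The system is
triangular in the order t, Y¹, Y⁰, Y², A², x, u, A¹¹, A¹⁰; for Y¹ the determinant δ ≠ 0 is used. -/
theorem injOn_timeForm (hδ : δ = c1' * c0 - c0' * c1) (hτ : Set.InjOn τ I)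
    (hpos : ∀ t ∈ I, 0 < δ * deriv τ t) :
    Set.InjOn (timeForm τ χ c0 c1 c2 c3 c0' c1' δ) {z | z.1.1 ∈ I ∧ c1 * w1 z + c0 ≠ 0} := by
  rintro ⟨⟨t, x, u⟩, a10, a11, a2, y0, y1, y2⟩ hz ⟨⟨t', x', u'⟩, b10, b11, b2, z0, z1, z2⟩ hz' h
  obtain ⟨hI, hW⟩ := hz
  obtain ⟨hI', hW'⟩ := hz'
  simp only [timeForm, Prod.mk.injEq, v10, v11, v2, w0, w1, w2] at h hW hW' hI hI'
  obtain ⟨⟨eT, eX, eU⟩, e10, e11, e2, e0, e1, e2'⟩ := h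
  obtain rfl := hτ hI hI' eT
  have hP := right_ne_zero_of_mul (hpos t hI).ne'
  have hδ0 := left_ne_zero_of_mul (hpos t hI).ne'
  have h1 : y1 = z1 := by
    rw [div_eq_div_iff hW hW'] at e1
    refine mul_left_cancel₀ hδ0 ?_
    rw [hδ]
    linear_combination e1
  subst h1
  obtain rfl : y0 = z0 := add_right_cancel e0
  obtain rfl : y2 = z2 := by
    field_simp at e2'
    refine mul_left_cancel₀ (mul_ne_zero hδ0 hP) ?_
    refine mul_left_cancel₀ hW ?_
    linear_combination e2'
  obtain rfl : a2 = b2 := mul_left_cancel₀ (mul_ne_zero hP (pow_ne_zero 2 hW)) e2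
  obtain rfl : x = x' := mul_left_cancel₀ (mul_ne_zero hP hW) (add_right_cancel eX)
  obtain rfl : u = u' := mul_left_cancel₀ hW (by linarith)
  obtain rfl : a11 = b11 := by
    have := mul_left_cancel₀ (one_div_ne_zero hP) e11
    linarith
  obtain rfl : a10 = b10 := mul_left_cancel₀ hW (by linarith)
  rfl

theorem hasPd_time {f : ℝ → ℝ} {z : Ext} (hI : IsOpen I) (hf : ContDiffOn ℝ ∞ f I)
    (hz : z.1.1 ∈ I) (d : Ext) :
    HasPd d (fun z : Ext => f z.1.1) (deriv f z.1.1 * d.1.1) z :=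
  HasPd.comp_deriv (smooth_at hf hI hz).hasDerivAt (hasPd_fst (hasPd_fst (hasPd_id _ _)))

/-- The differential is triangular in the same sense: the coordinates of a kernel vector vanish one
after another, each using those already known to be zero. -/
theorem fderiv_timeForm_injective (hI : IsOpen I) (hτ : ContDiffOn ℝ ∞ τ I)
    (hχ : ContDiffOn ℝ ∞ χ I) (hδ : δ = c1' * c0 - c0' * c1)
    (hpos : ∀ t ∈ I, 0 < δ * deriv τ t) {z : Ext} (hz : z.1.1 ∈ I) (hW : c1 * w1 z + c0 ≠ 0) :
    Function.Injective (fderiv ℝ (timeForm τ χ c0 c1 c2 c3 c0' c1' δ) z) := by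
  have hP := right_ne_zero_of_mul (hpos _ hz).ne'
  have hδ0 := left_ne_zero_of_mul (hpos _ hz).ne'
  have hS : IsOpen {z : Ext | z.1.1 ∈ I ∧ c1 * w1 z + c0 ≠ 0} :=
    (hI.preimage (continuous_fst.comp continuous_fst)).inter (isOpen_ne_fun
      (by have := smooth_w1.continuous; fun_prop) continuous_const)
  have hd := smooth_at (smooth_timeForm (c0 := c0) (c1 := c1) (c2 := c2) (c3 := c3) (c0' := c0')
    (c1' := c1') hI hτ hχ hpos) hS ⟨hz, hW⟩
  have hτ' := hτ.deriv_of_isOpen (m := ∞) hI (by simp)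
  have hτ'' := hτ'.deriv_of_isOpen (m := ∞) hI (by simp)
  have hχ' := hχ.deriv_of_isOpen (m := ∞) hI (by simp)
  rw [injective_iff_map_eq_zero]
  intro d hv
  have hcomp : ∀ {L : Ext →L[ℝ] ℝ} {a : ℝ},
      HasPd d (fun z => L (timeForm τ χ c0 c1 c2 c3 c0' c1' δ z)) a z → a = 0 := by
    intro L a h
    rw [← h.eq, (HasPd.comp L.differentiableAt hd.hasFDerivAt d).eq, hv]
    exact map_zero _
  -- Each component is a linear functional of the map, so its derivative along a kernel vector is
  -- zero.
  have mk : ∀ {f : Ext → ℝ} {f' : ℝ}, HasPd d f f' z → ∀ L : Ext →L[ℝ] ℝ,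
      (∀ z, L (timeForm τ χ c0 c1 c2 c3 c0' c1' δ z) = f z) → f' = 0 := by
    intro f f' h L hL
    refine hcomp (L := L) ?_
    rw [show (fun z => L (timeForm τ χ c0 c1 c2 c3 c0' c1' δ z)) = f from funext hL]
    exact h
  let Lv := ContinuousLinearMap.snd ℝ Pt Val
  let Lp := ContinuousLinearMap.fst ℝ Pt Val
  let L3 := ContinuousLinearMap.snd ℝ ℝ (ℝ × ℝ × ℝ) ∘L ContinuousLinearMap.snd ℝ ℝ _ ∘L
    ContinuousLinearMap.snd ℝ ℝ _ ∘L Lv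
  have pτ := hasPd_time hI hτ hz d
  have pP := hasPd_time hI hτ' hz d
  have pQ := hasPd_time hI hτ'' hz d
  have pχ := hasPd_time hI hχ hz d
  have pχ' := hasPd_time hI hχ' hz d
  have p0 := hasPd_w0 d z
  have p1 := hasPd_w1 d z
  have p2 := hasPd_w2 d z
  have px : HasPd d (fun z : Ext => z.1.2.1) d.1.2.1 z :=
    hasPd_fst (hasPd_snd (hasPd_fst (hasPd_id _ _)))
  have pu : HasPd d (fun z : Ext => z.1.2.2) d.1.2.2 z :=
    hasPd_fst (hasPd_snd (hasPd_snd (hasPd_id _ _)))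
  have pW := ((HasPd.const (v := d) (z := z) c1).mul p1).add (HasPd.const c0)
  have dt : d.1.1 = 0 := (mul_eq_zero.1 (mk pτ (ContinuousLinearMap.fst ℝ ℝ _ ∘L Lp)
    fun z => rfl)).resolve_left hP
  have pM := (((HasPd.const (v := d) (z := z) c1').mul p1).add (HasPd.const c0')).div pW hW
  have d1 : d.2.2.2.2.2.1 = 0 := by
    have h := mk pM (ContinuousLinearMap.fst ℝ ℝ _ ∘L ContinuousLinearMap.snd ℝ ℝ _ ∘L L3)
      fun z => rfl
    rw [div_eq_zero_iff, or_iff_left (pow_ne_zero 2 hW)] at h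
    refine (mul_eq_zero.1 (?_ : δ * _ = 0)).resolve_left hδ0
    rw [hδ]
    linear_combination h
  rw [dt, mul_zero] at pP pQ pχ pχ'
  rw [d1] at p1
  have pW := (((HasPd.const (v := d) (z := z) c1).mul p1).add (HasPd.const c0)).val (b := 0)
    (by ring)
  have pM := (((((HasPd.const (v := d) (z := z) c1').mul p1).add (HasPd.const c0')).div
    pW hW)).val (b := 0) (by ring)
  have pPW := (pP.mul (pW.mul pW)).val (b := 0) (by ring)
  simp only [← sq] at pPW
  have nPW : deriv τ z.1.1 * (c1 * w1 z + c0) ^ 2 ≠ 0 := mul_ne_zero hP (pow_ne_zero 2 hW)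
  have d0 : d.2.2.2.2.1 = 0 := by
    have h := mk (p0.add (((HasPd.const δ).div pPW nPW).log (div_ne_zero hδ0 nPW)))
      (ContinuousLinearMap.fst ℝ ℝ _ ∘L L3) fun z => rfl
    simpa using h
  rw [d0] at p0
  have pE := p0.exp.val (b := 0) (by ring)
  have d2 : d.2.2.2.2.2.2 = 0 := by
    have h := mk ((((((HasPd.const δ).mul p2).div pW hW).sub ((((HasPd.const δ).mul pχ).mul
      pE).div pPW nPW)).add ((HasPd.const c2).mul pM)).add (HasPd.const c3))
      (ContinuousLinearMap.snd ℝ ℝ _ ∘L ContinuousLinearMap.snd ℝ ℝ _ ∘L L3) fun z => rfl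
    simpa [hδ0, hW] using h
  rw [d2] at p2
  have da2 : d.2.2.2.1 = 0 := by
    have h := mk (pPW.mul (hasPd_v2 d z)) (ContinuousLinearMap.fst ℝ ℝ _ ∘L
      ContinuousLinearMap.snd ℝ ℝ _ ∘L ContinuousLinearMap.snd ℝ ℝ _ ∘L Lv) fun z => rfl
    rw [zero_mul, zero_add] at h
    exact (mul_eq_zero.1 h).resolve_left nPW
  have dx : d.1.2.1 = 0 := by
    have h := mk (((pP.mul pW).mul px).add pχ) (ContinuousLinearMap.fst ℝ ℝ _ ∘L
      ContinuousLinearMap.snd ℝ ℝ _ ∘L Lp) fun z => rfl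
    refine (mul_eq_zero.1 (?_ : deriv τ z.1.1 * (c1 * w1 z + c0) * _ = 0)).resolve_left
      (mul_ne_zero hP hW)
    linear_combination h
  have du : d.1.2.2 = 0 := by
    have h := mk ((((pW.mul pu).sub (((HasPd.const c1).mul pE).mul px)).add (HasPd.const c2)).sub
      ((HasPd.const c1).mul p2)) (ContinuousLinearMap.snd ℝ ℝ _ ∘L
      ContinuousLinearMap.snd ℝ ℝ _ ∘L Lp) fun z => rfl
    refine (mul_eq_zero.1 (?_ : (c1 * w1 z + c0) * _ = 0)).resolve_left hW
    rw [dx] at h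
    linear_combination h
  have pB := (((hasPd_v11 d z).sub (pQ.div pP hP)).sub
    (((HasPd.const (2 * c1)).mul pE).div pW hW)).val (b := d.2.2.1) (by ring)
  have da11 : d.2.2.1 = 0 := by
    have h := mk (((HasPd.const 1).div pP hP).mul pB) (ContinuousLinearMap.fst ℝ ℝ _ ∘L
      ContinuousLinearMap.snd ℝ ℝ _ ∘L Lv) fun z => rfl
    refine (mul_eq_zero.1 (?_ : 1 / deriv τ z.1.1 * _ = 0)).resolve_left (one_div_ne_zero hP)
    linear_combination h
  rw [da11] at pB
  have da10 : d.2.1 = 0 := by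
    have h := mk ((((((pW.mul (hasPd_v10 d z)).sub (pχ'.div pP hP)).add (HasPd.const c2)).sub
      ((HasPd.const c1).mul p2)).sub ((pχ.div pP hP).mul pB))) (ContinuousLinearMap.fst ℝ ℝ _ ∘L
        Lv) fun z => rfl
    refine (mul_eq_zero.1 (?_ : (c1 * w1 z + c0) * _ = 0)).resolve_left hW
    linear_combination h
  exact Prod.ext (Prod.ext dt (Prod.ext dx du)) (Prod.ext da10 (Prod.ext da11 (Prod.ext da2
    (Prod.ext d0 (Prod.ext d1 d2)))))

theorem injOn_of_deriv (hI : IsOpen I) (hc : Convex ℝ I) (hτ : ContDiffOn ℝ ∞ τ I)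
    (hpos : ∀ t ∈ I, 0 < δ * deriv τ t) : Set.InjOn τ I := by
  have h : StrictMonoOn (fun t => δ * τ t) I :=
    strictMonoOn_of_deriv_pos hc (hτ.continuousOn.const_mul δ) fun t ht => by
      rw [hI.interior_eq] at ht
      rw [((smooth_at hτ hI ht).hasDerivAt.const_mul δ).deriv]
      exact hpos t ht
  intro s hs t ht hst
  exact h.injOn hs ht (by simp only [hst])

theorem exists_genEquiv_timeForm (hI : IsOpen I) (hc : Convex ℝ I) (hτ : ContDiffOn ℝ ∞ τ I)
    (hχ : ContDiffOn ℝ ∞ χ I) (hδ : δ = c1' * c0 - c0' * c1)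
    (hpos : ∀ t ∈ I, 0 < δ * deriv τ t) :
    ∃ e : OpenPartialHomeomorph Ext Ext, IsGenEquiv e ∧
      e.source = {z | z.1.1 ∈ I ∧ c1 * w1 z + c0 ≠ 0} ∧
      ∀ z, e z = timeForm τ χ c0 c1 c2 c3 c0' c1' δ z := by
  have hS : IsOpen {z : Ext | z.1.1 ∈ I ∧ c1 * w1 z + c0 ≠ 0} :=
    (hI.preimage (continuous_fst.comp continuous_fst)).inter (isOpen_ne_fun
      (by have := smooth_w1.continuous; fun_prop) continuous_const)
  obtain ⟨e, hs, he, hp⟩ := exists_pointTransformation hS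
    (smooth_timeForm (c0 := c0) (c1 := c1) (c2 := c2) (c3 := c3) (c0' := c0')
      (c1' := c1') hI hτ hχ hpos) (injOn_timeForm hδ (injOn_of_deriv hI hc hτ hpos) hpos)
    fun z hz => fderiv_timeForm_injective hI hτ hχ hδ hpos hz.1 hz.2
  refine ⟨e, HasForm.isGenEquiv hp ⟨fun t _ => τ t, fun t _ _ _ => χ t, c0, c1, c2, c3, c0', c1',
    δ, hδ, ?_, ?_, ?_⟩, hs, he⟩
  · refine hτ.comp contDiffOn_fst ?_
    rintro z ⟨x, u, a10, a11, a2, y0, y2, hz⟩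
    rw [hs] at hz
    exact hz.1
  · refine hχ.comp contDiffOn_fst ?_
    rintro z ⟨x, u, a10, a11, a2, hz⟩
    rw [hs] at hz
    exact hz.1
  · intro t x u a10 a11 a2 y0 y1 y2 hz
    rw [hs] at hz
    have h1 : ∀ a b, Dbar a b (lift fun t _ => τ t) = fun t _ _ _ => deriv τ t := fun a b => by
      funext t y0 y1 y2
      exact Dbar_time a b τ t y0 y1 y2
    simp only [h1, Dbar_time, he]
    exact ⟨hz.2, hpos t hz.1, rfl⟩

end TimeForm

/-! ### Normalization -/

theorem pd_of_time {S : Set Pt} (hS : IsOpen S) {G : Pt → ℝ} {f : ℝ → ℝ} {I : Set ℝ}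
    (hI : IsOpen I) (hf : ContDiffOn ℝ ∞ f I) (hG : ∀ p ∈ S, f p.1 = G p) {p : Pt} (hp : p ∈ S)
    (hpI : p.1 ∈ I) : deriv f p.1 = pd bt G p := by
  rw [pd_congr hS (fun q hq => (hG q hq).symm) hp,
    (HasPd.comp_deriv (smooth_at hf hI hpI).hasDerivAt (hasPd_t bt p)).eq]
  simp [bt]

theorem exists_genEquiv_of_empty : ∃ e : OpenPartialHomeomorph Ext Ext, IsGenEquiv e := by
  obtain ⟨e, hs, -, hp⟩ := exists_pointTransformation (E := Ext) isOpen_empty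
    (Φ := id) contDiffOn_id (Set.injOn_empty _) (by simp)
  exact ⟨e, hp, fun Ω θ _ p _ h => absurd h (by simp [hs])⟩

/-- Convexity of the source makes the invariants constant, lets T and X be written as functions of
t, and makes the range of t an interval, on which τ is injective. -/
theorem isNormalizedGen : IsNormalizedGen := by
  intro Ω Ω' θ θ' φ ha hc
  have hS := φ.open_source
  by_cases hne : φ.source.Nonempty
  swap
  · obtain ⟨e, he⟩ := exists_genEquiv_of_empty
    exact ⟨e, he, fun p hp => absurd ⟨p, hp⟩ hne⟩
  obtain ⟨p₀, hp₀⟩ := hne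
  have hF := ha.smooth_frame
  set F := frame θ φ θ' with hFdef
  let k : Fin 7 → ℝ := fun i => F.inv i p₀
  have hk : ∀ p ∈ φ.source, ∀ i, F.inv i p = k i := fun p hp i =>
    eq_of_pd_zero hc hS (hF.inv i) (fun q hq v => ha.pd_inv hq i v) hp hp₀
  have hW : ∀ p ∈ φ.source, F.W p ≠ 0 := fun p hp => (ha.det hp).Uu
  have hP : ∀ p ∈ φ.source, F.P p ≠ 0 := fun p hp => by
    rw [hFdef, ha.frame_P hp]; exact (ha.det hp).Tt
  have hfm := fun p hp => Frame.formulas (hW p hp) (hP p hp) (hk p hp)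
  let I : Set ℝ := Prod.fst '' φ.source
  have hI : IsOpen I := isOpenMap_fst _ hS
  have hIc : Convex ℝ I := hc.linear_image (LinearMap.fst ℝ ℝ (ℝ × ℝ))
  have hmem : ∀ p ∈ φ.source, p.1 ∈ I := fun p hp => ⟨p, hp, rfl⟩
  obtain ⟨τ, hτ, sτ⟩ := exists_factor hS hc (smooth_cT ha.point.1)
    (ContinuousLinearMap.fst ℝ ℝ (ℝ × ℝ)) ((ContinuousLinearMap.id ℝ ℝ).smulRight bt)
    (fun w => by simp [bt]) (fun p hp d hd => by
      obtain ⟨a, b, c⟩ := d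
      obtain rfl : a = 0 := hd
      rw [pd_pt, (ha.det hp).Tx, (ha.det hp).Tu]; ring)
  obtain ⟨χ, hχ, sχ⟩ := exists_factor hS hc hF.X
    (ContinuousLinearMap.fst ℝ ℝ (ℝ × ℝ)) ((ContinuousLinearMap.id ℝ ℝ).smulRight bt)
    (fun w => by simp [bt]) (fun p hp d hd => by
      obtain ⟨a, b, c⟩ := d
      obtain rfl : a = 0 := hd
      rw [pd_pt, (ha.flow hp bx (by simp)).X.eq, (ha.flow hp bu (by simp)).X.eq]
      simp [bx, bu])
  change ContDiffOn ℝ ∞ τ I at sτ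
  change ContDiffOn ℝ ∞ χ I at sχ
  have dτ : ∀ p ∈ φ.source, deriv τ p.1 = pd bt (cT φ) p := fun p hp =>
    pd_of_time hS hI sτ hτ hp (hmem p hp)
  have dτ' : ∀ p ∈ φ.source, deriv τ p.1 = F.P p := fun p hp => by
    rw [dτ p hp, hFdef, ha.frame_P hp]
  have ddτ : ∀ p ∈ φ.source, deriv (deriv τ) p.1 = pd bt (pd bt (cT φ)) p := fun p hp =>
    pd_of_time hS hI (sτ.deriv_of_isOpen (m := ∞) hI (by simp)) dτ hp (hmem p hp)
  have dχ : ∀ p ∈ φ.source, deriv χ p.1 = pd bt F.X p := fun p hp =>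
    pd_of_time hS hI sχ hχ hp (hmem p hp)
  -- The constants are the values of the invariants at p₀, in the numbering of `Frame.inv`.
  obtain ⟨e, he, hes, hef⟩ := exists_genEquiv_timeForm (c0 := k 1) (c1 := k 0) (c2 := k 2)
    (c3 := k 6) (c0' := k 5) (c1' := k 4) (δ := k 3) hI hIc sτ sχ (hfm p₀ hp₀).1 (by
      rintro _ ⟨p, hp, rfl⟩
      rw [dτ' p hp]; exact (hfm p hp).2.1)
  refine ⟨e, he, fun p hp => ?_⟩
  obtain ⟨-, -, eW, eR, ev, e0, e1, e2⟩ := hfm p hp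
  have hWp := hW p hp
  have hPp := hP p hp
  have hfl := ha.flow hp bt (by simp)
  have hW1 : k 0 * w1 (sec θ p) + k 1 = F.W p := eW.symm
  have hR1 : k 0 * Real.exp (w0 (sec θ p)) = F.R p := eR.symm
  have hv1 : k 2 - k 0 * w2 (sec θ p) = F.v p := ev.symm
  have hXx : pd bx (cX φ) p = F.P p * F.W p := (div_mul_cancel₀ _ hWp).symm
  have h11 := hfl.rel11
  have h10 := hfl.rel10
  rw [← hFdef] at h11 h10
  have hB : θ'.A11 (cT φ p) (cX φ p) * F.P p = θ.A11 p.1 p.2.1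
      - pd bt (pd bt (cT φ)) p / F.P p - 2 * k 0 * Real.exp (w0 (sec θ p)) / F.W p := by
    rw [show 2 * k 0 * Real.exp (w0 (sec θ p)) = 2 * F.R p by rw [← hR1]; ring]
    field_simp
    linear_combination h11
  refine ⟨by rw [hes]; exact ⟨hmem p hp, by rw [show k 0 * w1 (p, θ.val p) + k 1 = _ from hW1];
                                            exact hWp⟩, ?_⟩
  rw [hef]
  change timeForm τ χ (k 1) (k 0) (k 2) (k 6) (k 5) (k 4) (k 3) (sec θ p) = _
  have s11 : v11 (sec θ p) = θ.A11 p.1 p.2.1 := rfl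
  have s1 : (sec θ p).1 = p := rfl
  have d1 := dτ' p hp
  have d2 := ddτ p hp
  have d3 := hχ p hp
  have d4 := dχ p hp
  change χ p.1 = _ at d3
  simp only [timeForm, s1, hW1, s11, d1, d2, d3, d4, ← hB]
  refine Prod.ext (Prod.ext (hτ p hp) (Prod.ext ?_ ?_)) (Prod.ext ?_ (Prod.ext ?_ (Prod.ext ?_
    (Prod.ext e0.symm (Prod.ext e1.symm e2.symm)))))
  · change _ + (cX φ p - pd bx (cX φ) p * p.2.1) = cX φ p
    rw [hXx]; ring
  · have : F.v p = cU φ p - F.W p * p.2.2 + F.R p * p.2.1 := by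
      change cU φ p - pd bu (cU φ) p * p.2.2 - pd bx (cU φ) p * p.2.1
        = cU φ p - pd bu (cU φ) p * p.2.2 + -pd bx (cU φ) p * p.2.1
      ring
    change F.W p * p.2.2 - k 0 * Real.exp (w0 (sec θ p)) * p.2.1 + k 2 - k 0 * w2 (sec θ p)
      = cU φ p
    rw [hR1]
    linear_combination hv1 + this
  · change F.W p * θ.A10 p.1 p.2.1 - _ + k 2 - _ - _ = θ'.A10 (cT φ p) (cX φ p)
    field_simp
    linear_combination hv1 * F.P p - h10
  · change _ = θ'.A11 (cT φ p) (cX φ p)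
    field_simp
  · change F.P p * F.W p ^ 2 * θ.A2 p.1 p.2.1 = θ'.A2 (cT φ p) (cX φ p)
    rw [(ha.det hp).B2, hFdef, ha.frame_P hp]
    change _ * (pd bu (cU φ) p) ^ 2 * _ = _
    ring

/-! ### Composition of maps between equations -/

theorem solvesAt_congr {θ θ' : ArbTuple} {f g : ℝ → ℝ → ℝ} {t x : ℝ}
    (h : ∀ᶠ w in 𝓝 ((t, x) : ℝ × ℝ), f w.1 w.2 = g w.1 w.2) (h10 : θ.A10 t x = θ'.A10 t x)
    (h11 : θ.A11 t x = θ'.A11 t x) (h2 : θ.A2 t x = θ'.A2 t x) :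
    SolvesAt θ f t x ↔ SolvesAt θ' g t x := by
  have h1 : dt f t x = dt g t x := by
    have hc : ContinuousAt (fun s : ℝ => (s, x)) t := by fun_prop
    exact Filter.EventuallyEq.deriv_eq (hc.eventually h)
  have hx : ∀ᶠ w in 𝓝 ((t, x) : ℝ × ℝ), dx f w.1 w.2 = dx g w.1 w.2 := by
    filter_upwards [h.eventually_nhds] with w hw
    have hc : ContinuousAt (fun y : ℝ => (w.1, y)) w.2 := by fun_prop
    exact Filter.EventuallyEq.deriv_eq (hc.eventually hw)
  have hxx : dx (dx f) t x = dx (dx g) t x := by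
    have hc : ContinuousAt (fun y : ℝ => (t, y)) x := by fun_prop
    exact Filter.EventuallyEq.deriv_eq (hc.eventually hx)
  have h0 := h.self_of_nhds
  have hx0 := hx.self_of_nhds
  simp only at h0 hx0
  rw [SolvesAt, SolvesAt, h1, hxx, hx0, h0, h10, h11, h2]

/-- For T = T(t) and X = X(t, x) the Jacobian along a graph is T_t X_x, so the prolongation is
defined at every jet. -/
theorem Det.jac_ne {A10 A11 A2 B10 B11 B2 : ℝ} {φ : Pt → Pt} {p : Pt}
    (h : Det A10 A11 A2 B10 B11 B2 φ p) (α β : ℝ) : jac φ p α β ≠ 0 := by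
  rw [jac, h.Tu, h.Tx, h.Xu, h.Xx]
  have := mul_ne_zero h.Tt (mul_ne_zero h.Uu h.Tt)
  simpa using this

section Comp

variable {φ φ' : Pt → Pt} {S S' : Set Pt} {p : Pt}

/-- The graph of `g` is the image under `φ` of the graph of `f`. -/
theorem MapsGraph.apply_eq {f g : ℝ → ℝ → ℝ} {t x : ℝ} (h : MapsGraph φ f g t x) :
    ∀ᶠ z in 𝓝 ((t, x) : ℝ × ℝ), (tAlong φ f z.1 z.2, xAlong φ f z.1 z.2,
      g (tAlong φ f z.1 z.2) (xAlong φ f z.1 z.2)) = φ (z.1, z.2, f z.1 z.2) := by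
  filter_upwards [h.graph] with z hz
  rw [hz]; rfl

/-- Given f and its image k under the composition, an intermediate graph g exists since all
Jacobians are nonzero. Its image under φ' has the same germ as k by uniqueness, and the two
equivalences compose. -/
theorem ConnectsAt.comp {θ θ₁ θ₂ : ArbTuple} (hS : IsOpen S) (hφ : ContDiffOn ℝ ∞ φ S)
    (hp : p ∈ S) (hJ : ∀ α β, jac φ p α β ≠ 0) (hS' : IsOpen S') (hφ' : ContDiffOn ℝ ∞ φ' S')
    (hp' : φ p ∈ S') (hJ' : ∀ α β, jac φ' (φ p) α β ≠ 0) (h : ConnectsAt φ θ θ₁ p)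
    (h' : ConnectsAt φ' θ₁ θ₂ (φ p)) : ConnectsAt (φ' ∘ φ) θ θ₂ p := by
  intro f k hfp hk
  have hpe : ((p.1, p.2.1, f p.1 p.2.1) : Pt) = p := by rw [hfp]
  obtain ⟨g, hg⟩ := exists_mapsGraph hS hφ hk.smooth_source (by rw [hpe]; exact hp)
    (by rw [hpe]; exact hJ _ _)
  have hge := hg.apply_eq.self_of_nhds
  simp only [hpe, tAlong, xAlong] at hge
  have hgp : g (φ p).1 (φ p).2.1 = (φ p).2.2 := congrArg (fun q : Pt => q.2.2) hge
  have hgt : SmoothNear g ((φ p).1, (φ p).2.1) := by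
    have := hg.smooth_target
    simp only [tAlong, xAlong, hpe] at this
    exact this
  obtain ⟨k', hk'⟩ := exists_mapsGraph hS' hφ' hgt (by rw [hge]; exact hp')
    (by rw [hge]; exact hJ' _ _)
  have hc := hg.continuousAt hS hφ (by rw [hpe]; exact hp)
  have ht0 : (tAlong φ f p.1 p.2.1, xAlong φ f p.1 p.2.1) = ((φ p).1, (φ p).2.1) := by
    simp only [tAlong, xAlong, hpe]
  have hev : ∀ᶠ z in 𝓝 ((p.1, p.2.1) : ℝ × ℝ), k' (tAlong (φ' ∘ φ) f z.1 z.2)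
      (xAlong (φ' ∘ φ) f z.1 z.2) = uAlong (φ' ∘ φ) f z.1 z.2 := by
    rw [ContinuousAt] at hc
    simp only [ht0] at hc
    filter_upwards [hc.eventually hk'.graph, hg.apply_eq] with z hz hz'
    simp only [tAlong, xAlong, uAlong] at hz hz'
    rw [hz'] at hz
    exact hz
  have hkm : MapsGraph (φ' ∘ φ) f k' p.1 p.2.1 := by
    refine ⟨hk.smooth_source, ?_, hk.jacobian_ne, hev⟩
    have := hk'.smooth_target
    simp only [tAlong, xAlong, hge] at this
    simp only [tAlong, xAlong, hpe]
    exact this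
  have huniq := hkm.unique (S := S ∩ φ ⁻¹' S') (hφ.continuousOn.isOpen_inter_preimage hS hS')
    (hφ'.comp (hφ.mono fun q hq => hq.1) fun q hq => hq.2) hk (by rw [hpe]; exact ⟨hp, hp'⟩)
  simp only [tAlong, xAlong, hpe] at huniq
  refine (h f g hfp hg).trans ((h' g k' hgp hk').trans ?_)
  exact solvesAt_congr huniq rfl rfl rfl

/-- If `φ` is a left inverse of `ψ`, then `ψ` connects equations in the opposite direction. -/
theorem ConnectsAt.of_leftInverse {ψ : Pt → Pt} {θ θ' θ'' : ArbTuple} (hS : IsOpen S)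
    (hψ : ContDiffOn ℝ ∞ ψ S) (hp : p ∈ S) (hS' : IsOpen S') (hφ : ContDiffOn ℝ ∞ φ S')
    (hp' : ψ p ∈ S') (hJ : ∀ α β, jac φ (ψ p) α β ≠ 0) (hinv : ∀ q ∈ S, φ (ψ q) = q)
    (h : ConnectsAt φ θ θ'' (ψ p)) (hval : θ''.val p = θ'.val p) : ConnectsAt ψ θ' θ p := by
  intro f g hfp hg
  have hpe : ((p.1, p.2.1, f p.1 p.2.1) : Pt) = p := by rw [hfp]
  have hge := hg.apply_eq.self_of_nhds
  simp only [hpe, tAlong, xAlong] at hge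
  have hgp : g (ψ p).1 (ψ p).2.1 = (ψ p).2.2 := congrArg (fun q : Pt => q.2.2) hge
  have hgt : SmoothNear g ((ψ p).1, (ψ p).2.1) := by
    have := hg.smooth_target
    simp only [tAlong, xAlong, hpe] at this
    exact this
  obtain ⟨k, hk⟩ := exists_mapsGraph hS' hφ hgt (by rw [hge]; exact hp')
    (by rw [hge]; exact hJ _ _)
  have hc := hg.continuousAt hS hψ (by rw [hpe]; exact hp)
  have ht0 : (tAlong ψ f p.1 p.2.1, xAlong ψ f p.1 p.2.1) = ((ψ p).1, (ψ p).2.1) := by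
    simp only [tAlong, xAlong, hpe]
  rw [ContinuousAt] at hc
  simp only [ht0] at hc
  obtain ⟨O, hO, hz, -, hOS⟩ := exists_graph_nhds hS hg.smooth_source
    (by rw [hpe]; exact hp)
  -- Applying φ to the image under ψ returns the original graph, so k is f as a germ.
  have hkf : ∀ᶠ z in 𝓝 ((p.1, p.2.1) : ℝ × ℝ), k z.1 z.2 = f z.1 z.2 := by
    filter_upwards [hc.eventually hk.graph, hg.apply_eq, hO.mem_nhds hz] with z hz1 hz2 hz3
    simp only [tAlong, xAlong, uAlong] at hz1 hz2
    rw [hz2, show φ (ψ (z.1, z.2, f z.1 z.2)) = (z.1, z.2, f z.1 z.2) from hinv _ (hOS z hz3)]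
      at hz1
    exact hz1
  refine Iff.symm ((h g k hgp hk).trans ?_)
  rw [hinv p hp]
  exact solvesAt_congr hkf (congrArg (fun v : Val => v.1) hval)
    (congrArg (fun v : Val => v.2.1) hval) (congrArg (fun v : Val => v.2.2.1) hval)

theorem connectsAt_id (θ : ArbTuple) (p : Pt) : ConnectsAt id θ θ p := by
  intro f g _ hg
  refine solvesAt_congr ?_ rfl rfl rfl
  filter_upwards [hg.graph] with z hz
  exact hz.symm

end Comp

/-! ### Closure properties of generalized equivalence transformations -/

theorem IsPointTransformation.trans {E : Type*} [NormedAddCommGroup E] [NormedSpace ℝ E]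
    {e e' : OpenPartialHomeomorph E E} (he : IsPointTransformation e)
    (he' : IsPointTransformation e') : IsPointTransformation (e.trans e') := by
  refine ⟨?_, ?_⟩
  · rw [OpenPartialHomeomorph.trans_source]
    exact he'.1.comp (he.1.mono fun x hx => hx.1) fun x hx => hx.2
  · rw [OpenPartialHomeomorph.trans_target]
    exact he.2.comp (he'.2.mono fun x hx => hx.1) fun x hx => hx.2

theorem isPointTransformation_ofSet {E : Type*} [NormedAddCommGroup E] [NormedSpace ℝ E]
    {S : Set E} (hS : IsOpen S) : IsPointTransformation (OpenPartialHomeomorph.ofSet S hS) :=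
  ⟨contDiffOn_id, contDiffOn_id⟩

theorem isGenEquiv_refl : IsGenEquiv (OpenPartialHomeomorph.refl Ext) := by
  refine ⟨⟨contDiffOn_id, contDiffOn_id⟩, fun Ω θ hθ p hp _ => ?_⟩
  exact ⟨OpenPartialHomeomorph.ofSet (tx ⁻¹' Ω) hθ.isOpen_preimage, Ω, θ, hp,
    ⟨hθ, hθ, isPointTransformation_ofSet _, fun _ h => h, fun _ h => h,
      fun p _ => connectsAt_id θ p⟩, fun p _ => ⟨Set.mem_univ _, rfl⟩⟩

theorem IsGenEquiv.trans {e e' : OpenPartialHomeomorph Ext Ext} (he : IsGenEquiv e)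
    (he' : IsGenEquiv e') : IsGenEquiv (e.trans e') := by
  refine ⟨he.1.trans he'.1, fun Ω θ hθ p hpΩ hp => ?_⟩
  rw [OpenPartialHomeomorph.trans_source] at hp
  obtain ⟨φ, Ω₁, θ₁, hpφ, ha, hg⟩ := he.2 Ω θ hθ p hpΩ hp.1
  have hp1 : (φ p, θ₁.val (φ p)) ∈ e'.source := (hg p hpφ).2 ▸ hp.2
  obtain ⟨φ', Ω₂, θ₂, hpφ', ha', hg'⟩ := he'.2 Ω₁ θ₁ ha.target (φ p) (ha.target_mem p hpφ) hp1
  refine ⟨φ.trans φ', Ω₂, θ₂, ⟨hpφ, hpφ'⟩, ⟨hθ, ha'.target, ha.point.trans ha'.point,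
    fun q hq => ha.source_mem q hq.1, fun q hq => ha'.target_mem _ hq.2, fun q hq => ?_⟩,
    fun q hq => ⟨⟨(hg q hq.1).1, ?_⟩, ?_⟩⟩
  · exact ConnectsAt.comp (φ := φ) (φ' := φ') φ.open_source ha.point.1 hq.1 (ha.det hq.1).jac_ne φ'.open_source
      ha'.point.1 hq.2 (ha'.det hq.2).jac_ne (ha.connects q hq.1) (ha'.connects _ hq.2)
  · change e (q, θ.val q) ∈ e'.source
    rw [(hg q hq.1).2]
    exact (hg' _ hq.2).1
  · change e' (e (q, θ.val q)) = _
    rw [(hg q hq.1).2]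
    exact (hg' _ hq.2).2

theorem IsGenEquiv.of_locally {e : OpenPartialHomeomorph Ext Ext}
    (h : ∀ z ∈ e.source, ∃ s, IsOpen s ∧ z ∈ s ∧ IsGenEquiv (e.restr s)) : IsGenEquiv e := by
  refine ⟨⟨fun z hz => ?_, fun w hw => ?_⟩, fun Ω θ hθ p hpΩ hp => ?_⟩
  · obtain ⟨s, hs, hzs, hes⟩ := h z hz
    have hm : z ∈ (e.restr s).source := by rw [e.restr_source' s hs]; exact ⟨hz, hzs⟩
    exact (hes.1.1.contDiffAt ((e.restr s).open_source.mem_nhds hm)).contDiffWithinAt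
  · obtain ⟨s, hs, hzs, hes⟩ := h _ (e.map_target hw)
    have hm : e.symm w ∈ (e.restr s).source := by
      rw [e.restr_source' s hs]; exact ⟨e.map_target hw, hzs⟩
    have hm' : w ∈ (e.restr s).target := by
      have := (e.restr s).map_source hm
      rwa [show e.restr s (e.symm w) = w from e.right_inv hw] at this
    exact (hes.1.2.contDiffAt ((e.restr s).open_target.mem_nhds hm')).contDiffWithinAt
  · obtain ⟨s, hs, hzs, hes⟩ := h _ hp
    obtain ⟨φ, Ω', θ', hpφ, ha, hg⟩ := hes.2 Ω θ hθ p hpΩ (by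
      rw [e.restr_source' s hs]; exact ⟨hp, hzs⟩)
    refine ⟨φ, Ω', θ', hpφ, ha, fun q hq => ⟨?_, (hg q hq).2⟩⟩
    have := (hg q hq).1
    rw [e.restr_source' s hs] at this
    exact this.1

theorem IsGenEquiv.congr {e e' : OpenPartialHomeomorph Ext Ext} (he : IsGenEquiv e)
    (h : e' ≈ e) : IsGenEquiv e' := by
  have hs := h.source_eq
  refine ⟨⟨?_, ?_⟩, fun Ω θ hθ p hpΩ hp => ?_⟩
  · exact (he.1.1.mono hs.le).congr h.eqOn
  · exact (he.1.2.mono h.target_eq.le).congr h.symm_eqOn_target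
  · obtain ⟨φ, Ω', θ', hpφ, ha, hg⟩ := he.2 Ω θ hθ p hpΩ (hs ▸ hp)
    refine ⟨φ, Ω', θ', hpφ, ha, fun q hq => ?_⟩
    have hm : (q, θ.val q) ∈ e'.source := hs ▸ (hg q hq).1
    exact ⟨hm, (h.eqOn hm).trans (hg q hq).2⟩

/-! ### Inverses of generalized equivalence transformations -/

/-- The injective A maps ker κ into ker κ', and the two kernels have equal dimension, so the
inclusion is an equality. Facts about the differential of e thereby pass to its inverse. -/
theorem ker_of_map_ker {E F : Type*} [NormedAddCommGroup E] [NormedSpace ℝ E]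
    [FiniteDimensional ℝ E] [AddCommGroup F] [Module ℝ F] [FiniteDimensional ℝ F] {A : E →L[ℝ] E}
    (hA : Function.Injective A) {κ κ' : E →ₗ[ℝ] F} (hκ : Function.Surjective κ)
    (hκ' : Function.Surjective κ') (h : ∀ d, κ d = 0 → κ' (A d) = 0) {d : E}
    (hd : κ' (A d) = 0) : κ d = 0 := by
  have h1 := LinearMap.finrank_range_add_finrank_ker κ
  have h2 := LinearMap.finrank_range_add_finrank_ker κ'
  rw [LinearMap.range_eq_top.2 hκ] at h1
  rw [LinearMap.range_eq_top.2 hκ'] at h2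
  have h3 : (LinearMap.ker κ).map (A : E →ₗ[ℝ] E) = LinearMap.ker κ' := by
    refine Submodule.eq_of_le_of_finrank_eq ?_ ?_
    · rintro _ ⟨d, hd, rfl⟩
      exact h d hd
    · rw [← (Submodule.equivMapOfInjective (A : E →ₗ[ℝ] E) hA (LinearMap.ker κ)).finrank_eq]
      omega
  have h4 : A d ∈ (LinearMap.ker κ).map (A : E →ₗ[ℝ] E) := by rw [h3]; exact hd
  obtain ⟨d', hd', hdd⟩ := h4
  rw [← hA hdd]
  exact hd'

/-- The contact forms at `z`. -/
noncomputable def contact (z : Ext) : Ext →ₗ[ℝ] ℝ × ℝ × ℝ where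
  toFun d := (w0 d - v11 z * d.1.1, w1 d - Real.exp (w0 z) * d.1.1,
    w2 d - v10 z * Real.exp (w0 z) * d.1.1)
  map_add' d d' := by
    ext <;> simp [w0, w1, w2] <;> ring
  map_smul' c d := by
    ext <;> simp [w0, w1, w2] <;> ring

theorem contact_surjective (z : Ext) : Function.Surjective (contact z) := fun y =>
  ⟨(0, (0, 0, 0, y)), by simp [contact, w0, w1, w2]⟩

/-- The projection to the variables which are functions of `t`. -/
def projTime : Ext →ₗ[ℝ] ℝ × ℝ × ℝ × ℝ × ℝ × ℝ where
  toFun d := (d.1.1, v10 d, v11 d, w0 d, w1 d, w2 d)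
  map_add' _ _ := rfl
  map_smul' _ _ := rfl

theorem projTime_surjective : Function.Surjective projTime := fun y =>
  ⟨((y.1, 0, 0), (y.2.1, y.2.2.1, 0, y.2.2.2)), rfl⟩

/-- The projection to all variables except for `u`. -/
def projNoU : Ext →ₗ[ℝ] ℝ × ℝ × Val where
  toFun d := (d.1.1, d.1.2.1, d.2)
  map_add' _ _ := rfl
  map_smul' _ _ := rfl

theorem projNoU_surjective : Function.Surjective projNoU := fun y =>
  ⟨((y.1, y.2.1, 0), y.2.2), rfl⟩

theorem pd_of_contact {G : Ext → ℝ} {z d : Ext} (hd : contact z d = 0) (hx : pd ex G z = 0)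
    (hu : pd eu G z = 0) (h10 : pd e10 G z = 0) (h11 : pd e11 G z = 0) (h2 : pd e2 G z = 0) :
    pd d G z = d.1.1 * total 0 0 0 G z := by
  have k0 : d.2.2.2.2.1 = v11 z * d.1.1 := sub_eq_zero.1 (congrArg Prod.fst hd)
  have k1 : d.2.2.2.2.2.1 = Real.exp (w0 z) * d.1.1 :=
    sub_eq_zero.1 (congrArg (fun y : ℝ × ℝ × ℝ => y.2.1) hd)
  have k2 : d.2.2.2.2.2.2 = v10 z * Real.exp (w0 z) * d.1.1 :=
    sub_eq_zero.1 (congrArg (fun y : ℝ × ℝ × ℝ => y.2.2) hd)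
  rw [pd_ext, hx, hu, h10, h11, h2, k0, k1, k2, total, h10, h11, h2]
  ring

theorem pd_comp_linear {E : Type*} [NormedAddCommGroup E] [NormedSpace ℝ E] {f : E → Ext} {z : E}
    (hf : DifferentiableAt ℝ f z) {g : Ext → ℝ} (hg : IsLinearMap ℝ g) (d : E) :
    pd d (fun z => g (f z)) z = g (fderiv ℝ f z d) := by
  let L : Ext →L[ℝ] ℝ := LinearMap.toContinuousLinearMap (hg.mk' g)
  change pd d (fun z => L (f z)) z = L _
  rw [(HasPd.comp L.differentiableAt hf.hasFDerivAt d).eq, pd, L.fderiv]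

section Inverse

variable {e : OpenPartialHomeomorph Ext Ext} {z : Ext} (he : IsGenEquiv e)

include he

theorem IsGenEquiv.pd_target (hz : z ∈ reg e) {g : Ext → ℝ}
    (hg : g = v10 ∨ g = v11 ∨ g = w0 ∨ g = w1 ∨ g = w2) :
    pd eu (fun z => g (e z)) z = 0 ∧ pd ex (fun z => g (e z)) z = 0 ∧
      pd e2 (fun z => g (e z)) z = 0 := by
  have hs : ContDiff ℝ ∞ g := by
    rcases hg with rfl | rfl | rfl | rfl | rfl
    exacts [smooth_v10, smooth_v11, smooth_w0, smooth_w1, smooth_w2]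
  have hG := smooth_comp_ext hs he.smooth_reg
  have key : ∀ (Ω Ω' : Set (ℝ × ℝ)) (θ θ' : ArbTuple) (φ : OpenPartialHomeomorph Pt Pt),
      IsAdmissible Ω θ φ Ω' θ' → Generates e θ φ θ' → z.1 ∈ φ.source → 
      pd bu (fun q => g (e (sec θ q))) z.1 = 0 ∧ pd bx (fun q => g (e (sec θ q))) z.1 = 0 := by
    intro Ω Ω' θ θ' φ ha hgen hp
    have hk : ∀ {f : ℝ → ℝ → ℝ}, SmoothOn f Ω' → (∀ t x, (t, x) ∈ Ω' → dx f t x = 0) →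
        (∀ q ∈ φ.source, g (e (sec θ q)) = f (cT φ q) (cX φ q)) →
        pd bu (fun q => g (e (sec θ q))) z.1 = 0 ∧ pd bx (fun q => g (e (sec θ q))) z.1 = 0 := by
      intro f hf hx hq
      rw [pd_congr φ.open_source hq hp, pd_congr φ.open_source hq hp]
      exact ⟨(ha.hasPd_target_u hp hf).eq, (ha.hasPd_target_x hp hf hx).eq⟩
    rcases hg with rfl | rfl | rfl | rfl | rfl
    · exact hk ha.target.smooth_A10 ha.target.A10_x fun q hq => by rw [hgen.apply hq]; rfl
    · exact hk ha.target.smooth_A11 ha.target.A11_x fun q hq => by rw [hgen.apply hq]; rfl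
    · exact hk ha.target.smooth_Y0 ha.target.Y0_x fun q hq => by rw [hgen.apply hq]; rfl
    · exact hk ha.target.smooth_Y1 ha.target.Y1_x fun q hq => by rw [hgen.apply hq]; rfl
    · exact hk ha.target.smooth_Y2 ha.target.Y2_x fun q hq => by rw [hgen.apply hq]; rfl
  exact ⟨he.pd_eu hG hz fun Ω Ω' θ θ' φ ha hgen hp _ => (key Ω Ω' θ θ' φ ha hgen hp).1,
    he.pd_ex hG hz fun Ω Ω' θ θ' φ ha hgen hp _ => (key Ω Ω' θ θ' φ ha hgen hp).2⟩

theorem IsGenEquiv.total_target (hz : z ∈ reg e) {g : Ext → ℝ} {c : ℝ}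
    (hg : g = w0 ∧ c = v11 (e z) ∨ g = w1 ∧ c = Real.exp (w0 (e z)) ∨
      g = w2 ∧ c = v10 (e z) * Real.exp (w0 (e z))) :
    pd e10 (fun z => g (e z)) z = 0 ∧ pd e11 (fun z => g (e z)) z = 0 ∧
      total 0 0 0 (fun z => g (e z)) z = c * (extFrame e).P z := by
  have hs : ContDiff ℝ ∞ g := by
    rcases hg with ⟨rfl, -⟩ | ⟨rfl, -⟩ | ⟨rfl, -⟩
    exacts [smooth_w0, smooth_w1, smooth_w2]
  obtain ⟨h1, h2, -, h3⟩ := he.total_eq (smooth_comp_ext hs he.smooth_reg) hz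
    (c := c * (extFrame e).P z) fun Ω Ω' θ θ' φ ha hgen hp hsec => by
      have hP := (hgen.frame_eq he ha hp).2.2.1
      rw [hsec, ha.frame_P hp] at hP
      have hval := hgen.apply hp
      rw [hsec] at hval
      have hk : ∀ {f : ℝ → ℝ → ℝ}, SmoothOn f Ω' → (∀ t x, (t, x) ∈ Ω' → dx f t x = 0) →
          (∀ q ∈ φ.source, g (e (sec θ q)) = f (cT φ q) (cX φ q)) →
          dt f (cT φ z.1) (cX φ z.1) = c →
          pd bt (fun q => g (e (sec θ q))) z.1 = c * (extFrame e).P z := by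
        intro f hf hx hq hc
        rw [pd_congr φ.open_source hq hp, (ha.hasPd_target_t hp hf hx).eq, hc, hP, mul_comm]
      have hm := ha.target_mem z.1 hp
      rcases hg with ⟨rfl, rfl⟩ | ⟨rfl, rfl⟩ | ⟨rfl, rfl⟩
      · refine hk ha.target.smooth_Y0 ha.target.Y0_x (fun q hq => by rw [hgen.apply hq]; rfl) ?_
        rw [hval]; exact ha.target.Y0_t _ _ hm
      · refine hk ha.target.smooth_Y1 ha.target.Y1_x (fun q hq => by rw [hgen.apply hq]; rfl) ?_
        rw [hval]; exact ha.target.Y1_t _ _ hm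
      · refine hk ha.target.smooth_Y2 ha.target.Y2_x (fun q hq => by rw [hgen.apply hq]; rfl) ?_
        rw [hval]; exact ha.target.Y2_t _ _ hm
  exact ⟨h1, h2, h3⟩

/-- On the kernel of the contact forms, a function free of x, u, A¹⁰, A¹¹, A² changes by its total
derivative times dt. Both the new Y's and the new t are of this kind, with total derivatives in the
ratio prescribed by the class. -/
theorem IsGenEquiv.contact_map (hz : z ∈ reg e) {d : Ext} (hd : contact z d = 0) :
    contact (e z) (fderiv ℝ e z d) = 0 := by
  have hdiff := smooth_at he.1.1 e.open_source hz.1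
  have hT : (fderiv ℝ e z d).1.1 = d.1.1 * (extFrame e).P z := by
    rw [← pd_comp_linear hdiff (g := fun z => z.1.1) ⟨fun _ _ => rfl, fun _ _ => rfl⟩ d,
      ← he.source_total_T hz.1]
    exact pd_of_contact hd (he.pd_T hz).2.1 (he.pd_T hz).1 (he.pd_X_T hz).2.1
      (he.pd_X_T hz).2.2.1 (he.pd_T hz).2.2
  have key : ∀ {g : Ext → ℝ} {c : ℝ}, IsLinearMap ℝ g → (g = w0 ∨ g = w1 ∨ g = w2) →
      (g = w0 ∧ c = v11 (e z) ∨ g = w1 ∧ c = Real.exp (w0 (e z)) ∨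
        g = w2 ∧ c = v10 (e z) * Real.exp (w0 (e z))) →
      g (fderiv ℝ e z d) - c * (fderiv ℝ e z d).1.1 = 0 := by
    intro g c hl hg hgc
    obtain ⟨k1, k2, k3⟩ := he.total_target hz hgc
    obtain ⟨q1, q2, q3⟩ := he.pd_target hz (g := g) (by tauto)
    rw [← pd_comp_linear hdiff hl, pd_of_contact hd q2 q1 k1 k2 q3, k3, hT]
    ring
  exact Prod.ext (key ⟨fun _ _ => rfl, fun _ _ => rfl⟩ (by simp) (Or.inl ⟨rfl, rfl⟩))
    (Prod.ext (key ⟨fun _ _ => rfl, fun _ _ => rfl⟩ (by simp) (Or.inr (Or.inl ⟨rfl, rfl⟩)))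
      (key ⟨fun _ _ => rfl, fun _ _ => rfl⟩ (by simp) (Or.inr (Or.inr ⟨rfl, rfl⟩))))

theorem IsGenEquiv.projTime_map (hz : z ∈ reg e) {d : Ext} (hd : projTime d = 0) :
    projTime (fderiv ℝ e z d) = 0 := by
  have hdiff := smooth_at he.1.1 e.open_source hz.1
  obtain ⟨⟨t, x, u⟩, a10, a11, a2, y0, y1, y2⟩ := d
  simp only [projTime, LinearMap.coe_mk, AddHom.coe_mk, v10, v11, w0, w1, w2, Prod.mk_eq_zero]
    at hd
  obtain ⟨rfl, rfl, rfl, rfl, rfl, rfl⟩ := hd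
  have key : ∀ {g : Ext → ℝ}, IsLinearMap ℝ g →
      (g = v10 ∨ g = v11 ∨ g = w0 ∨ g = w1 ∨ g = w2) →
      g (fderiv ℝ e z ((0, x, u), (0, 0, a2, 0, 0, 0))) = 0 := by
    intro g hl hg
    obtain ⟨q1, q2, q3⟩ := he.pd_target hz hg
    rw [← pd_comp_linear hdiff hl, pd_ext, q1, q2, q3]
    ring
  refine Prod.ext ?_ (Prod.ext (key (g := v10) ⟨fun _ _ => rfl, fun _ _ => rfl⟩ (by tauto))
    (Prod.ext (key (g := v11) ⟨fun _ _ => rfl, fun _ _ => rfl⟩ (by tauto))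
    (Prod.ext (key (g := w0) ⟨fun _ _ => rfl, fun _ _ => rfl⟩ (by tauto))
    (Prod.ext (key (g := w1) ⟨fun _ _ => rfl, fun _ _ => rfl⟩ (by tauto))
    (key (g := w2) ⟨fun _ _ => rfl, fun _ _ => rfl⟩ (by tauto))))))
  exact (pd_comp_linear hdiff (g := fun z => z.1.1) ⟨fun _ _ => rfl, fun _ _ => rfl⟩ _).symm.trans
    (he.source_T hz.1 rfl rfl)

theorem IsGenEquiv.projNoU_map (hz : z ∈ reg e) {d : Ext} (hd : projNoU d = 0) :
    projNoU (fderiv ℝ e z d) = 0 := by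
  have hdiff := smooth_at he.1.1 e.open_source hz.1
  obtain ⟨⟨t, x, u⟩, v⟩ := d
  simp only [projNoU, LinearMap.coe_mk, AddHom.coe_mk, Prod.mk_eq_zero] at hd
  obtain ⟨rfl, rfl, rfl⟩ := hd
  have hp := he.projTime_map hz (d := ((0, 0, u), 0)) rfl
  have hx : (fderiv ℝ e z ((0, 0, u), 0)).1.2.1 = 0 := by
    rw [← pd_comp_linear hdiff (g := fun z => z.1.2.1) ⟨fun _ _ => rfl, fun _ _ => rfl⟩]
    change pd _ (eX e) z = 0
    rw [pd_ext, he.pd_eu_X hz]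
    simp
  have h2 : v2 (fderiv ℝ e z ((0, 0, u), 0)) = 0 := by
    rw [← pd_comp_linear hdiff (g := v2) ⟨fun _ _ => rfl, fun _ _ => rfl⟩, pd_ext,
      show pd eu (fun z => v2 (e z)) z = 0 from
        he.pd_eu (smooth_comp_ext smooth_v2 he.smooth_reg) hz fun Ω Ω' θ θ' φ ha hgen hp _ => by
          rw [pd_congr φ.open_source (G := fun q => θ'.A2 (cT φ q) (cX φ q))
            (fun q hq => by simp only [hgen.apply hq]; rfl) hp]
          exact (ha.hasPd_target_u hp ha.target.smooth_A2).eq]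
    simp
  have p1 : (fderiv ℝ e z ((0, 0, u), 0)).1.1 = 0 := congrArg (fun y : ℝ × ℝ × ℝ × ℝ × ℝ × ℝ => y.1) hp
  have q0 : v10 (fderiv ℝ e z ((0, 0, u), 0)) = 0 :=
    congrArg (fun y : ℝ × ℝ × ℝ × ℝ × ℝ × ℝ => y.2.1) hp
  have q1 : v11 (fderiv ℝ e z ((0, 0, u), 0)) = 0 :=
    congrArg (fun y : ℝ × ℝ × ℝ × ℝ × ℝ × ℝ => y.2.2.1) hp
  have q2 : w0 (fderiv ℝ e z ((0, 0, u), 0)) = 0 :=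
    congrArg (fun y : ℝ × ℝ × ℝ × ℝ × ℝ × ℝ => y.2.2.2.1) hp
  have q3 : w1 (fderiv ℝ e z ((0, 0, u), 0)) = 0 :=
    congrArg (fun y : ℝ × ℝ × ℝ × ℝ × ℝ × ℝ => y.2.2.2.2.1) hp
  have q4 : w2 (fderiv ℝ e z ((0, 0, u), 0)) = 0 :=
    congrArg (fun y : ℝ × ℝ × ℝ × ℝ × ℝ × ℝ => y.2.2.2.2.2) hp
  have hv : (fderiv ℝ e z ((0, 0, u), 0)).2 = 0 :=
    Prod.ext q0 (Prod.ext q1 (Prod.ext h2 (Prod.ext q2 (Prod.ext q3 q4))))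
  exact Prod.ext p1 (Prod.ext hx hv)

/-- The composition of e with e⁻¹ ∘ sec θ is sec θ, whose tangent vectors lie in the kernels of the
contact forms, of `projTime` when d.1 = 0, and of `projNoU` for the direction of u. By
`ker_of_map_ker` the tangent vectors of e⁻¹ ∘ sec θ lie in the corresponding kernels. -/
theorem IsGenEquiv.graphlike_symm {Ω : Set (ℝ × ℝ)} {θ : ArbTuple} (hθ : IsArbTuple Ω θ) {q : Pt}
    (hq : q ∈ domainOver Ω θ e.target) : Graphlike (fun q => e.symm (sec θ q)) q := by
  set ζ : Pt → Ext := fun q => e.symm (sec θ q) with hζ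
  have hN := hθ.isOpen_domainOver e.open_target
  have hsm : ContDiffOn ℝ ∞ ζ (domainOver Ω θ e.target) :=
    he.1.2.comp (hθ.smooth_sec.mono fun q hq => hq.1) fun q hq => hq.2
  have hd := smooth_at hsm hN hq
  have hzs : ζ q ∈ e.source := e.map_target hq.2
  have hez : e (ζ q) = sec θ q := e.right_inv hq.2
  -- The new A² is a multiple of the old one, so a nonzero image has a nonzero preimage and ζ q is a
  -- regular point.
  have hz2 : v2 (ζ q) ≠ 0 := by
    have h := he.source_v2 hzs
    rw [hez] at h
    have h0 : v2 (sec θ q) ≠ 0 := hθ.A2_ne _ _ hq.1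
    rw [h] at h0
    exact right_ne_zero_of_mul h0
  have hz : ζ q ∈ reg e := ⟨hzs, hz2⟩
  have hA := (he.1.fderiv_bijective hzs).1
  obtain ⟨L, hL, hLv⟩ := hθ.hasFDerivAt_sec hq.1
  have hAL : ∀ v, fderiv ℝ e (ζ q) (fderiv ℝ ζ q v) = L v := by
    intro v
    have h1 := (smooth_at he.1.1 e.open_source hzs).hasFDerivAt.comp q hd.hasFDerivAt
    have h2 := hL.congr_of_eventuallyEq (Filter.eventuallyEq_of_mem (hN.mem_nhds hq)
      fun y hy => (e.right_inv hy.2 : (e ∘ ζ) y = sec θ y))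
    exact congrArg (fun M : Pt →L[ℝ] Ext => M v) (h1.unique h2)
  have hK : ∀ v, contact (ζ q) (fderiv ℝ ζ q v) = 0 := fun v =>
    ker_of_map_ker hA (contact_surjective _) (contact_surjective (e (ζ q)))
      (fun d hd => he.contact_map hz hd) (by
        rw [hAL, hez, hLv]
        refine Prod.ext (sub_eq_zero.2 (mul_comm _ _)) (Prod.ext (sub_eq_zero.2 (mul_comm _ _))
          (sub_eq_zero.2 (mul_comm _ _))))
  have hT : ∀ v : Pt, v.1 = 0 → projTime (fderiv ℝ ζ q v) = 0 := fun v hv =>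
    ker_of_map_ker hA projTime_surjective projTime_surjective
      (fun d hd => he.projTime_map hz hd) (by
        rw [hAL, hLv]
        simp [projTime, hv, v10, v11, w0, w1, w2])
  have hU : projNoU (fderiv ℝ ζ q bu) = 0 :=
    ker_of_map_ker hA projNoU_surjective projNoU_surjective
      (fun d hd => he.projNoU_map hz hd) (by
        rw [hAL, hLv]
        simp [projNoU, bu])
  have hc : ∀ {g : Ext → ℝ}, IsLinearMap ℝ g → ∀ v, pd v (fun q => g (ζ q)) q
      = g (fderiv ℝ ζ q v) := fun hg v => pd_comp_linear hd hg v
  have hct : ∀ v, pd v (cT fun q => (ζ q).1) q = (fderiv ℝ ζ q v).1.1 := fun v =>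
    hc (g := fun z => z.1.1) ⟨fun _ _ => rfl, fun _ _ => rfl⟩ v
  have hcx : ∀ v, pd v (cX fun q => (ζ q).1) q = (fderiv ℝ ζ q v).1.2.1 := fun v =>
    hc (g := fun z => z.1.2.1) ⟨fun _ _ => rfl, fun _ _ => rfl⟩ v
  have hcu : ∀ v, pd v (cU fun q => (ζ q).1) q = (fderiv ℝ ζ q v).1.2.2 := fun v =>
    hc (g := fun z => z.1.2.2) ⟨fun _ _ => rfl, fun _ _ => rfl⟩ v
  have hae : ∀ {g : Ext → ℝ}, IsLinearMap ℝ g → ∀ d, pd d (fun z => g (e z)) (ζ q)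
      = g (fderiv ℝ e (ζ q) d) := fun hg d =>
    pd_comp_linear (smooth_at he.1.1 e.open_source hzs) hg d
  have htime : ∀ v : Pt, v.1 = 0 → ∀ g : Ext → ℝ,
      g = v10 ∨ g = v11 ∨ g = w0 ∨ g = w1 ∨ g = w2 → pd v (fun q => g (ζ q)) q = 0 := by
    intro v hv g hg
    have h := hT v hv
    rcases hg with rfl | rfl | rfl | rfl | rfl
    · rw [hc ⟨fun _ _ => rfl, fun _ _ => rfl⟩]
      exact congrArg (fun y : ℝ × ℝ × ℝ × ℝ × ℝ × ℝ => y.2.1) h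
    · rw [hc ⟨fun _ _ => rfl, fun _ _ => rfl⟩]
      exact congrArg (fun y : ℝ × ℝ × ℝ × ℝ × ℝ × ℝ => y.2.2.1) h
    · rw [hc ⟨fun _ _ => rfl, fun _ _ => rfl⟩]
      exact congrArg (fun y : ℝ × ℝ × ℝ × ℝ × ℝ × ℝ => y.2.2.2.1) h
    · rw [hc ⟨fun _ _ => rfl, fun _ _ => rfl⟩]
      exact congrArg (fun y : ℝ × ℝ × ℝ × ℝ × ℝ × ℝ => y.2.2.2.2.1) h
    · rw [hc ⟨fun _ _ => rfl, fun _ _ => rfl⟩]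
      exact congrArg (fun y : ℝ × ℝ × ℝ × ℝ × ℝ × ℝ => y.2.2.2.2.2) h
  exact {
    Tx := by rw [hct]; exact congrArg Prod.fst (hT bx rfl)
    Tu := by rw [hct]; exact congrArg Prod.fst (hT bu rfl)
    -- If t did not change along ζ, the contact forms would freeze Y¹ as well; then T(t, Y¹) would
    -- be stationary, although T ∘ ζ = t.
    Tt := by
      rw [hct]
      intro h0
      have h1 : w1 (fderiv ℝ ζ q bt) - Real.exp (w0 (ζ q)) * (fderiv ℝ ζ q bt).1.1 = 0 :=
        congrArg (fun y : ℝ × ℝ × ℝ => y.2.1) (hK bt)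
      rw [h0, mul_zero, sub_zero] at h1
      have h2 : pd _ (eT e) (ζ q) = _ :=
        hae (g := fun z => z.1.1) ⟨fun _ _ => rfl, fun _ _ => rfl⟩ (fderiv ℝ ζ q bt)
      rw [he.source_T hzs h0 h1, hAL, hLv] at h2
      exact zero_ne_one h2
    Xu := by rw [hcx]; exact congrArg (fun y : ℝ × ℝ × Val => y.2.1) hU
    Xx := by
      rw [hcx]
      intro h0
      have h1 := hT bx rfl
      have h2 : pd _ (eX e) (ζ q) = _ :=
        hae (g := fun z => z.1.2.1) ⟨fun _ _ => rfl, fun _ _ => rfl⟩ (fderiv ℝ ζ q bx)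
      simp only [projTime, LinearMap.coe_mk, AddHom.coe_mk, Prod.mk_eq_zero, v10, v11, w0, w1, w2]
        at h1
      obtain ⟨k1, k2, k3, k4, k5, k6⟩ := h1
      rw [hAL, hLv, pd_ext, k1, k2, k3, k4, k5, k6, h0, he.pd_eu_X hz, (he.pd_X_T hz).1] at h2
      simp [bx] at h2
    Uu := by
      rw [hcu]
      intro h0
      have k1 : (fderiv ℝ ζ q bu).1.1 = 0 := congrArg (fun y : ℝ × ℝ × Val => y.1) hU
      have k2 : (fderiv ℝ ζ q bu).1.2.1 = 0 := congrArg (fun y : ℝ × ℝ × Val => y.2.1) hU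
      have k3 : (fderiv ℝ ζ q bu).2 = 0 := congrArg (fun y : ℝ × ℝ × Val => y.2.2) hU
      have h1 : fderiv ℝ ζ q bu = 0 := Prod.ext (Prod.ext k1 (Prod.ext k2 h0)) k3
      have h2 := hAL bu
      rw [h1, map_zero, hLv] at h2
      exact zero_ne_one (congrArg (fun z : Ext => z.1.2.2) h2)
    time := fun g hg => ⟨htime bx rfl g hg, htime bu rfl g hg⟩
    A2u := by
      rw [hc ⟨fun _ _ => rfl, fun _ _ => rfl⟩]
      exact congrArg (fun y : ℝ × ℝ × Val => y.2.2.2.2.1) hU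
    A2_ne := hz2
    Y0 := by
      rw [hct, hc ⟨fun _ _ => rfl, fun _ _ => rfl⟩]
      exact sub_eq_zero.1 (congrArg Prod.fst (hK bt))
    Y1 := by
      rw [hct, hc ⟨fun _ _ => rfl, fun _ _ => rfl⟩]
      exact sub_eq_zero.1 (congrArg (fun y : ℝ × ℝ × ℝ => y.2.1) (hK bt))
    Y2 := by
      rw [hct, hc ⟨fun _ _ => rfl, fun _ _ => rfl⟩]
      exact sub_eq_zero.1 (congrArg (fun y : ℝ × ℝ × ℝ => y.2.2) (hK bt)) }

theorem IsGenEquiv.symm : IsGenEquiv e.symm := by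
  refine ⟨⟨he.1.2, he.1.1⟩, fun Ω θ hθ p hpΩ hp => ?_⟩
  have hN := hθ.isOpen_domainOver e.open_target
  have hsm : ContDiffOn ℝ ∞ (fun q => e.symm (sec θ q)) (domainOver Ω θ e.target) :=
    he.1.2.comp (hθ.smooth_sec.mono fun q hq => hq.1) fun q hq => hq.2
  obtain ⟨ψ, Ω₁, η, hpψ, hψN, hψ, hη, hψe, hval⟩ := Graphlike.exists_tuple hN hsm
    (fun q hq => he.graphlike_symm hθ hq) (p := p) ⟨hpΩ, hp⟩
  have hsec : ∀ q ∈ ψ.source, sec η (ψ q) = e.symm (sec θ q) := fun q hq =>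
    Prod.ext (hψe q) (hval q hq).2
  obtain ⟨φ, Ω₂, θ₂, hpφ, ha, hg⟩ := he.2 Ω₁ η hη (ψ p) (hval p hpψ).1 (by
    change sec η (ψ p) ∈ e.source
    rw [hsec p hpψ]
    exact e.map_target hp)
  have hret : ∀ q ∈ ψ.source, ψ q ∈ φ.source → φ (ψ q) = q ∧ θ₂.val q = θ.val q := by
    intro q hq hq'
    have h := hg.apply hq'
    rw [hsec q hq, e.right_inv (hψN hq).2] at h
    have h1 : φ (ψ q) = q := (congrArg Prod.fst h).symm
    have h2 : θ.val q = θ₂.val (φ (ψ q)) := congrArg Prod.snd h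
    exact ⟨h1, by rw [h2, h1]⟩
  -- Restriction to the points that ψ sends into the domain of φ, where φ is a left inverse of ψ.
  set ψ' := ψ.trans (OpenPartialHomeomorph.ofSet φ.source φ.open_source)
  have hψ' : IsPointTransformation ψ' := hψ.trans (isPointTransformation_ofSet _)
  refine ⟨ψ', Ω₁, η, ⟨hpψ, hpφ⟩, ⟨hθ, hη, hψ', fun q hq => (hψN hq.1).1,
    fun q hq => (hval q hq.1).1, fun q hq => ?_⟩, fun q hq => ⟨(hψN hq.1).2, (hsec q hq.1).symm⟩⟩
  exact ConnectsAt.of_leftInverse ψ'.open_source hψ'.1 hq φ.open_source ha.point.1 hq.2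
    (ha.det hq.2).jac_ne (fun y hy => (hret y hy.1 hy.2).1) (ha.connects _ hq.2)
    (hret q hq.1 hq.2).2

end Inverse

/-! ### The generalized equivalence group -/

/-- The pseudogroup of generalized equivalence transformations. -/
def genEquivGroupoid : StructureGroupoid Ext where
  members := {e | IsGenEquiv e}
  trans' _ _ he he' := IsGenEquiv.trans he he'
  symm' _ he := IsGenEquiv.symm he
  id_mem' := isGenEquiv_refl
  locality' _ h := IsGenEquiv.of_locally h
  mem_of_eqOnSource' _ _ he h := IsGenEquiv.congr he h

end BurgersL0

theorem mainTheorem4 :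
    BurgersL0.IsNormalizedGen ∧
    ∃ G : StructureGroupoid BurgersL0.Ext,
      (∀ e : OpenPartialHomeomorph BurgersL0.Ext BurgersL0.Ext,
        e ∈ G ↔ BurgersL0.IsGenEquiv e) ∧
      (∀ e : OpenPartialHomeomorph BurgersL0.Ext BurgersL0.Ext, Convex ℝ e.source →
        (e ∈ G ↔ BurgersL0.IsPointTransformation e ∧ BurgersL0.HasForm e)) := by
  exact ⟨BurgersL0.isNormalizedGen, BurgersL0.genEquivGroupoid, fun _ => Iff.rfl, fun _ hc =>
    ⟨fun he => ⟨he.1, BurgersL0.IsGenEquiv.hasForm he hc⟩, fun h => h.2.isGenEquiv h.1⟩⟩
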